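/- **Definitions.** $C_D$ is the set of smooth $\phi:(0,\infty)\to\mathbb C$ with $|\phi(u)|\le Cu^k$ for some $C>0$, $k\ge 0$. For $\phi\in C_D$ put $L_\phi(s)=\sum_{n\ge1}\phi(n)n^{-s}$ for $\mathrm{Re}(s)$ large, and its continuation. The Selberg class $\mathcal S$ consists of the functions $L$ such that: (S1) $L(s)=\sum_{n\ge1}a(n)n^{-s}$ converges absolutely for $\mathrm{Re}(s)>1$; (S2) $(s-1)^mL(s)$ is entire of finite order for some integer $m\ge0$, the smallest such $m$ being denoted $m_L$; (S3) for some $Q>0$, $r\ge1$, $\lambda_j>0$, $\mathrm{Re}(\mu_j)\ge0$ and $|\omega|=1$, the function $L^*(s)=Q^s\prod_{j=1}^r\Gamma(\lambda_js+\mu_j)L(s)$ satisfies $L^*(s)=\omega\overline{L^*(1-\bar s)}$; (S4) $a(n)\ll_\varepsilon n^\varepsilon$ for every $\varepsilon>0$; (S5) $\log L(s)=\sum_{n\ge1}b(n)n^{-s}$ for $\mathrm{Re}(s)>1$, with $b(n)=0$ unless $n=p^m$, $m\ge1$, and $b(n)\ll n^\theta$ for some $\theta<\frac12$. For $N\ge1$,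 $L\in\mathcal S$ has a rank $N$ Euler product if for every prime $p$ the Euler factor $L_p(s)=\sum_{m\ge0}a(p^m)p^{-ms}$ equals $P_p(p^{-s})^{-1}$ with $P_p(X)=1-c_1(p)X-\cdots-c_N(p)X^N$, and $c_N(p)\ne0$ for all but finitely many $p$. $C_L(N)$ is the set of $\phi\in C_D$ such that $|\phi(u)|\le Cu^2$ on $(0,\infty)$ for some $C>0$, $L_\phi\in\mathcal S$, and $L_\phi$ has a rank $N$ Euler product; one then writes $m_\phi=m_{L_\phi}$, $c_{\phi,j}(p)=c_j(p)$ and $S_\phi=\{p: c_{\phi,N}(p)=0\}$. Put $\zeta^*(s)=\pi^{-s/2}\Gamma(s/2)\zeta(s)$. **Theorem.** Let $N\ge2$, $\phi\in C_L(N)$, and let $h:(0,\infty)\to\mathbb C$ be smooth with compact support in $(0,\infty)$. For $x>0$ put $$J_\phi(x;h)=\sum_{p\notin S_\phi}c_{\phi,2}(p)\,h(xp^2)\log p .$$ Then for every $x>0$ the two sums over zeros below converge absolutely, and for every fixed $\varepsilon>0$, as $x\to+0$, $$m_\phi\int_0^\infty h(xu)\,du-\sum_{L_\phi^*(\rho)=0}\int_0^\infty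 h(xu)u^\rho\frac{du}u=\int_0^\infty h(xu)\phi(u)\,du-\sum_{\zeta^*(\rho)=0}\int_0^\infty h(xu)\phi(u)u^\rho\frac{du}u+J_\phi(x;h)+O(x^{-\frac13-\varepsilon}),$$ where the sums run over all zeros of $L_\phi^*$ and of $\zeta^*$ respectively, counted with multiplicity. Moreover, for every fixed $\varepsilon>0$, $$J_\phi(x;h)\ll_{\varepsilon,\phi,h}x^{-\frac12-\varepsilon}\qquad(x\to+0).$$ Furthermore, if $A,\mu\in\mathbb C$ and $\nu\in\mathbb R$ satisfy $\mathrm{Re}(\mu)>\nu\ge0$ and $$\sum_{p\le T}c_{\phi,2}(p)\log p=AT^\mu+O(T^{\nu+\varepsilon})\qquad(T\to\infty)$$ for every $\varepsilon>0$, then for every $\varepsilon>0$ $$J_\phi(x;h)=\mu A\int_0^\infty h(xu^2)u^\mu\frac{du}u+O(x^{-\frac\nu2-\varepsilon})\qquad(x\to+0).$$ -/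

import Mathlib

open Filter Topology Asymptotics Set

noncomputable section

namespace ZeroRelation

/-- Smooth slowly increasing functions on `(0, ∞)` (the values at `u ≤ 0` play no role). -/
def CD : Set (ℝ → ℂ) :=
  {φ | ContDiffOn ℝ (⊤ : ℕ∞) φ (Ioi 0) ∧
    ∃ k : ℝ, 0 ≤ k ∧ ∃ C : ℝ, 0 < C ∧ ∀ u : ℝ, 0 < u → ‖φ u‖ ≤ C * u ^ k}

/-- Smooth functions with compact support contained in `(0, ∞)`, extended by zero to `ℝ`. -/
def TestFunctions : Set (ℝ → ℂ) :=
  {h | ContDiff ℝ (⊤ : ℕ∞) h ∧ HasCompactSupport h ∧ tsupport h ⊆ Ioi 0}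

/-- `E` is an entire function of finite order. -/
def IsEntireFiniteOrder (E : ℂ → ℂ) : Prop :=
  Differentiable ℂ E ∧
    ∃ A : ℝ, E =O[Bornology.cobounded ℂ] fun s : ℂ => Real.exp (‖s‖ ^ A)

/-- `(s - 1) ^ m * L s` is (after removing the singularity at `s = 1`) entire of finite order. -/
def ClearsPole (L : ℂ → ℂ) (m : ℕ) : Prop :=
  ∃ E : ℂ → ℂ, IsEntireFiniteOrder E ∧ ∀ s : ℂ, s ≠ 1 → E s = (s - 1) ^ m * L s

/-- The integer `m_L`: the smallest `m` for which `(s - 1) ^ m * L s` is entire of finite order. -/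
def poleOrder (L : ℂ → ℂ) : ℕ := sInf {m : ℕ | ClearsPole L m}

/-- The parameters of a Gamma factor `Q ^ s * ∏ j, Γ (lam j * s + mu j)`. -/
structure GammaFactor where
  Q : ℝ
  r : ℕ
  lam : Fin r → ℝ
  mu : Fin r → ℂ
  Q_pos : 0 < Q
  one_le_r : 1 ≤ r
  lam_pos : ∀ j, 0 < lam j
  mu_re : ∀ j, 0 ≤ (mu j).re

/-- The Gamma factor as a function. -/
def GammaFactor.eval (G : GammaFactor) (s : ℂ) : ℂ :=
  (G.Q : ℂ) ^ s * ∏ j, Complex.Gamma ((G.lam j : ℂ) * s + G.mu j)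

/-- `s` is not a pole of any of the functions `Γ (lam j * s + mu j)`. -/
def GammaFactor.Regular (G : GammaFactor) (s : ℂ) : Prop :=
  ∀ (j : Fin G.r) (n : ℕ), (G.lam j : ℂ) * s + G.mu j ≠ -(n : ℂ)

/-- The complete `L`-function `L^*`. -/
def completed (G : GammaFactor) (L : ℂ → ℂ) (s : ℂ) : ℂ := G.eval s * L s

/-- The functional equation `L^*(s) = ω * conj (L^*(1 - conj s))` with `|ω| = 1`, an identity of
meromorphic functions, asserted at the points where all the factors on both sides are finite
(`L` has no pole except possibly at `1`). -/
def FunctionalEquation (G : GammaFactor) (L : ℂ → ℂ) : Prop :=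
  ∃ ω : ℂ, ‖ω‖ = 1 ∧ ∀ s : ℂ, s ≠ 0 → s ≠ 1 →
    G.Regular s → G.Regular (1 - (starRingEnd ℂ) s) →
      completed G L s = ω * (starRingEnd ℂ) (completed G L (1 - (starRingEnd ℂ) s))

/-- `L` is an element of the Selberg class, with Dirichlet coefficients `a n`, `n ≥ 1`.
The value of `L` at the possible pole `1` plays no role. -/
structure IsSelberg (a : ℕ → ℂ) (L : ℂ → ℂ) : Prop where
  /-- absolutely convergent Dirichlet series -/
  dirichlet : ∀ s : ℂ, 1 < s.re → LSeriesSummable a s ∧ L s = LSeries a s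
  /-- analytic continuation -/
  continuation : ∃ m : ℕ, ClearsPole L m
  /-- functional equation -/
  functional : ∃ G : GammaFactor, FunctionalEquation G L
  /-- Ramanujan estimate -/
  ramanujan : ∀ ε : ℝ, 0 < ε → a =O[atTop] fun n : ℕ => (n : ℝ) ^ ε
  /-- Dirichlet series of the logarithm, supported on prime powers -/
  euler : ∃ b : ℕ → ℂ, (∀ n : ℕ, ¬ IsPrimePow n → b n = 0) ∧
    (∃ θ : ℝ, θ < 1 / 2 ∧ b =O[atTop] fun n : ℕ => (n : ℝ) ^ θ) ∧
    ∀ s : ℂ, 1 < s.re → LSeriesSummable b s ∧ Complex.exp (LSeries b s) = L s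

/-- The Euler factor `L_p(s) = ∑ a(p ^ m) p ^ (-m s)`. -/
def eulerFactor (a : ℕ → ℂ) (p : ℕ) (s : ℂ) : ℂ :=
  ∑' m : ℕ, a (p ^ m) * ((p : ℂ) ^ (-s)) ^ m

/-- The polynomial `P_p(X) = 1 - c_1(p) X - ⋯ - c_N(p) X ^ N`, where `c p j` is `c_j(p)`. -/
def eulerPoly (N : ℕ) (c : ℕ → ℕ → ℂ) (p : ℕ) (X : ℂ) : ℂ :=
  1 - ∑ j ∈ Finset.Icc 1 N, c p j * X ^ j

/-- The series with coefficients `a` has a rank `N` Euler product, the coefficients of the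
polynomials `P_p` being `c p j`. -/
def HasRankEulerProduct (a : ℕ → ℂ) (N : ℕ) (c : ℕ → ℕ → ℂ) : Prop :=
  (∀ p : ℕ, p.Prime → ∀ s : ℂ, 0 < s.re →
    eulerFactor a p s = (eulerPoly N c p ((p : ℂ) ^ (-s)))⁻¹) ∧
  {p : ℕ | p.Prime ∧ c p N = 0}.Finite

/-- The Dirichlet coefficients interpolated by `φ`. -/
def coeffs (φ : ℝ → ℂ) (n : ℕ) : ℂ := φ (n : ℝ)

/-- The class `C_L(N)`. -/
def CL (N : ℕ) : Set (ℝ → ℂ) :=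
  {φ | φ ∈ CD ∧ (∃ C : ℝ, 0 < C ∧ ∀ u : ℝ, 0 < u → ‖φ u‖ ≤ C * u ^ 2) ∧
    (∃ L : ℂ → ℂ, IsSelberg (coeffs φ) L) ∧
    ∃ c : ℕ → ℕ → ℂ, HasRankEulerProduct (coeffs φ) N c}

/-- The multiplicity of `ρ` as a zero of the meromorphic function `F` (`0` if it is no zero). -/
def zeroMult (F : ℂ → ℂ) (ρ : ℂ) : ℕ := (meromorphicOrderAt F ρ).untop₀.toNat

/-- The term at `ρ` of the sum, over the zeros of `F` with multiplicity, of
`∫_0^∞ g(u) u ^ ρ du / u`. -/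
def zeroTerm (F : ℂ → ℂ) (g : ℝ → ℂ) (ρ : ℂ) : ℂ := (zeroMult F ρ : ℂ) * mellin g ρ

/-- The sum over the zeros `ρ` of `F`, with multiplicity, of `∫_0^∞ g(u) u ^ ρ du / u`. -/
def zeroSum (F : ℂ → ℂ) (g : ℝ → ℂ) : ℂ := ∑' ρ : ℂ, zeroTerm F g ρ

open Classical in
/-- The extra term `J(x; h)`: the sum of `c_2(p) h(x p ^ 2) log p` over the primes `p` with
`c_N(p) ≠ 0`. -/
def extraTerm (N : ℕ) (c : ℕ → ℕ → ℂ) (h : ℝ → ℂ) (x : ℝ) : ℂ :=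
  ∑' p : ℕ, if p.Prime ∧ c p N ≠ 0 then c p 2 * h (x * (p : ℝ) ^ 2) * (Real.log p : ℂ) else 0

/-- The sum of `c_2(p) log p` over the primes `p ≤ T`. -/
def c2Sum (c : ℕ → ℕ → ℂ) (T : ℝ) : ℂ :=
  ∑ p ∈ (Finset.Iic ⌊T⌋₊).filter Nat.Prime, c p 2 * (Real.log p : ℂ)

end ZeroRelation

end

noncomputable section

namespace ZeroRelation

/-! ### Entire functions: factorization, counting of zeros, partial fractions -/

/-! Both sides of the relation are explicit formulas. For the test function `h (x * u)` the terms
attached to `L` equal `∑ b(n) log n · h(xn)` up to `O(1)`, where `b` are the coefficients of `log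
L`; for the weighted test function `h (x * u) * φ u` the terms attached to zeta equal `∑ Λ(n) φ(n)
h(xn)` up to `O(1)`. The `O(1)` comes from the trivial zeros: for small `x` the test functions live
on `u ≥ 2`, so a trivial zero with real part `-σ` contributes at most a constant times `2 ^ (-σ)`.

What remains is the difference `logDiff` of the two coefficient sequences, supported on prime
powers. Taking logarithmic derivatives of the Euler factor `1 / P_p` gives `b(p) = a(p)`, so the
primes cancel (`EulerData.logDiff_prime`), and `2 b(p²) - a(p²) = c₂(p)`, so the squares of primes
produce `J` (`EulerData.logDiff_sq`). The Ramanujan estimate together with the bounded degree of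
`P_p` makes all coefficients `O(n ^ ε)` (`EulerData.exists_norm_logDiff_le`). Rankin's trick then
bounds the squares by `x ^ (-1/2 - ε)` and the cubes and higher powers by `x ^ (-1/3 - ε)`
(`isBigO_sqPart`, `isBigO_sub_sqPart`). The asymptotic formula for `J` is partial summation at scale
`√x` (`isBigO_tsum_sub_mellin`).

The explicit formula `LogDerivData.explicit_formula` is proved without shifting contours. For `E =
(s - 1) ^ m * L` of finite order, a sufficiently high derivative of `E' / E` is an absolutely
convergent sum over zeros (`hasSum_iteratedDeriv_logDeriv`, from Jensen's inequality,
Borel–Carathéodory and Cauchy's estimate). It is integrated along `Re s = 2` against the Mellin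
transform of `g / (log u) ^ K`; each term `K! / (s - ρ) ^ (K + 1)` inverts to `u ^ ρ (log u) ^ K` on
`u > 1`, and the logarithms cancel. Passing from `E` to the completed function only requires
counting Gamma poles (`zeroMult_completed`). The functional equation confines the zeros of the
completed function to `0 ≤ Re s ≤ 1`, which gives absolute convergence for every `x > 0`. -/

lemma analyticOrderAt_ne_top_of_entire {f : ℂ → ℂ} (hf : Differentiable ℂ f) {c : ℂ}
    (hc : f c ≠ 0) (z : ℂ) : analyticOrderAt f z ≠ ⊤ := by
  intro h
  rw [analyticOrderAt_eq_top] at h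
  have hA : AnalyticOnNhd ℂ f univ := fun x _ => hf.analyticAt x
  exact hc (hA.eqOn_zero_of_preconnected_of_eventuallyEq_zero isPreconnected_univ
    (mem_univ z) h (mem_univ c))

lemma exists_entire_eq_pow_mul {f : ℂ → ℂ} (hf : Differentiable ℂ f) {a : ℂ}
    (ha : analyticOrderAt f a ≠ ⊤) :
    ∃ g : ℂ → ℂ, Differentiable ℂ g ∧ g a ≠ 0 ∧
      ∀ z, f z = (z - a) ^ analyticOrderNatAt f a * g z := by
  classical
  obtain ⟨q, hq, hqa, hfq⟩ := ((hf.analyticAt a).analyticOrderNatAt_eq_iff ha).1 rfl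
  set n := analyticOrderNatAt f a
  set g : ℂ → ℂ := Function.update (fun z => f z / (z - a) ^ n) a (q a) with hg
  have hgne : ∀ z, z ≠ a → g z = f z / (z - a) ^ n := fun z hz => by
    simp [hg, Function.update_of_ne hz]
  have hga : g a = q a := by simp [hg]
  have hgq : g =ᶠ[𝓝 a] q := by
    filter_upwards [hfq] with z hz
    by_cases h : z = a
    · rw [h, hga]
    · rw [hgne z h, hz, smul_eq_mul, mul_div_cancel_left₀]
      exact pow_ne_zero _ (sub_ne_zero.2 h)
  refine ⟨g, fun z => ?_, by rwa [hga], fun z => ?_⟩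
  · by_cases h : z = a
    · rw [h]
      exact (hgq.differentiableAt_iff).2 hq.differentiableAt
    · have : g =ᶠ[𝓝 z] fun z => f z / (z - a) ^ n := by
        filter_upwards [isOpen_ne.mem_nhds h] with w hw using hgne w hw
      refine this.differentiableAt_iff.2 ((hf z).div (by fun_prop) ?_)
      exact pow_ne_zero _ (sub_ne_zero.2 h)
  · by_cases h : z = a
    · have := hfq.self_of_nhds
      rw [h, hga, this, smul_eq_mul]
    · rw [hgne z h, mul_div_cancel₀]
      exact pow_ne_zero _ (sub_ne_zero.2 h)

lemma exists_entire_eq_prod_mul {f : ℂ → ℂ} (hf : Differentiable ℂ f) {c : ℂ}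
    (hc : f c ≠ 0) (S : Finset ℂ) :
    ∃ g : ℂ → ℂ, Differentiable ℂ g ∧ (∀ ρ ∈ S, g ρ ≠ 0) ∧
      ∀ z, f z = (∏ ρ ∈ S, (z - ρ) ^ analyticOrderNatAt f ρ) * g z := by
  classical
  induction S using Finset.induction_on with
  | empty => exact ⟨f, hf, by simp, by simp⟩
  | insert a S ha ih =>
    obtain ⟨g, hg, hgS, hfg⟩ := ih
    set P : ℂ → ℂ := fun z => ∏ ρ ∈ S, (z - ρ) ^ analyticOrderNatAt f ρ with hP
    have hPd : Differentiable ℂ P := by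
      simp only [hP]; fun_prop
    have hPa : P a ≠ 0 := by
      simp only [hP]
      refine Finset.prod_ne_zero_iff.2 fun ρ hρ => pow_ne_zero _ (sub_ne_zero.2 ?_)
      rintro rfl
      exact ha hρ
    have hfe : f = P * g := funext hfg
    -- The factors already split off do not vanish at `a`, so the cofactor `g` still carries the
    -- full order of `f` there.
    have ho : analyticOrderAt f a = analyticOrderAt g a := by
      rw [hfe, analyticOrderAt_mul (hPd.analyticAt a) (hg.analyticAt a),
        (hPd.analyticAt a).analyticOrderAt_eq_zero.2 hPa, zero_add]
    have hg0 : analyticOrderAt g a ≠ ⊤ := ho ▸ analyticOrderAt_ne_top_of_entire hf hc a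
    obtain ⟨q, hq, hqa, hgq⟩ := exists_entire_eq_pow_mul hg hg0
    have ho' : analyticOrderNatAt f a = analyticOrderNatAt g a := by
      simp [analyticOrderNatAt, ho]
    refine ⟨q, hq, fun ρ hρ => ?_, fun z => ?_⟩
    · rcases Finset.mem_insert.1 hρ with rfl | hρ
      · exact hqa
      · intro h0
        have := hgq ρ
        rw [h0, mul_zero] at this
        exact hgS ρ hρ this
    · rw [Finset.prod_insert ha, ho', hfg z, hgq z]
      ring

lemma finite_zeros_closedBall {f : ℂ → ℂ} (hf : Differentiable ℂ f) {c : ℂ}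
    (hc : f c ≠ 0) (R : ℝ) : {ρ : ℂ | ‖ρ - c‖ ≤ R ∧ f ρ = 0}.Finite := by
  have hA : AnalyticOnNhd ℂ f univ := fun x _ => hf.analyticAt x
  have h1 : f ⁻¹' {0}ᶜ ∈ codiscrete ℂ := hA.preimage_zero_mem_codiscrete hc
  have h2 : IsClosed (f ⁻¹' {0}) ∧ IsDiscrete (f ⁻¹' {0}) := by
    have := mem_codiscrete'.1 h1
    simpa using this
  have : {ρ : ℂ | ‖ρ - c‖ ≤ R ∧ f ρ = 0} = Metric.closedBall c R ∩ f ⁻¹' {0} := by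
    ext z; simp [dist_eq_norm]
  rw [this]
  exact ((isCompact_closedBall c R).inter_right h2.1).finite (h2.2.mono inter_subset_right)

/-- The zeros of `f` in a closed disc can be divided out with control on a larger circle. -/
lemma exists_quotient_by_zeros {f : ℂ → ℂ} (hf : Differentiable ℂ f) {c : ℂ}
    (hc : f c ≠ 0) {R M : ℝ} (hR : 0 < R) (hM : ∀ z, ‖z - c‖ = 4 * R → ‖f z‖ ≤ M) :
    ∃ (S : Finset ℂ) (h : ℂ → ℂ), (∀ ρ, ρ ∈ S ↔ ‖ρ - c‖ ≤ R ∧ f ρ = 0) ∧ Differentiable ℂ h ∧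
      (∀ z, f z = (∏ ρ ∈ S, (1 - (z - c) / (ρ - c)) ^ analyticOrderNatAt f ρ) * h z) ∧
      (∀ z, ‖z - c‖ ≤ R → h z ≠ 0) ∧ h c = f c ∧
      ∀ z, ‖z - c‖ ≤ 4 * R → ‖h z‖ * 3 ^ (∑ ρ ∈ S, analyticOrderNatAt f ρ) ≤ M := by
  set S := (finite_zeros_closedBall hf hc R).toFinset with hS
  have hmem : ∀ ρ, ρ ∈ S ↔ ‖ρ - c‖ ≤ R ∧ f ρ = 0 := fun ρ => by simp [hS]
  have hne : ∀ ρ ∈ S, ρ - c ≠ 0 := by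
    intro ρ hρ h
    rw [sub_eq_zero.1 h] at hρ
    exact hc ((hmem c).1 hρ).2
  obtain ⟨g, hg, hgS, hfg⟩ := exists_entire_eq_prod_mul hf hc S
  set h : ℂ → ℂ := fun z => (∏ ρ ∈ S, (c - ρ) ^ analyticOrderNatAt f ρ) * g z with hh
  have hfac : ∀ z, f z = (∏ ρ ∈ S, (1 - (z - c) / (ρ - c)) ^ analyticOrderNatAt f ρ) * h z := by
    intro z
    rw [hfg z, hh]
    simp only
    rw [← mul_assoc, ← Finset.prod_mul_distrib]
    congr 1
    refine Finset.prod_congr rfl fun ρ hρ => ?_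
    rw [← mul_pow]
    congr 1
    have := hne ρ hρ
    field_simp
    ring
  have hhd : Differentiable ℂ h := hg.const_mul _
  refine ⟨S, h, hmem, hhd, hfac, fun z hz h0 => ?_, ?_, ?_⟩
  · have h1 : (∏ ρ ∈ S, (c - ρ) ^ analyticOrderNatAt f ρ) ≠ 0 :=
      Finset.prod_ne_zero_iff.2 fun ρ hρ => pow_ne_zero _ (by
        have := hne ρ hρ
        rw [← neg_sub]; exact neg_ne_zero.2 this)
    have h2 : g z = 0 := by simpa [hh, h1] using h0
    have h3 : f z = 0 := by rw [hfac z, h0, mul_zero]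
    exact hgS z ((hmem z).2 ⟨hz, h3⟩) h2
  · have := hfac c
    simpa using this.symm
  -- On the circle of radius `4R` each quotient `(z - c) / (ρ - c)` has modulus at least 4, so each
  -- factor has modulus at least 3. The maximum principle carries the resulting bound for `h`
  -- inside.
  · have key : ∀ z ∈ frontier (Metric.ball c (4 * R)),
        ‖h z‖ ≤ M / 3 ^ (∑ ρ ∈ S, analyticOrderNatAt f ρ) := by
      intro z hz
      rw [frontier_ball c (by positivity)] at hz
      have hz' : ‖z - c‖ = 4 * R := by simpa [dist_eq_norm] using hz
      rw [le_div_iff₀ (by positivity)]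
      refine le_trans ?_ (hM z hz')
      rw [hfac z, norm_mul _ (h z), mul_comm ‖h z‖]
      refine mul_le_mul_of_nonneg_right ?_ (norm_nonneg (h z))
      rw [norm_prod, ← Finset.prod_pow_eq_pow_sum]
      refine Finset.prod_le_prod (fun _ _ => by positivity) fun ρ hρ => ?_
      rw [norm_pow]
      refine pow_le_pow_left₀ (by norm_num) ?_ _
      have hρ0 : 0 < ‖ρ - c‖ := norm_pos_iff.2 (hne ρ hρ)
      have h4 : 4 ≤ ‖(z - c) / (ρ - c)‖ := by
        rw [norm_div, le_div_iff₀ hρ0, hz']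
        have := ((hmem ρ).1 hρ).1
        linarith
      have h5 := norm_sub_norm_le ((z - c) / (ρ - c)) 1
      rw [norm_sub_rev] at h5
      simp only [norm_one] at h5
      linarith
    intro z hz
    have hz' : z ∈ closure (Metric.ball c (4 * R)) := by
      rw [closure_ball c (by positivity)]
      simpa [dist_eq_norm] using hz
    have := Complex.norm_le_of_forall_mem_frontier_norm_le Metric.isBounded_ball
      hhd.diffContOnCl key hz'
    rwa [le_div_iff₀ (by positivity)] at this

end ZeroRelation

end

noncomputable section

namespace ZeroRelation

/-! ### Logarithms of zero-free functions and partial fractions -/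

/-- A primitive `l` of `h' / h` with `l c = 0` satisfies `h = h c * exp l`. The growth bound
therefore controls `Re l` from above, and Borel–Carathéodory turns this into a bound for `‖l‖` on
half the radius. -/
lemma exists_log_on_ball {h : ℂ → ℂ} (hd : Differentiable ℂ h) {c : ℂ} {R M : ℝ} (hR : 0 < R)
    (hM : 0 < M) (hne : ∀ z ∈ Metric.ball c R, h z ≠ 0)
    (hb : ∀ z ∈ Metric.ball c R, ‖h z‖ ≤ ‖h c‖ * Real.exp M) :
    ∃ l : ℂ → ℂ, (∀ z ∈ Metric.ball c R, HasDerivAt l (logDeriv h z) z) ∧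
      ∀ z, ‖z - c‖ ≤ R / 2 → ‖l z‖ ≤ 2 * M := by
  have hc : h c ≠ 0 := hne c (Metric.mem_ball_self hR)
  have hdl : DifferentiableOn ℂ (logDeriv h) (Metric.ball c R) := by
    have h1 : Differentiable ℂ (deriv h) := fun z => (hd.analyticAt z).deriv.differentiableAt
    intro z hz
    exact ((h1 z).div (hd z) (hne z hz)).differentiableWithinAt
  obtain ⟨l, hlc, hl⟩ := hdl.isExactOn_ball.with_val_at c 0
  have hexp : ∀ z ∈ Metric.ball c R, h z = h c * Complex.exp (l z) := by
    intro z hz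
    have hD : ∀ w ∈ Metric.ball c R,
        HasDerivAt (fun w => h w * Complex.exp (-l w)) 0 w := by
      intro w hw
      have h1 := (hd w).hasDerivAt.mul ((hl w hw).neg.cexp)
      refine h1.congr_deriv ?_
      rw [logDeriv_apply]
      have := hne w hw
      field_simp
      ring
    have hconst := Metric.isOpen_ball.is_const_of_deriv_eq_zero
      (convex_ball c R).isPreconnected
      (fun w hw => (hD w hw).differentiableAt.differentiableWithinAt)
      (fun w hw => (hD w hw).deriv) hz (Metric.mem_ball_self hR)
    simp only [hlc, neg_zero, Complex.exp_zero, mul_one] at hconst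
    rw [← hconst, mul_assoc, ← Complex.exp_add, neg_add_cancel, Complex.exp_zero, mul_one]
  refine ⟨l, hl, fun z hz => ?_⟩
  have hshift : ∀ w ∈ Metric.ball (0 : ℂ) R, c + w ∈ Metric.ball c R := by
    intro w hw
    simpa [dist_eq_norm] using hw
  have hre : MapsTo (fun w => l (c + w)) (Metric.ball 0 R) {z | z.re ≤ M} := by
    intro w hw
    have h1 := hb _ (hshift w hw)
    rw [hexp _ (hshift w hw), norm_mul, Complex.norm_exp] at h1
    exact Real.exp_le_exp.1 (le_of_mul_le_mul_left h1 (norm_pos_iff.2 hc))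
  have hdf : DifferentiableOn ℂ (fun w => l (c + w)) (Metric.ball 0 R) := by
    intro w hw
    exact ((hl _ (hshift w hw)).comp_const_add c w).differentiableAt.differentiableWithinAt
  have hzb : z - c ∈ Metric.ball (0 : ℂ) R := by
    rw [mem_ball_zero_iff]; linarith
  have := Complex.borelCaratheodory_zero hM hdf hre hR hzb (by simpa using hlc)
  simp only [add_sub_cancel] at this
  refine this.trans ?_
  rw [div_le_iff₀ (by linarith)]
  nlinarith

lemma iteratedDeriv_inv_sub (K : ℕ) (ρ s : ℂ) :
    iteratedDeriv K (fun z => (z - ρ)⁻¹) s = (-1) ^ K * K.factorial / (s - ρ) ^ (K + 1) := by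
  have := congrFun (iteratedDeriv_comp_sub_const K (fun z : ℂ => z⁻¹) ρ) s
  rw [this, iteratedDeriv_eq_iterate, show (fun z : ℂ => z⁻¹) = Inv.inv from rfl, iter_deriv_inv,
    div_eq_mul_inv, show (-1 - (K : ℤ)) = -((K + 1 : ℕ) : ℤ) by push_cast; ring, zpow_neg,
    zpow_natCast]

lemma logDeriv_prod_zeros {S : Finset ℂ} {n : ℂ → ℕ} {c z : ℂ} (hS : ∀ ρ ∈ S, ρ ≠ c)
    (hz : ∀ ρ ∈ S, z ≠ ρ) :
    logDeriv (fun z => ∏ ρ ∈ S, (1 - (z - c) / (ρ - c)) ^ n ρ) z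
      = ∑ ρ ∈ S, n ρ * (z - ρ)⁻¹ := by
  have hfac : ∀ ρ ∈ S, 1 - (z - c) / (ρ - c) ≠ 0 := by
    intro ρ hρ h
    have h1 : ρ - c ≠ 0 := sub_ne_zero.2 (hS ρ hρ)
    field_simp at h
    exact hz ρ hρ (by linear_combination -h)
  have hdiff : ∀ ρ ∈ S,
      DifferentiableAt ℂ (fun z => (1 - (z - c) / (ρ - c)) ^ n ρ) z := fun ρ _ => by fun_prop
  have hpow : ∀ ρ ∈ S, (fun z => (1 - (z - c) / (ρ - c)) ^ n ρ) z ≠ 0 :=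
    fun ρ hρ => pow_ne_zero _ (hfac ρ hρ)
  rw [logDeriv_prod hpow hdiff]
  refine Finset.sum_congr rfl fun ρ hρ => ?_
  rw [logDeriv_fun_pow (by fun_prop)]
  congr 1
  have hd : HasDerivAt (fun z => 1 - (z - c) / (ρ - c)) (-(1 / (ρ - c))) z := by
    simpa using (((hasDerivAt_id z).sub_const c).div_const (ρ - c)).const_sub 1
  rw [logDeriv_apply, hd.deriv]
  have h1 : ρ - c ≠ 0 := sub_ne_zero.2 (hS ρ hρ)
  have h2 : z - ρ ≠ 0 := sub_ne_zero.2 (hz ρ hρ)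
  have h3 : ρ - z ≠ 0 := sub_ne_zero.2 (hz ρ hρ).symm
  have h4 : 1 - (z - c) / (ρ - c) = (ρ - z) / (ρ - c) := by
    field_simp
    ring
  rw [h4]
  field_simp
  ring

section Growth

variable {f : ℂ → ℂ} {c : ℂ} {B : ℝ} {k : ℕ}

/-- This is Jensen's inequality: the value at the centre satisfies `‖f c‖ * 3 ^ n ≤ max ‖f‖` over
the circle of radius `4R`, where `n` counts the zeros, and `e < 3`. The cofactor is returned as well
because the partial fraction expansion needs its size. -/
lemma count_zeros_le (hf : Differentiable ℂ f) (hc : f c ≠ 0) (hB : 0 ≤ B)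
    (hgr : ∀ z, ‖f z‖ ≤ Real.exp (B * (1 + ‖z - c‖) ^ k)) :
    ∃ D : ℝ, 0 < D ∧ ∀ R : ℝ, 0 < R → ∃ (S : Finset ℂ) (h : ℂ → ℂ),
      (∀ ρ, ρ ∈ S ↔ ‖ρ - c‖ ≤ R ∧ f ρ = 0) ∧ Differentiable ℂ h ∧
      (∀ z, f z = (∏ ρ ∈ S, (1 - (z - c) / (ρ - c)) ^ analyticOrderNatAt f ρ) * h z) ∧
      (∀ z, ‖z - c‖ ≤ R → h z ≠ 0) ∧
      (∀ z, ‖z - c‖ ≤ R → ‖h z‖ ≤ ‖h c‖ * Real.exp (D * (1 + R) ^ k)) ∧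
      (∑ ρ ∈ S, analyticOrderNatAt f ρ : ℕ) ≤ D * (1 + R) ^ k := by
  -- The factor `4 ^ k` comes from `1 + 4R ≤ 4 (1 + R)`, the logarithm absorbs division by `‖f c‖`,
  -- and the summand 1 makes `D` positive.
  set D := B * 4 ^ k + |Real.log ‖f c‖| + 1 with hD
  have hD0 : 0 < D := by positivity
  refine ⟨D, hD0, fun R hR => ?_⟩
  have hM : ∀ z, ‖z - c‖ = 4 * R → ‖f z‖ ≤ Real.exp (B * (4 ^ k * (1 + R) ^ k)) := by
    intro z hz
    refine (hgr z).trans (Real.exp_le_exp.2 ?_)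
    rw [hz, ← mul_pow]
    gcongr
    linarith
  obtain ⟨S, h, hS, hd, hfac, hne, hhc, hbd⟩ := exists_quotient_by_zeros hf hc hR hM
  have hfc : 0 < ‖f c‖ := norm_pos_iff.2 hc
  have h1R : 1 ≤ (1 + R) ^ k := one_le_pow₀ (by linarith)
  have hkey : Real.exp (B * (4 ^ k * (1 + R) ^ k)) ≤ ‖f c‖ * Real.exp (D * (1 + R) ^ k) := by
    rw [← Real.exp_log hfc, ← Real.exp_add, Real.exp_le_exp]
    have := neg_abs_le (Real.log ‖f c‖)
    have h2 : 0 ≤ |Real.log ‖f c‖| := abs_nonneg _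
    rw [hD]
    nlinarith
  have h3 : (1 : ℝ) ≤ 3 ^ (∑ ρ ∈ S, analyticOrderNatAt f ρ) := one_le_pow₀ (by norm_num)
  refine ⟨S, h, hS, hd, hfac, hne, fun z hz => ?_, ?_⟩
  · rw [hhc]
    refine le_trans ?_ ((hbd z (by linarith)).trans hkey)
    exact le_mul_of_one_le_right (norm_nonneg _) h3
  · have h4 := (hbd c (by simpa using by positivity)).trans hkey
    rw [hhc] at h4
    have h5 := le_of_mul_le_mul_left h4 hfc
    have h6 : Real.exp ((∑ ρ ∈ S, analyticOrderNatAt f ρ : ℕ) : ℝ) ≤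
        3 ^ (∑ ρ ∈ S, analyticOrderNatAt f ρ) := by
      rw [← mul_one (((∑ ρ ∈ S, analyticOrderNatAt f ρ : ℕ) : ℝ)), Real.exp_nat_mul]
      exact pow_le_pow_left₀ (Real.exp_pos _).le
        (Real.exp_one_lt_d9.le.trans (by norm_num)) _
    exact Real.exp_le_exp.1 (h6.trans h5)

/-- Cut the plane into the shells `j ≤ ‖ρ - c‖ < j + 1`. Each contains `O((1 + j) ^ k)` zeros, so
the weight with exponent `k + 2` leaves the convergent series of `(1 + j) ^ (-2)`. -/
lemma summable_zeros (hf : Differentiable ℂ f) (hc : f c ≠ 0) (hB : 0 ≤ B)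
    (hgr : ∀ z, ‖f z‖ ≤ Real.exp (B * (1 + ‖z - c‖) ^ k)) :
    Summable fun ρ : ℂ => (analyticOrderNatAt f ρ : ℝ) / (1 + ‖ρ - c‖) ^ (k + 2) := by
  classical
  obtain ⟨D, hD, hcount⟩ := count_zeros_le hf hc hB hgr
  have hcount' : ∀ (T : Finset ℂ) (R : ℝ), 0 < R → (∀ ρ ∈ T, ‖ρ - c‖ ≤ R) →
      ∑ ρ ∈ T, (analyticOrderNatAt f ρ : ℝ) ≤ D * (1 + R) ^ k := by
    intro T R hR hT
    obtain ⟨S, -, hS, -, -, -, -, hle⟩ := hcount R hR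
    refine le_trans ?_ hle
    push_cast
    rw [← Finset.sum_filter_add_sum_filter_not T (fun ρ => f ρ = 0),
      Finset.sum_eq_zero (s := {x ∈ T | ¬f x = 0}), add_zero]
    · refine Finset.sum_le_sum_of_subset_of_nonneg (fun ρ hρ => ?_) fun _ _ _ => by positivity
      rw [Finset.mem_filter] at hρ
      exact (hS ρ).2 ⟨hT ρ hρ.1, hρ.2⟩
    · intro ρ hρ
      rw [Finset.mem_filter] at hρ
      by_contra h
      exact hρ.2 (apply_eq_zero_of_analyticOrderNatAt_ne_zero (by exact_mod_cast h))
  have hs2 : Summable fun j : ℕ => D * 2 ^ k * (2 ^ 2 * (1 / ((j + 1 : ℕ) : ℝ) ^ 2)) :=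
    (((summable_nat_add_iff 1).2 (Real.summable_one_div_nat_pow.2 one_lt_two)).mul_left
      _).mul_left _
  refine summable_of_sum_le (c := ∑' j : ℕ, D * 2 ^ k * (2 ^ 2 * (1 / ((j + 1 : ℕ) : ℝ) ^ 2)))
    (fun ρ => by positivity) fun T => ?_
  set g : ℂ → ℕ := fun ρ => ⌊‖ρ - c‖⌋₊ with hg
  rw [← Finset.sum_fiberwise_of_maps_to (t := T.image g) (g := g)
    (fun ρ hρ => Finset.mem_image_of_mem g hρ)]
  refine le_trans ?_ (hs2.sum_le_tsum (T.image g) fun j _ => by positivity)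
  refine Finset.sum_le_sum fun j _ => ?_
  have hfib : ∀ ρ ∈ T.filter (fun ρ => g ρ = j), (j : ℝ) ≤ ‖ρ - c‖ ∧ ‖ρ - c‖ ≤ j + 1 := by
    intro ρ hρ
    have h1 := (Finset.mem_filter.1 hρ).2
    rw [← h1]
    exact ⟨Nat.floor_le (norm_nonneg _), (Nat.lt_floor_add_one _).le⟩
  calc ∑ ρ ∈ T with g ρ = j, (analyticOrderNatAt f ρ : ℝ) / (1 + ‖ρ - c‖) ^ (k + 2)
      ≤ ∑ ρ ∈ T with g ρ = j, (analyticOrderNatAt f ρ : ℝ) / (1 + j) ^ (k + 2) := by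
        refine Finset.sum_le_sum fun ρ hρ => ?_
        have := (hfib ρ hρ).1
        gcongr
    _ = (∑ ρ ∈ T with g ρ = j, (analyticOrderNatAt f ρ : ℝ)) / (1 + j) ^ (k + 2) := by
        rw [Finset.sum_div]
    _ ≤ (D * (1 + (j + 1)) ^ k) / (1 + j) ^ (k + 2) := by
        gcongr
        exact hcount' _ _ (by positivity) fun ρ hρ => (hfib ρ hρ).2
    _ ≤ (D * (2 * (1 + j)) ^ k) / (1 + j) ^ (k + 2) := by
        gcongr
        linarith
    _ ≤ D * 2 ^ k * (2 ^ 2 * (1 / ((j + 1 : ℕ) : ℝ) ^ 2)) := by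
        rw [mul_pow, pow_add]
        push_cast
        have : (0 : ℝ) < 1 + j := by positivity
        rw [add_comm (j : ℝ) 1]
        have h2 : D * (2 ^ k * (1 + (j : ℝ)) ^ k) / ((1 + j) ^ k * (1 + j) ^ 2)
          = D * 2 ^ k * (1 / (1 + (j : ℝ)) ^ 2) := by field_simp
        rw [h2]
        gcongr
        exact le_mul_of_one_le_left (by positivity) (by norm_num)

/-- This is the error in the truncated partial fractions: the logarithm of the cofactor is `O(R ^
k)`, while Cauchy's estimate of order `K + 1` gains `R ^ (-K - 1)`. -/
lemma tendsto_pow_div_pow_succ (D s : ℝ) (k K : ℕ) (hK : k ≤ K) :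
    Tendsto (fun R : ℕ => ((D * (1 + ((R : ℝ) + s)) ^ k) / (((R : ℝ) + s) / 4) ^ (K + 1)))
      atTop (𝓝 0) := by
  have hT : Tendsto (fun R : ℕ => (R : ℝ) + s) atTop atTop :=
    tendsto_atTop_add_const_right _ _ tendsto_natCast_atTop_atTop
  suffices h : Tendsto (fun R : ℝ => (D * (1 + R) ^ k) / (R / 4) ^ (K + 1)) atTop (𝓝 0) from
    h.comp hT
  have hb : ∀ᶠ R : ℝ in atTop, ‖(D * (1 + R) ^ k) / (R / 4) ^ (K + 1)‖
      ≤ |D| * 2 ^ k * 4 ^ (K + 1) * R⁻¹ := by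
    filter_upwards [eventually_ge_atTop 1] with R hR
    have hR0 : 0 < R := by linarith
    rw [norm_div, norm_mul, norm_pow, norm_pow, Real.norm_eq_abs, Real.norm_eq_abs,
      Real.norm_eq_abs, abs_of_pos (show 0 < 1 + R by linarith),
      abs_of_pos (show 0 < R / 4 by linarith), div_pow, pow_succ R]
    calc |D| * (1 + R) ^ k / (R ^ K * R / 4 ^ (K + 1))
        ≤ |D| * (2 * R) ^ k / (R ^ K * R / 4 ^ (K + 1)) := by gcongr; linarith
      _ ≤ |D| * (2 ^ k * R ^ K) / (R ^ K * R / 4 ^ (K + 1)) := by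
          rw [mul_pow]
          gcongr
      _ = |D| * 2 ^ k * 4 ^ (K + 1) * R⁻¹ := by field_simp
  refine squeeze_zero_norm' hb ?_
  simpa using tendsto_inv_atTop_zero.const_mul (|D| * 2 ^ k * 4 ^ (K + 1))

/-- The partial fraction expansion of the derivatives of `f' / f`. -/
theorem hasSum_iteratedDeriv_logDeriv (hf : Differentiable ℂ f) (hc : f c ≠ 0) (hB : 0 ≤ B)
    (hgr : ∀ z, ‖f z‖ ≤ Real.exp (B * (1 + ‖z - c‖) ^ k)) {s : ℂ} {K : ℕ} (hK : k + 1 ≤ K)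
    (hs : ∀ ρ, f ρ = 0 → 1 ≤ ‖s - ρ‖) :
    HasSum (fun ρ : ℂ => (analyticOrderNatAt f ρ : ℂ) *
      ((-1) ^ K * K.factorial / (s - ρ) ^ (K + 1))) (iteratedDeriv K (logDeriv f) s) := by
  have hfs : f s ≠ 0 := fun h => by simpa using (hs s h).trans_lt (by simp : ‖s - s‖ < 1)
  set a : ℂ → ℂ := fun ρ => (analyticOrderNatAt f ρ : ℂ) *
      ((-1) ^ K * K.factorial / (s - ρ) ^ (K + 1)) with ha
  have ha0 : ∀ ρ, f ρ ≠ 0 → a ρ = 0 := by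
    intro ρ hρ
    have : analyticOrderNatAt f ρ = 0 := by
      by_contra h
      exact hρ (apply_eq_zero_of_analyticOrderNatAt_ne_zero h)
    simp [ha, this]
  have hsum : Summable a := by
    refine Summable.of_norm_bounded
      (((summable_zeros hf hc hB hgr).mul_left (K.factorial * (2 + ‖s - c‖) ^ (K + 1)))) fun ρ => ?_
    by_cases hρ : f ρ = 0
    · have h1 := hs ρ hρ
      have h2 : 1 + ‖ρ - c‖ ≤ (2 + ‖s - c‖) * ‖s - ρ‖ := by
        have : ‖ρ - c‖ ≤ ‖s - ρ‖ + ‖s - c‖ := by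
          have := norm_sub_le (s - c) (s - ρ)
          simp only [sub_sub_sub_cancel_left] at this
          linarith
        nlinarith [norm_nonneg (s - c)]
      have h3 : 1 / ‖s - ρ‖ ^ (K + 1) ≤
          (2 + ‖s - c‖) ^ (K + 1) / (1 + ‖ρ - c‖) ^ (k + 2) := by
        rw [div_le_div_iff₀ (by positivity) (by positivity), one_mul, ← mul_pow]
        calc (1 + ‖ρ - c‖) ^ (k + 2) ≤ (1 + ‖ρ - c‖) ^ (K + 1) :=
              pow_le_pow_right₀ (by linarith [norm_nonneg (ρ - c)]) (by omega)
          _ ≤ _ := by gcongr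
      simp only [ha, norm_mul, norm_div, norm_pow, norm_neg, norm_one, one_pow, one_mul,
        Complex.norm_natCast]
      calc (analyticOrderNatAt f ρ : ℝ) * (K.factorial / ‖s - ρ‖ ^ (K + 1))
          = (analyticOrderNatAt f ρ : ℝ) * K.factorial * (1 / ‖s - ρ‖ ^ (K + 1)) := by ring
        _ ≤ (analyticOrderNatAt f ρ : ℝ) * K.factorial *
            ((2 + ‖s - c‖) ^ (K + 1) / (1 + ‖ρ - c‖) ^ (k + 2)) := by gcongr
        _ = _ := by ring
    · rw [ha0 ρ hρ, norm_zero]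
      positivity
  obtain ⟨D, hD, hcount⟩ := count_zeros_le hf hc hB hgr
  -- The offset makes the disc of radius `R n / 4` about `s` lie in the disc of radius `R n / 2`
  -- about `c`, where the logarithm of the cofactor is bounded.
  set R : ℕ → ℝ := fun n => n + (4 * ‖s - c‖ + 1) with hRdef
  have hRpos : ∀ n, 0 < R n := fun n => by positivity
  have hRge : ∀ n, 4 * ‖s - c‖ < R n := fun n => by
    have : (0 : ℝ) ≤ n := n.cast_nonneg
    simp only [hRdef]; linarith
  choose S h hS hd hfac hne hbd _ using fun n : ℕ => hcount (R n) (hRpos n)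
  -- the difference between the derivative and the partial sums
  have hdiff : ∀ n, ‖iteratedDeriv K (logDeriv f) s - ∑ ρ ∈ S n, a ρ‖
      ≤ (K + 1).factorial * 2 * ((D * (1 + R n) ^ k) / (R n / 4) ^ (K + 1)) := by
    intro n
    obtain ⟨l, hl, hlb⟩ := exists_log_on_ball (hd n) (hRpos n)
      (show 0 < D * (1 + R n) ^ k by have := hRpos n; positivity)
      (fun z hz => hne n z (by rw [mem_ball_iff_norm] at hz; exact hz.le))
      (fun z hz => hbd n z (by rw [mem_ball_iff_norm] at hz; exact hz.le))
    have hsub : Metric.closedBall s (R n / 4) ⊆ {z | ‖z - c‖ ≤ R n / 2} := by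
      intro z hz
      rw [Metric.mem_closedBall, dist_eq_norm] at hz
      have h1 := norm_add_le (z - s) (s - c)
      rw [sub_add_sub_cancel] at h1
      have := hRge n
      simp only [mem_ofPred_eq]
      linarith
    have hcl : ∀ z ∈ Metric.closedBall s (R n / 4), z ∈ Metric.ball c (R n) := by
      intro z hz
      rw [mem_ball_iff_norm]
      have : ‖z - c‖ ≤ R n / 2 := hsub hz
      linarith [hRpos n]
    have hdc : DiffContOnCl ℂ l (Metric.ball s (R n / 4)) := by
      refine DifferentiableOn.diffContOnCl fun z hz => ?_
      rw [closure_ball _ (by linarith [hRpos n])] at hz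
      exact (hl z (hcl z hz)).differentiableAt.differentiableWithinAt
    -- Cauchy's estimate has order `K + 1`, one more than `K`, because `l` is a primitive of the
    -- logarithmic derivative.
    have hC := Complex.norm_iteratedDeriv_le_of_forall_mem_sphere_norm_le (K + 1)
      (by linarith [hRpos n]) hdc
      (fun z hz => hlb z (hsub (Metric.sphere_subset_closedBall hz)))
    have hloc : deriv l =ᶠ[𝓝 s] fun z => logDeriv f z -
        ∑ ρ ∈ S n, (analyticOrderNatAt f ρ : ℂ) * (z - ρ)⁻¹ := by
      have h1 : ∀ᶠ z in 𝓝 s, z ∈ Metric.ball s (R n / 4) :=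
        Metric.ball_mem_nhds _ (by linarith [hRpos n])
      have h2 : ∀ᶠ z in 𝓝 s, f z ≠ 0 := hf.continuous.continuousAt.eventually_ne hfs
      filter_upwards [h1, h2] with z hz hfz
      have hzb := hcl z (Metric.ball_subset_closedBall hz)
      rw [(hl z hzb).deriv]
      have hzz := hfz
      rw [hfac n z] at hzz
      have h3 : logDeriv f z = logDeriv (fun z => ∏ ρ ∈ S n,
          (1 - (z - c) / (ρ - c)) ^ analyticOrderNatAt f ρ) z + logDeriv (h n) z := by
        rw [show logDeriv f z = logDeriv (fun z =>
          (∏ ρ ∈ S n, (1 - (z - c) / (ρ - c)) ^ analyticOrderNatAt f ρ) * h n z) z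
          from congrArg (fun F => logDeriv F z) (funext (hfac n))]
        exact logDeriv_mul z (left_ne_zero_of_mul hzz) (right_ne_zero_of_mul hzz) (by fun_prop)
          (hd n z)
      rw [h3, logDeriv_prod_zeros]
      · ring
      · rintro ρ hρ rfl
        exact hc ((hS n ρ).1 hρ).2
      · rintro ρ hρ rfl
        exact hfz ((hS n z).1 hρ).2
    have hfa : AnalyticAt ℂ (logDeriv f) s := by
      have := (hf.analyticAt s).deriv.div (hf.analyticAt s) hfs
      exact this
    have hcd : ∀ ρ ∈ S n, ContDiffAt ℂ K
        (fun z => (analyticOrderNatAt f ρ : ℂ) * (z - ρ)⁻¹) s := by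
      intro ρ hρ
      refine contDiffAt_const.mul ((contDiffAt_id.sub contDiffAt_const).inv ?_)
      intro h0
      have h1 := hs ρ ((hS n ρ).1 hρ).2
      simp only [id] at h0
      rw [h0] at h1
      simp at h1
      linarith
    have heq : iteratedDeriv (K + 1) l s = iteratedDeriv K (logDeriv f) s - ∑ ρ ∈ S n, a ρ := by
      rw [iteratedDeriv_succ', hloc.iteratedDeriv_eq,
        iteratedDeriv_fun_sub hfa.contDiffAt (ContDiffAt.sum hcd), iteratedDeriv_fun_sum hcd]
      congr 1
      refine Finset.sum_congr rfl fun ρ _ => ?_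
      rw [iteratedDeriv_const_mul_field, iteratedDeriv_inv_sub]
    rw [heq] at hC
    refine hC.trans (le_of_eq ?_)
    ring
  have hlim : Tendsto (fun n => ∑ ρ ∈ S n, a ρ) atTop (𝓝 (iteratedDeriv K (logDeriv f) s)) := by
    have h0 := (tendsto_pow_div_pow_succ D (4 * ‖s - c‖ + 1) k K (by omega)).const_mul
      (((K + 1).factorial : ℝ) * 2)
    rw [mul_zero] at h0
    rw [tendsto_iff_norm_sub_tendsto_zero]
    refine squeeze_zero (fun _ => norm_nonneg _) (fun n => ?_) h0
    rw [norm_sub_rev]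
    exact hdiff n
  set Z : Set ℂ := {ρ | f ρ = 0}
  have hsupp : Function.support a ⊆ Z := fun ρ hρ => by
    by_contra hh
    exact hρ (ha0 ρ hh)
  -- The finite sets `S n` exhaust the zeros, so the same partial sums also converge to the
  -- unconditional sum; uniqueness of limits then identifies it.
  have hlim2 : Tendsto (fun n => ∑ ρ ∈ S n, a ρ) atTop (𝓝 (∑' ρ, a ρ)) := by
    have hs1 : HasSum (a ∘ ((↑) : Z → ℂ)) (∑' ρ, a ρ) :=
      (hasSum_subtype_iff_of_support_subset hsupp).2 hsum.hasSum
    classical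
    set S' : ℕ → Finset Z := fun n => (S n).subtype (fun ρ => ρ ∈ Z)
    have hS' : Tendsto S' atTop atTop := by
      refine tendsto_atTop_finset_of_monotone (fun n m hnm ρ hρ => ?_) fun ρ => ?_
      · simp only [S', Finset.mem_subtype] at hρ ⊢
        refine (hS m _).2 ⟨((hS n _).1 hρ).1.trans ?_, ρ.2⟩
        simp only [hRdef]
        gcongr
      · obtain ⟨n, hn⟩ := exists_nat_ge ‖(ρ : ℂ) - c‖
        refine ⟨n, ?_⟩
        simp only [S', Finset.mem_subtype]
        refine (hS n _).2 ⟨hn.trans ?_, ρ.2⟩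
        simp only [hRdef]
        linarith [norm_nonneg (s - c)]
    have h4 := hs1.comp hS'
    refine h4.congr fun n => ?_
    simp only [Function.comp_apply, S']
    rw [Finset.sum_subtype_of_mem (f := a)]
    intro ρ hρ
    exact ((hS n ρ).1 hρ).2
  rw [tendsto_nhds_unique hlim hlim2]
  exact hsum.hasSum

end Growth

end ZeroRelation

end

noncomputable section

namespace ZeroRelation

open MeasureTheory

/-! ### Mellin transforms of test functions -/

section TestFunctions

/-- Membership in `TestFunctions`, unbundled. -/
structure IsTest (g : ℝ → ℂ) : Prop where
  smooth : ContDiff ℝ (⊤ : ℕ∞) g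
  compact : HasCompactSupport g
  supp : tsupport g ⊆ Ioi 0

lemma isTest_of_mem {h : ℝ → ℂ} (hh : h ∈ TestFunctions) : IsTest h := ⟨hh.1, hh.2.1, hh.2.2⟩

variable {g : ℝ → ℂ}

lemma IsTest.eq_zero_of_nonpos (hg : IsTest g) {u : ℝ} (hu : u ≤ 0) : g u = 0 :=
  image_eq_zero_of_notMem_tsupport fun h => absurd (hg.supp h) (by simpa using hu)

lemma IsTest.continuous (hg : IsTest g) : Continuous g := hg.smooth.continuous

lemma IsTest.exists_support_subset_Icc (hg : IsTest g) {c : ℝ}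
    (hs : tsupport g ⊆ Ioi c) : ∃ a b : ℝ, c < a ∧ a < b ∧ tsupport g ⊆ Icc a b := by
  rcases (tsupport g).eq_empty_or_nonempty with h | h
  · exact ⟨c + 1, c + 2, by linarith, by linarith, by simp [h]⟩
  · obtain ⟨a, ha, hamin⟩ := hg.compact.isCompact.exists_isLeast h
    obtain ⟨b, hb, hbmax⟩ := hg.compact.isCompact.exists_isGreatest h
    refine ⟨a, b + 1, hs ha, by linarith [hbmax ha], fun u hu => ⟨hamin hu, ?_⟩⟩
    linarith [hbmax hu]

lemma contDiff_mul_of_tsupport_subset {w : ℝ → ℂ} {U : Set ℝ} (hg : ContDiff ℝ (⊤ : ℕ∞) g)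
    (hU : IsOpen U) (hgU : tsupport g ⊆ U) (hw : ContDiffOn ℝ (⊤ : ℕ∞) w U) :
    ContDiff ℝ (⊤ : ℕ∞) fun u => g u * w u := by
  rw [contDiff_iff_contDiffAt]
  intro u
  by_cases hu : u ∈ U
  · exact hg.contDiffAt.mul (hw.contDiffAt (hU.mem_nhds hu))
  · have h0 : g =ᶠ[𝓝 u] 0 := notMem_tsupport_iff_eventuallyEq.1 fun h => hu (hgU h)
    refine (contDiffAt_const (c := (0 : ℂ))).congr_of_eventuallyEq ?_
    filter_upwards [h0] with v hv
    simp [hv]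

lemma tsupport_mul_subset_left' (g w : ℝ → ℂ) : tsupport (fun u => g u * w u) ⊆ tsupport g :=
  closure_mono fun u hu => by
    simp only [Function.mem_support] at hu ⊢
    exact left_ne_zero_of_mul hu

lemma IsTest.mul (hg : IsTest g) {w : ℝ → ℂ} {U : Set ℝ} (hU : IsOpen U)
    (hgU : tsupport g ⊆ U) (hw : ContDiffOn ℝ (⊤ : ℕ∞) w U) :
    IsTest fun u => g u * w u :=
  ⟨contDiff_mul_of_tsupport_subset hg.smooth hU hgU hw, hg.compact.mul_right,
    (tsupport_mul_subset_left' g w).trans hg.supp⟩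

lemma IsTest.mul_deriv (hg : IsTest g) :
    IsTest fun u : ℝ => (u : ℂ) * deriv g u := by
  have h1 : ContDiff ℝ (⊤ : ℕ∞) (deriv g) := by
    have h2 : ContDiff ℝ ((⊤ : ℕ∞) + 1) g := hg.smooth
    exact (contDiff_succ_iff_deriv.1 h2).2.2
  refine ⟨Complex.ofRealCLM.contDiff.mul h1, hg.compact.deriv.mul_left, ?_⟩
  refine (closure_mono ?_).trans ((tsupport_deriv_subset (f := g)).trans hg.supp)
  intro u hu
  exact right_ne_zero_of_mul hu

lemma tsupport_mul_deriv_subset (g : ℝ → ℂ) :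
    tsupport (fun u : ℝ => (u : ℂ) * deriv g u) ⊆ tsupport g := by
  refine (closure_mono ?_).trans (tsupport_deriv_subset (f := g))
  intro u hu
  exact right_ne_zero_of_mul hu

lemma IsTest.continuous_mul (hg : IsTest g) {w : ℝ → ℂ}
    (hw : ContinuousOn w (Ioi 0)) : Continuous fun u => w u * g u := by
  refine ContinuousOn.continuous_of_tsupport_subset (s := Ioi 0)
    (hw.mul hg.smooth.continuous.continuousOn) isOpen_Ioi ?_
  refine (closure_mono ?_).trans hg.supp
  intro u hu
  exact right_ne_zero_of_mul hu

lemma IsTest.integrable_mul (hg : IsTest g) {w : ℝ → ℂ}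
    (hw : ContinuousOn w (Ioi 0)) : Integrable fun u => w u * g u :=
  (hg.continuous_mul hw).integrable_of_hasCompactSupport hg.compact.mul_left

lemma continuousOn_ofReal_cpow (s : ℂ) : ContinuousOn (fun u : ℝ => (u : ℂ) ^ s) (Ioi 0) :=
  fun u hu => (Complex.continuousAt_ofReal_cpow_const u s (Or.inr (ne_of_gt hu))).continuousWithinAt

lemma IsTest.mellinConvergent (hg : IsTest g) (s : ℂ) : MellinConvergent g s :=
  (hg.integrable_mul (continuousOn_ofReal_cpow (s - 1))).integrableOn

lemma norm_mellin_le (g : ℝ → ℂ) (s : ℂ) :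
    ‖mellin g s‖ ≤ ∫ u in Ioi (0 : ℝ), u ^ (s.re - 1) * ‖g u‖ := by
  refine (norm_integral_le_integral_norm _).trans (le_of_eq ?_)
  refine setIntegral_congr_fun measurableSet_Ioi fun u hu => ?_
  simp only [norm_smul, Complex.norm_cpow_eq_rpow_re_of_pos hu, Complex.sub_re, Complex.one_re]

lemma IsTest.integrableOn_rpow_mul_norm (hg : IsTest g) (σ : ℝ) :
    IntegrableOn (fun u : ℝ => u ^ (σ - 1) * ‖g u‖) (Ioi 0) := by
  have := (hg.mellinConvergent (σ : ℂ)).norm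
  refine this.congr ?_
  filter_upwards [ae_restrict_mem measurableSet_Ioi] with u hu
  simp [Complex.norm_cpow_eq_rpow_re_of_pos hu]

/-- Integration by parts; the boundary terms vanish because `g` is zero near `0` and near infinity.
-/
lemma IsTest.mellin_mul_deriv (hg : IsTest g) (s : ℂ) :
    mellin (fun u : ℝ => (u : ℂ) * deriv g u) s = -s * mellin g s := by
  have hz : ∀ᶠ u : ℝ in 𝓝 0, g u = 0 := by
    have : (0 : ℝ) ∉ tsupport g := fun h => by simpa using hg.supp h
    exact notMem_tsupport_iff_eventuallyEq.1 this
  have ht : ∀ᶠ u : ℝ in atTop, g u = 0 := by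
    obtain ⟨a, b, -, -, hab⟩ := hg.exists_support_subset_Icc hg.supp
    filter_upwards [eventually_gt_atTop b] with u hu
    exact image_eq_zero_of_notMem_tsupport fun h => absurd (hab h).2 (not_le.2 hu)
  have hgd : Differentiable ℝ g := hg.smooth.differentiable (by simp)
  have hD := hg.mul_deriv
  have h1 : ∀ u ∈ Ioi (0 : ℝ), HasDerivAt (fun u : ℝ => (u : ℂ) ^ s) (s * (u : ℂ) ^ (s - 1)) u := by
    intro u hu
    have hu0 : (u : ℂ) ∈ Complex.slitPlane := Complex.ofReal_mem_slitPlane.2 hu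
    simpa using ((hasDerivAt_id (u : ℂ)).cpow_const (c := s) hu0).comp_ofReal
  have hpow : ∀ u : ℝ, (u : ℂ) ≠ 0 → (u : ℂ) ^ (s - 1) * u = (u : ℂ) ^ s := fun u hu0 => by
    rw [Complex.cpow_sub _ _ hu0, Complex.cpow_one, div_mul_cancel₀ _ hu0]
  have h2 : ∀ u ∈ Ioi (0 : ℝ), HasDerivAt g (deriv g u) u := fun u _ => (hgd u).hasDerivAt
  have key := integral_Ioi_mul_deriv_eq_deriv_mul (a := (0 : ℝ)) (a' := 0) (b' := 0) h1 h2
    ?_ ?_ ?_ ?_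
  · simp only [mellin, smul_eq_mul]
    rw [sub_zero, zero_sub] at key
    have e1 : ∫ t in Ioi (0 : ℝ), (t : ℂ) ^ (s - 1) * ((t : ℂ) * deriv g t)
        = ∫ t in Ioi (0 : ℝ), (t : ℂ) ^ s * deriv g t := by
      refine setIntegral_congr_fun measurableSet_Ioi fun u hu => ?_
      have hu0 : (u : ℂ) ≠ 0 := by exact_mod_cast (ne_of_gt hu)
      change (u : ℂ) ^ (s - 1) * ((u : ℂ) * deriv g u) = (u : ℂ) ^ s * deriv g u
      rw [← mul_assoc, hpow u hu0]
    rw [e1, key, neg_mul, ← integral_const_mul]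
    congr 1
    refine integral_congr_ae (ae_of_all _ fun u => ?_)
    simp only
    ring
  · have := (hD.integrable_mul (continuousOn_ofReal_cpow (s - 1))).integrableOn (s := Ioi 0)
    refine this.congr_fun (fun u hu => ?_) measurableSet_Ioi
    have hu0 : (u : ℂ) ≠ 0 := by exact_mod_cast (ne_of_gt hu)
    simp only [Pi.mul_apply]
    rw [← mul_assoc, hpow u hu0]
  · have := ((hg.integrable_mul (continuousOn_ofReal_cpow (s - 1))).const_mul s).integrableOn
      (s := Ioi 0)
    refine this.congr_fun (fun u hu => ?_) measurableSet_Ioi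
    simp only [Pi.mul_apply]
    ring
  · refine tendsto_const_nhds.congr' ?_
    filter_upwards [hz.filter_mono nhdsWithin_le_nhds] with u hu
    simp [hu]
  · refine tendsto_const_nhds.congr' ?_
    filter_upwards [ht] with u hu
    simp [hu]

/-- Each application of `u d/du` multiplies the transform by `-s`, so boundedness for all test
functions supported in `T` bootstraps to decay of every order. The quantifier over `g` is what makes
the induction close, since the operator does not enlarge the support. -/
lemma mellin_decay {V : Set ℂ} {T : Set ℝ}
    (hbd : ∀ g, IsTest g → tsupport g ⊆ T → ∃ C : ℝ, ∀ s ∈ V, ‖mellin g s‖ ≤ C) (k : ℕ) :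
    ∀ g, IsTest g → tsupport g ⊆ T →
      ∃ C : ℝ, 0 < C ∧ ∀ s ∈ V, ‖mellin g s‖ ≤ C / (1 + ‖s‖) ^ k := by
  induction k with
  | zero =>
    intro g hg hT
    obtain ⟨C, hC⟩ := hbd g hg hT
    exact ⟨|C| + 1, by positivity, fun s hs => by
      simpa using (hC s hs).trans ((le_abs_self C).trans (by linarith))⟩
  | succ k ih =>
    intro g hg hT
    obtain ⟨C₁, hC₁, h1⟩ := ih g hg hT
    obtain ⟨C₂, hC₂, h2⟩ := ih _ hg.mul_deriv ((tsupport_mul_deriv_subset g).trans hT)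
    refine ⟨C₁ + C₂, by positivity, fun s hs => ?_⟩
    have h3 := h1 s hs
    have h4 := h2 s hs
    rw [hg.mellin_mul_deriv, norm_mul, norm_neg] at h4
    have hp : (0 : ℝ) < (1 + ‖s‖) ^ k := by positivity
    rw [le_div_iff₀ hp] at h3 h4
    rw [le_div_iff₀ (by positivity), pow_succ]
    nlinarith

lemma IsTest.mellin_decay_strip (hg : IsTest g) (σ₀ σ₁ : ℝ) (k : ℕ) :
    ∃ C : ℝ, 0 < C ∧ ∀ s : ℂ, σ₀ ≤ s.re → s.re ≤ σ₁ → ‖mellin g s‖ ≤ C / (1 + ‖s‖) ^ k := by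
  obtain ⟨C, hC, h⟩ := mellin_decay (V := {s | σ₀ ≤ s.re ∧ s.re ≤ σ₁}) (T := univ)
    (fun g hg _ => ⟨(∫ u in Ioi (0 : ℝ), u ^ (σ₀ - 1) * ‖g u‖) +
      ∫ u in Ioi (0 : ℝ), u ^ (σ₁ - 1) * ‖g u‖, fun s hs => by
        refine (norm_mellin_le g s).trans ?_
        rw [← integral_add (hg.integrableOn_rpow_mul_norm _) (hg.integrableOn_rpow_mul_norm _)]
        refine setIntegral_mono_on (hg.integrableOn_rpow_mul_norm _)
          ((hg.integrableOn_rpow_mul_norm _).add (hg.integrableOn_rpow_mul_norm _))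
          measurableSet_Ioi fun u hu => ?_
        rw [← add_mul]
        refine mul_le_mul_of_nonneg_right ?_ (norm_nonneg _)
        have hu0 : (0 : ℝ) < u := hu
        rcases le_total 1 u with h1 | h1
        · have := Real.rpow_le_rpow_of_exponent_le h1 (show s.re - 1 ≤ σ₁ - 1 by linarith [hs.2])
          have h2 : 0 ≤ u ^ (σ₀ - 1) := by positivity
          linarith
        · have := Real.rpow_le_rpow_of_exponent_ge hu0 h1
            (show σ₀ - 1 ≤ s.re - 1 by linarith [hs.1])
          have h2 : 0 ≤ u ^ (σ₁ - 1) := by positivity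
          linarith⟩) k g hg (subset_univ _)
  exact ⟨C, hC, fun s h0 h1 => h s ⟨h0, h1⟩⟩

/-- For `u > 1` the factor `u ^ (Re s)` is largest at the right edge, so no lower bound on `Re s` is
needed. This covers all zeros of an entire function such as `E`, the trivial ones included. -/
lemma IsTest.mellin_decay_left (hg : IsTest g) (hg1 : tsupport g ⊆ Ioi 1)
    (σ₁ : ℝ) (k : ℕ) :
    ∃ C : ℝ, 0 < C ∧ ∀ s : ℂ, s.re ≤ σ₁ → ‖mellin g s‖ ≤ C / (1 + ‖s‖) ^ k := by
  obtain ⟨C, hC, h⟩ := mellin_decay (V := {s | s.re ≤ σ₁}) (T := Ioi 1)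
    (fun g hg hg1 => ⟨∫ u in Ioi (0 : ℝ), u ^ (σ₁ - 1) * ‖g u‖, fun s hs => by
        refine (norm_mellin_le g s).trans ?_
        refine setIntegral_mono_on (hg.integrableOn_rpow_mul_norm _)
          (hg.integrableOn_rpow_mul_norm _) measurableSet_Ioi fun u hu => ?_
        by_cases h1 : u ∈ tsupport g
        · have h2 : (1 : ℝ) < u := hg1 h1
          refine mul_le_mul_of_nonneg_right ?_ (norm_nonneg _)
          have h3 : s.re ≤ σ₁ := hs
          exact Real.rpow_le_rpow_of_exponent_le h2.le (by linarith)
        · simp [image_eq_zero_of_notMem_tsupport h1]⟩) k g hg hg1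
  exact ⟨C, hC, fun s h1 => h s h1⟩

lemma IsTest.continuous_mellin_vertical (hg : IsTest g) (σ : ℝ) :
    Continuous fun t : ℝ => mellin g (σ + t * Complex.I) := by
  have hd : Differentiable ℂ (mellin g) := by
    intro s
    refine mellin_differentiableAt_of_isBigO_rpow (a := s.re + 1) (b := s.re - 1)
      (hg.smooth.continuous.locallyIntegrable.locallyIntegrableOn _) ?_ (by linarith) ?_ (by linarith)
    · obtain ⟨a, b, -, -, hab⟩ := hg.exists_support_subset_Icc hg.supp
      refine EventuallyEq.trans_isBigO ?_ (isBigO_zero _ _)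
      filter_upwards [eventually_gt_atTop b] with u hu
      exact image_eq_zero_of_notMem_tsupport fun h => absurd (hab h).2 (not_le.2 hu)
    · have : (0 : ℝ) ∉ tsupport g := fun h => by simpa using hg.supp h
      refine EventuallyEq.trans_isBigO ?_ (isBigO_zero _ _)
      exact (notMem_tsupport_iff_eventuallyEq.1 this).filter_mono nhdsWithin_le_nhds
  exact hd.continuous.comp (by fun_prop)

lemma IsTest.integrable_mellin_vertical (hg : IsTest g) (σ : ℝ) (k : ℕ) :
    Integrable fun t : ℝ =>
      (1 + ‖(σ + t * Complex.I : ℂ)‖) ^ k * ‖mellin g (σ + t * Complex.I)‖ := by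
  -- The two extra powers produce the integrable majorant `1 / (1 + t ^ 2)`.
  obtain ⟨C, hC, h⟩ := hg.mellin_decay_strip σ σ (k + 2)
  refine (integrable_inv_one_add_sq.const_mul C).mono' ?_ (ae_of_all _ fun t => ?_)
  · refine Continuous.aestronglyMeasurable ?_
    have := (hg.continuous_mellin_vertical σ).norm
    fun_prop
  · have h1 := h (σ + t * Complex.I) (by simp) (by simp)
    have h2 : |t| ≤ ‖(σ + t * Complex.I : ℂ)‖ := by
      simpa using Complex.abs_im_le_norm (σ + t * Complex.I : ℂ)
    set r := ‖(σ + t * Complex.I : ℂ)‖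
    rw [Real.norm_of_nonneg (by positivity)]
    rw [le_div_iff₀ (by positivity)] at h1
    rw [← div_eq_mul_inv, le_div_iff₀ (by positivity)]
    refine le_trans ?_ h1
    have h3 : 1 + t ^ 2 ≤ (1 + r) ^ 2 := by
      have : 0 ≤ |t| := abs_nonneg t
      rw [← sq_abs]
      nlinarith
    calc (1 + r) ^ k * ‖mellin g (σ + t * Complex.I)‖ * (1 + t ^ 2)
        ≤ (1 + r) ^ k * ‖mellin g (σ + t * Complex.I)‖ * (1 + r) ^ 2 := by gcongr
      _ = _ := by ring

lemma IsTest.verticalIntegrable (hg : IsTest g) (σ : ℝ) :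
    Complex.VerticalIntegrable (mellin g) σ := by
  have := hg.integrable_mellin_vertical σ 0
  simp only [pow_zero, one_mul] at this
  exact (integrable_norm_iff (hg.continuous_mellin_vertical σ).aestronglyMeasurable).1 this

lemma IsTest.mellin_inversion (hg : IsTest g) (σ : ℝ) {u : ℝ} (hu : 0 < u) :
    ∫ t : ℝ, (u : ℂ) ^ (-(σ + t * Complex.I : ℂ)) * mellin g (σ + t * Complex.I)
      = 2 * Real.pi * g u := by
  have h := mellinInv_mellin_eq σ g hu (hg.mellinConvergent σ) (hg.verticalIntegrable σ)
    hg.continuous.continuousAt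
  rw [← h, mellinInv]
  simp only [smul_eq_mul, Complex.real_smul]
  push_cast
  rw [← mul_assoc, mul_one_div, div_self (by simp), one_mul]

end TestFunctions

end ZeroRelation

end

noncomputable section

namespace ZeroRelation

open MeasureTheory

/-! ### The explicit formula -/

lemma integrableOn_pow_mul_cexp_neg {w : ℂ} (hw : 0 < w.re) (K : ℕ) :
    IntegrableOn (fun v : ℝ => (v : ℂ) ^ K * Complex.exp (-w * v)) (Ioi 0) := by
  have h := integrableOn_rpow_mul_exp_neg_mul_rpow (p := 1) (s := K)
    (by have : (0 : ℝ) ≤ K := K.cast_nonneg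
        linarith) one_pos hw
  refine Integrable.mono' h (Continuous.aestronglyMeasurable (by fun_prop)) ?_
  filter_upwards [ae_restrict_mem measurableSet_Ioi] with v hv
  have hv0 : (0 : ℝ) < v := hv
  rw [norm_mul, norm_pow, Complex.norm_real, Real.norm_of_nonneg hv0.le, Complex.norm_exp]
  simp

/-- With `w = s - ρ` and `v = log u`, this exhibits `K! / (s - ρ) ^ (K + 1)` as a Laplace transform,
ready for an exchange of integrals. The recursion in `K` is integration by parts. -/
lemma integral_pow_mul_cexp_neg {w : ℂ} (hw : 0 < w.re) (K : ℕ) :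
    ∫ v in Ioi (0 : ℝ), (v : ℂ) ^ K * Complex.exp (-w * v) = K.factorial / w ^ (K + 1) := by
  have hw0 : w ≠ 0 := fun h => by simp [h] at hw
  induction K with
  | zero =>
    have := integral_exp_mul_complex_Ioi (a := -w) (by simpa using hw) 0
    simp only [pow_zero, one_mul, this]
    simp
  | succ K ih =>
    have hF : ∀ v ∈ Ici (0 : ℝ), HasDerivAt
        (fun v : ℝ => (v : ℂ) ^ (K + 1) * Complex.exp (-w * v))
        ((K + 1) * ((v : ℂ) ^ K * Complex.exp (-w * v))
          - w * ((v : ℂ) ^ (K + 1) * Complex.exp (-w * v))) v := by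
      intro v _
      have h1 : HasDerivAt (fun z : ℂ => z ^ (K + 1) * Complex.exp (-w * z))
          ((K + 1) * ((v : ℂ) ^ K * Complex.exp (-w * v))
          - w * ((v : ℂ) ^ (K + 1) * Complex.exp (-w * v))) (v : ℂ) := by
        have h2 := (hasDerivAt_pow (K + 1) (v : ℂ)).mul
          (((hasDerivAt_id (v : ℂ)).const_mul (-w)).cexp)
        refine h2.congr_deriv ?_
        simp only [id, Nat.add_sub_cancel]
        push_cast
        ring
      exact h1.comp_ofReal
    have hint := ((integrableOn_pow_mul_cexp_neg hw K).const_mul ((K : ℂ) + 1)).sub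
      ((integrableOn_pow_mul_cexp_neg hw (K + 1)).const_mul w)
    have hlim : Tendsto (fun v : ℝ => (v : ℂ) ^ (K + 1) * Complex.exp (-w * v)) atTop (𝓝 0) := by
      rw [tendsto_zero_iff_norm_tendsto_zero]
      have h1 := tendsto_rpow_mul_exp_neg_mul_atTop_nhds_zero (K + 1 : ℕ) w.re hw
      refine h1.congr' ?_
      filter_upwards [eventually_gt_atTop 0] with v hv
      rw [norm_mul, norm_pow, Complex.norm_real, Real.norm_of_nonneg hv.le, Complex.norm_exp,
        Real.rpow_natCast]
      simp
    have := integral_Ioi_of_hasDerivAt_of_tendsto' hF hint hlim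
    rw [integral_sub ((integrableOn_pow_mul_cexp_neg hw K).const_mul _)
      ((integrableOn_pow_mul_cexp_neg hw (K + 1)).const_mul w), integral_const_mul,
      integral_const_mul, ih] at this
    simp only [Complex.ofReal_zero, ne_eq, Nat.add_eq_zero_iff, one_ne_zero, and_false,
      not_false_eq_true, zero_pow, zero_mul, sub_zero] at this
    rw [sub_eq_zero] at this
    rw [← mul_right_inj' hw0, ← this, Nat.factorial_succ]
    push_cast
    field_simp
    ring

/-- Substitute `u = exp v`; the support condition restricts the integral to `v > 0`, the range of
the Laplace transform above. -/
lemma mellin_eq_integral_exp {g : ℝ → ℂ} (hg1 : tsupport g ⊆ Ioi 1) (s : ℂ) :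
    mellin g s = ∫ v in Ioi (0 : ℝ), Complex.exp (s * v) * g (Real.exp v) := by
  have himg : Real.exp '' Ioi 0 = Ioi 1 := by
    ext u
    simp only [mem_image, mem_Ioi]
    constructor
    · rintro ⟨v, hv, rfl⟩
      exact Real.one_lt_exp_iff.2 hv
    · intro hu
      exact ⟨Real.log u, Real.log_pos hu, Real.exp_log (by linarith)⟩
  have h1 : mellin g s = ∫ u in Ioi (1 : ℝ), (u : ℂ) ^ (s - 1) * g u := by
    rw [mellin]
    simp only [smul_eq_mul]
    refine setIntegral_eq_of_subset_of_forall_sdiff_eq_zero measurableSet_Ioi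
      (Ioi_subset_Ioi zero_le_one) fun u hu => ?_
    rw [image_eq_zero_of_notMem_tsupport fun h => hu.2 (hg1 h), mul_zero]
  rw [h1, ← himg, integral_image_eq_integral_abs_deriv_smul measurableSet_Ioi
    (fun v _ => (Real.hasDerivAt_exp v).hasDerivWithinAt) Real.exp_injective.injOn]
  refine setIntegral_congr_fun measurableSet_Ioi fun v _ => ?_
  have : (Real.exp v : ℂ) ^ (s - 1) = Complex.exp ((s - 1) * v) := by
    rw [Complex.cpow_def_of_ne_zero (by exact_mod_cast (Real.exp_pos v).ne'),
      ← Complex.ofReal_log (Real.exp_pos v).le, Real.log_exp, mul_comm]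
  simp only [abs_of_pos (Real.exp_pos v), Complex.real_smul, this]
  rw [← mul_assoc, Complex.ofReal_exp, ← Complex.exp_add]
  congr 2
  ring

/-- The inverse Mellin transform of `K! / (s - ρ) ^ (K + 1)` is `u ^ ρ (log u) ^ K` on `u > 1`. -/
lemma integral_mellin_mul_inv_pow {g : ℝ → ℂ} (hg : IsTest g) (hg1 : tsupport g ⊆ Ioi 1)
    {ρ : ℂ} (hρ : ρ.re ≤ 1) (K : ℕ) :
    ∫ t : ℝ, (K.factorial / ((2 + t * Complex.I : ℂ) - ρ) ^ (K + 1)) *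
        mellin g ((2 : ℝ) + t * Complex.I)
      = 2 * Real.pi * mellin (fun u => g u * (Real.log u : ℂ) ^ K) ρ := by
  set W : ℝ → ℂ := fun t => mellin g ((2 : ℝ) + t * Complex.I) with hW
  have hWint : Integrable W := hg.verticalIntegrable 2
  have hWcont : Continuous W := hg.continuous_mellin_vertical 2
  have hre : ∀ t : ℝ, 0 < ((2 + t * Complex.I : ℂ) - ρ).re := by
    intro t
    simp only [Complex.sub_re, Complex.add_re, Complex.re_ofNat, Complex.mul_re, Complex.ofReal_re,
      Complex.I_re, mul_zero, Complex.ofReal_im, Complex.I_im, mul_one, sub_self, add_zero]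
    linarith
  set F : ℝ → ℝ → ℂ := fun t v =>
    W t * ((v : ℂ) ^ K * Complex.exp (-((2 + t * Complex.I : ℂ) - ρ) * v)) with hF
  have h1 : ∀ t : ℝ, (K.factorial / ((2 + t * Complex.I : ℂ) - ρ) ^ (K + 1)) * W t
      = ∫ v in Ioi (0 : ℝ), F t v := by
    intro t
    simp only [hF]
    rw [integral_const_mul, integral_pow_mul_cexp_neg (hre t), mul_comm]
  -- Since the real part of `s` is constant on the line, `‖F t v‖` is a product of a function of `t`
  -- and a function of `v`, so Fubini applies.
  have hFint : Integrable (Function.uncurry F) (volume.prod (volume.restrict (Ioi 0))) := by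
    have h2 : (0 : ℝ) < ((2 : ℂ) - ρ).re := by simpa using hre 0
    refine (hWint.mul_prod (integrableOn_pow_mul_cexp_neg h2 K)).mono
      (Continuous.aestronglyMeasurable ?_) (ae_of_all _ fun z => le_of_eq ?_)
    · simp only [hF, Function.uncurry_def]
      fun_prop
    · simp only [hF, Function.uncurry_def, norm_mul, Complex.norm_exp]
      simp
  -- For fixed `v` the integral over the line is Mellin inversion of `g` at the point `exp v`.
  have h2 : ∀ v ∈ Ioi (0 : ℝ), ∫ t : ℝ, F t v =
      2 * Real.pi * (Complex.exp (ρ * v) * (g (Real.exp v) * (Real.log (Real.exp v) : ℂ) ^ K)) := by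
    intro v _
    have h3 := hg.mellin_inversion 2 (Real.exp_pos v)
    have h4 : ∀ t : ℝ, F t v = ((v : ℂ) ^ K * Complex.exp (ρ * v)) *
        ((Real.exp v : ℂ) ^ (-((2 : ℝ) + t * Complex.I : ℂ)) * W t) := by
      intro t
      rw [Complex.cpow_def_of_ne_zero (by exact_mod_cast (Real.exp_pos v).ne'),
        ← Complex.ofReal_log (Real.exp_pos v).le, Real.log_exp]
      simp only [hF]
      have : Complex.exp (-((2 + t * Complex.I : ℂ) - ρ) * v) = Complex.exp (ρ * v) *
          Complex.exp (v * -((2 : ℝ) + t * Complex.I)) := by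
        rw [← Complex.exp_add]
        congr 1
        push_cast
        ring
      rw [this]
      ring
    simp only [h4]
    rw [integral_const_mul, h3, Real.log_exp]
    ring
  have hts : tsupport (fun u => g u * (Real.log u : ℂ) ^ K) ⊆ Ioi 1 :=
    (tsupport_mul_subset_left' _ _).trans hg1
  calc ∫ t : ℝ, (K.factorial / ((2 + t * Complex.I : ℂ) - ρ) ^ (K + 1)) * W t
      = ∫ t : ℝ, ∫ v in Ioi (0 : ℝ), F t v := integral_congr_ae (ae_of_all _ h1)
    _ = ∫ v in Ioi (0 : ℝ), ∫ t : ℝ, F t v := integral_integral_swap hFint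
    _ = _ := by
      rw [setIntegral_congr_fun measurableSet_Ioi h2, integral_const_mul,
        mellin_eq_integral_exp hts]

/-- The growth at infinity is combined with compactness on a large disc. All constants, and the
change of centre to `c`, are absorbed into `B`, so that Jensen's inequality can be applied about
`c`. -/
lemma IsEntireFiniteOrder.exists_growth {E : ℂ → ℂ} (hE : IsEntireFiniteOrder E) (c : ℂ) :
    ∃ (B : ℝ) (k : ℕ), 0 ≤ B ∧ ∀ z, ‖E z‖ ≤ Real.exp (B * (1 + ‖z - c‖) ^ k) := by
  obtain ⟨hd, A, hA⟩ := hE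
  obtain ⟨C, hC⟩ := hA.bound
  obtain ⟨r, -, hr⟩ := (hasBasis_cobounded_norm (E := ℂ)).eventually_iff.1 hC
  obtain ⟨M, hM⟩ := (isCompact_closedBall (0 : ℂ) (max r 1)).exists_bound_of_continuousOn
    hd.continuous.continuousOn
  set k : ℕ := ⌈A⌉₊
  set C' := max (max |C| |M|) 1 with hC'
  have hC'1 : 1 ≤ C' := le_max_right _ _
  refine ⟨Real.log C' + (1 + ‖c‖) ^ k, k, by have := Real.log_nonneg hC'1; positivity,
    fun z => ?_⟩
  have h1 : 1 ≤ (1 + ‖z - c‖) ^ k := one_le_pow₀ (by linarith [norm_nonneg (z - c)])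
  have h2 : ‖z‖ ^ k ≤ (1 + ‖c‖) ^ k * (1 + ‖z - c‖) ^ k := by
    rw [← mul_pow]
    refine pow_le_pow_left₀ (norm_nonneg z) ?_ _
    have := norm_add_le (z - c) c
    rw [sub_add_cancel] at this
    nlinarith [norm_nonneg (z - c), norm_nonneg c]
  have h3 : ‖E z‖ ≤ C' * Real.exp (‖z‖ ^ k) := by
    by_cases hz : ‖z‖ ≤ max r 1
    · have h4 := hM z (by simpa using hz)
      have h5 : M ≤ C' := (le_abs_self M).trans ((le_max_right _ _).trans (le_max_left _ _))
      have h6 : 1 ≤ Real.exp (‖z‖ ^ k) := Real.one_le_exp (by positivity)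
      nlinarith
    · rw [not_le] at hz
      have h4 := hr (show z ∈ {x | r ≤ ‖x‖} from (le_max_left r 1).trans hz.le)
      rw [Real.norm_of_nonneg (Real.exp_pos _).le] at h4
      have h5 : C ≤ C' := (le_abs_self C).trans ((le_max_left _ _).trans (le_max_left _ _))
      refine h4.trans ?_
      have h6 : ‖z‖ ^ A ≤ ‖z‖ ^ k := by
        rw [← Real.rpow_natCast]
        exact Real.rpow_le_rpow_of_exponent_le ((le_max_right r 1).trans hz.le) (Nat.le_ceil A)
      gcongr
  refine h3.trans ?_
  conv_lhs => rw [← Real.exp_log (show 0 < C' by linarith)]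
  rw [← Real.exp_add, Real.exp_le_exp]
  nlinarith [Real.log_nonneg hC'1]

lemma IsEntireFiniteOrder.exists_summable_zeros {E : ℂ → ℂ} (hE : IsEntireFiniteOrder E) {c : ℂ}
    (hc : E c ≠ 0) :
    ∃ k : ℕ, Summable fun ρ : ℂ => (analyticOrderNatAt E ρ : ℝ) / (1 + ‖ρ‖) ^ k := by
  obtain ⟨B, k, hB, hgr⟩ := hE.exists_growth c
  refine ⟨k + 2, Summable.of_nonneg_of_le (fun _ => by positivity) (fun ρ => ?_)
    ((summable_zeros hE.1 hc hB hgr).mul_left ((1 + ‖c‖) ^ (k + 2)))⟩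
  have h1 : 1 + ‖ρ - c‖ ≤ (1 + ‖c‖) * (1 + ‖ρ‖) := by
    have := norm_sub_le ρ c
    nlinarith [norm_nonneg ρ, norm_nonneg c]
  rw [← mul_div_assoc, div_le_div_iff₀ (by positivity) (by positivity)]
  calc (analyticOrderNatAt E ρ : ℝ) * (1 + ‖ρ - c‖) ^ (k + 2)
      ≤ (analyticOrderNatAt E ρ : ℝ) * ((1 + ‖c‖) * (1 + ‖ρ‖)) ^ (k + 2) := by gcongr
    _ = _ := by rw [mul_pow]; ring

lemma logMul_iterate_apply (l : ℕ → ℂ) (K n : ℕ) :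
    (LSeries.logMul^[K] l) n = (Real.log n : ℂ) ^ K * l n := by
  induction K with
  | zero => simp
  | succ K ih =>
    rw [Function.iterate_succ_apply', LSeries.logMul, ih, ← Complex.natCast_log, pow_succ]
    ring

/-- The data of an entire function `E` of finite order whose logarithmic derivative is,
apart from a pole of order `m` at `1`, minus the Dirichlet series with coefficients `l`. -/
structure LogDerivData (E : ℂ → ℂ) (m : ℕ) (l : ℕ → ℂ) : Prop where
  order : IsEntireFiniteOrder E
  ne_zero : ∀ s : ℂ, 1 < s.re → E s ≠ 0
  summable : ∀ s : ℂ, 1 < s.re → LSeriesSummable l s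
  logDeriv_eq : ∀ s : ℂ, 1 < s.re → logDeriv E s = m / (s - 1) - LSeries l s

section Explicit

variable {E : ℂ → ℂ} {m : ℕ} {l : ℕ → ℂ} {g : ℝ → ℂ}

lemma LogDerivData.abscissa_lt (h : LogDerivData E m l) {s : ℂ} (hs : 1 < s.re) :
    LSeries.abscissaOfAbsConv l < s.re :=
  lt_of_le_of_lt (LSeries.abscissaOfAbsConv_le_of_forall_lt_LSeriesSummable
    (x := 1) fun y hy => h.summable y (by simpa using hy)) (by exact_mod_cast hs)

lemma LogDerivData.re_le_one (h : LogDerivData E m l) {ρ : ℂ} (hρ : analyticOrderNatAt E ρ ≠ 0) :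
    ρ.re ≤ 1 := by
  by_contra hlt
  exact h.ne_zero ρ (not_le.1 hlt) (apply_eq_zero_of_analyticOrderNatAt_ne_zero hρ)

lemma LogDerivData.summable_mellin (h : LogDerivData E m l) (hg : IsTest g)
    (hg1 : tsupport g ⊆ Ioi 1) :
    Summable fun ρ : ℂ => (analyticOrderNatAt E ρ : ℂ) * mellin g ρ := by
  obtain ⟨k, hk⟩ := h.order.exists_summable_zeros (h.ne_zero 2 (by simp))
  obtain ⟨C, hC, hdec⟩ := hg.mellin_decay_left hg1 1 k
  refine Summable.of_norm_bounded (hk.mul_left C) fun ρ => ?_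
  by_cases hρ : analyticOrderNatAt E ρ = 0
  · simp [hρ]
  · rw [norm_mul, Complex.norm_natCast]
    calc (analyticOrderNatAt E ρ : ℝ) * ‖mellin g ρ‖
        ≤ (analyticOrderNatAt E ρ : ℝ) * (C / (1 + ‖ρ‖) ^ k) := by
          gcongr
          exact hdec ρ (h.re_le_one hρ)
      _ = _ := by ring

/-- Beyond the growth exponent, differentiation removes the polynomial ambiguity of Hadamard's
factorization and makes the sum over zeros absolutely convergent. Zeros have `Re ρ ≤ 1`, so points
with `Re s ≥ 2` keep distance at least 1 from them. -/
lemma LogDerivData.hasSum_partial_fractions (h : LogDerivData E m l) :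
    ∃ K₀ : ℕ, ∀ K, K₀ ≤ K → ∀ s : ℂ, 2 ≤ s.re →
      HasSum (fun ρ : ℂ => (analyticOrderNatAt E ρ : ℂ) * (K.factorial / (s - ρ) ^ (K + 1)))
        (m * (K.factorial / (s - 1) ^ (K + 1)) - LSeries (LSeries.logMul^[K] l) s) := by
  obtain ⟨B, k, hB, hgr⟩ := h.order.exists_growth 2
  refine ⟨k + 1, fun K hK s hs => ?_⟩
  have hs1 : 1 < s.re := by linarith
  have hE2 : E 2 ≠ 0 := h.ne_zero 2 (by simp)
  have hH := hasSum_iteratedDeriv_logDeriv h.order.1 hE2 hB hgr hK (s := s) fun ρ hρ => by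
    have h1 : ρ.re ≤ 1 := by
      by_contra hlt
      exact h.ne_zero ρ (not_le.1 hlt) hρ
    have h2 := Complex.abs_re_le_norm (s - ρ)
    have h3 := le_abs_self (s - ρ).re
    rw [Complex.sub_re] at h2 h3
    linarith
  have hloc : logDeriv E =ᶠ[𝓝 s] fun z => (m : ℂ) * (z - 1)⁻¹ - LSeries l z := by
    filter_upwards [(isOpen_lt continuous_const Complex.continuous_re).mem_nhds hs1] with z hz
    rw [h.logDeriv_eq z hz, div_eq_mul_inv]
  have hcd1 : ContDiffAt ℂ K (fun z : ℂ => (m : ℂ) * (z - 1)⁻¹) s := by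
    refine contDiffAt_const.mul ((contDiffAt_id.sub contDiffAt_const).inv ?_)
    intro h0
    have : s = 1 := sub_eq_zero.1 h0
    rw [this] at hs1
    simp at hs1
  have hcd2 : ContDiffAt ℂ K (LSeries l) s :=
    (LSeries_analyticOnNhd l s (h.abscissa_lt hs1)).contDiffAt
  rw [hloc.iteratedDeriv_eq, iteratedDeriv_fun_sub hcd1 hcd2, iteratedDeriv_const_mul_field,
    iteratedDeriv_inv_sub, LSeries_iteratedDeriv K (h.abscissa_lt hs1)] at hH
  -- Both the derivatives of `(s - ρ)⁻¹` and those of the Dirichlet series carry the sign `(-1) ^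
  -- K`, which is cleared throughout.
  have hsq : ((-1 : ℂ) ^ K) * (-1) ^ K = 1 := by
    rw [← mul_pow]; simp
  have := hH.mul_left ((-1 : ℂ) ^ K)
  have e1 : (fun ρ : ℂ => (-1 : ℂ) ^ K * ((analyticOrderNatAt E ρ : ℂ) *
      ((-1) ^ K * K.factorial / (s - ρ) ^ (K + 1)))) =
      fun ρ : ℂ => (analyticOrderNatAt E ρ : ℂ) * (K.factorial / (s - ρ) ^ (K + 1)) := by
    funext ρ
    calc _ = ((-1 : ℂ) ^ K * (-1) ^ K) *
            ((analyticOrderNatAt E ρ : ℂ) * (K.factorial / (s - ρ) ^ (K + 1))) := by ring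
      _ = _ := by rw [hsq, one_mul]
  have e2 : (-1 : ℂ) ^ K * (m * ((-1) ^ K * K.factorial / (s - 1) ^ (K + 1)) -
      (-1) ^ K * LSeries (LSeries.logMul^[K] l) s) =
      m * (K.factorial / (s - 1) ^ (K + 1)) - LSeries (LSeries.logMul^[K] l) s := by
    calc _ = ((-1 : ℂ) ^ K * (-1) ^ K) * (m * (K.factorial / (s - 1) ^ (K + 1)) -
          LSeries (LSeries.logMul^[K] l) s) := by ring
      _ = _ := by rw [hsq, one_mul]
  rwa [e1, e2] at this

/-- The explicit formula for test functions supported in `(1, ∞)`. -/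
theorem LogDerivData.explicit_formula (h : LogDerivData E m l) (hg : IsTest g)
    (hg1 : tsupport g ⊆ Ioi 1) :
    ∑' n : ℕ, l n * g n = m * mellin g 1 - ∑' ρ : ℂ, (analyticOrderNatAt E ρ : ℂ) * mellin g ρ := by
  obtain ⟨K, hpf⟩ := h.hasSum_partial_fractions
  replace hpf := hpf K le_rfl
  -- Dividing by `(log u) ^ K`, which is smooth and nonzero on the support, undoes the `K`
  -- differentiations.
  set gK : ℝ → ℂ := fun u => g u * ((Real.log u : ℂ) ^ K)⁻¹ with hgKdef
  have hlogne : ∀ u : ℝ, 1 < u → (Real.log u : ℂ) ≠ 0 := fun u hu => by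
    exact_mod_cast (Real.log_pos hu).ne'
  have hgK : IsTest gK := by
    refine hg.mul isOpen_Ioi hg1 ?_
    intro u hu
    have hu0 : u ≠ 0 := by have : (1 : ℝ) < u := hu; linarith
    refine ContDiffAt.contDiffWithinAt (ContDiffAt.inv (ContDiffAt.pow ?_ K)
      (pow_ne_zero _ (hlogne u hu)))
    exact Complex.ofRealCLM.contDiff.contDiffAt.comp u (Real.contDiffAt_log.2 hu0)
  have hgK1 : tsupport gK ⊆ Ioi 1 := (tsupport_mul_subset_left' _ _).trans hg1
  have hgKg : ∀ u, gK u * (Real.log u : ℂ) ^ K = g u := by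
    intro u
    by_cases hu : u ∈ tsupport g
    · simp only [hgKdef]
      rw [inv_mul_cancel_right₀ (pow_ne_zero _ (hlogne u (hg1 hu)))]
    · simp [hgKdef, image_eq_zero_of_notMem_tsupport hu]
  set W : ℝ → ℂ := fun t => mellin gK ((2 : ℝ) + t * Complex.I) with hW
  have hWint : Integrable W := hgK.verticalIntegrable 2
  have hWcont : Continuous W := hgK.continuous_mellin_vertical 2
  set S : ℝ → ℂ := fun t => 2 + t * Complex.I with hS
  have hScont : Continuous S := by fun_prop
  have hSre : ∀ t, (S t).re = 2 := fun t => by simp [hS]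
  set l' := LSeries.logMul^[K] l with hl'
  have h2sum : LSeriesSummable l' 2 := by
    refine LSeriesSummable_of_abscissaOfAbsConv_lt_re ?_
    rw [hl', LSeries.absicssaOfAbsConv_logPowMul]
    exact h.abscissa_lt (by simp)
  have hpair : ∀ ρ : ℂ, ρ.re ≤ 1 → ∫ t, (K.factorial / (S t - ρ) ^ (K + 1)) * W t
      = 2 * Real.pi * mellin g ρ := by
    intro ρ hρ
    rw [integral_mellin_mul_inv_pow hgK hgK1 hρ K]
    simp only [hgKg]
  -- integrability of the kernels
  have hkerb : ∀ (ρ : ℂ), ρ.re ≤ 1 → ∀ t, ‖(K.factorial : ℂ) / (S t - ρ) ^ (K + 1) * W t‖ ≤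
      K.factorial / (1 + ‖ρ‖) ^ (K + 1) * (2 ^ (K + 1) * ((1 + ‖S t‖) ^ (K + 1) * ‖W t‖)) := by
    intro ρ hρ t
    have h1 : 1 ≤ ‖S t - ρ‖ := by
      have h2 := Complex.abs_re_le_norm (S t - ρ)
      have h3 := le_abs_self (S t - ρ).re
      rw [Complex.sub_re, hSre] at h2 h3
      linarith
    have h2 : 1 + ‖ρ‖ ≤ 2 * (1 + ‖S t‖) * ‖S t - ρ‖ := by
      have := norm_sub_le (S t) (S t - ρ)
      rw [sub_sub_cancel] at this
      nlinarith [norm_nonneg (S t)]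
    rw [norm_mul, norm_div, norm_pow, Complex.norm_natCast]
    have h3 : (1 + ‖ρ‖) ^ (K + 1) ≤ 2 ^ (K + 1) * (1 + ‖S t‖) ^ (K + 1) * ‖S t - ρ‖ ^ (K + 1) := by
      rw [← mul_pow, ← mul_pow]
      gcongr
    have h4 : 1 / ‖S t - ρ‖ ^ (K + 1) ≤
        2 ^ (K + 1) * (1 + ‖S t‖) ^ (K + 1) / (1 + ‖ρ‖) ^ (K + 1) := by
      rw [div_le_div_iff₀ (by positivity) (by positivity), one_mul]
      exact h3
    calc (K.factorial : ℝ) / ‖S t - ρ‖ ^ (K + 1) * ‖W t‖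
        = K.factorial * ‖W t‖ * (1 / ‖S t - ρ‖ ^ (K + 1)) := by ring
      _ ≤ K.factorial * ‖W t‖ * (2 ^ (K + 1) * (1 + ‖S t‖) ^ (K + 1) / (1 + ‖ρ‖) ^ (K + 1)) := by
          gcongr
      _ = _ := by ring
  have hWK : Integrable fun t => 2 ^ (K + 1) * ((1 + ‖S t‖) ^ (K + 1) * ‖W t‖) := by
    have := (hgK.integrable_mellin_vertical 2 (K + 1)).const_mul (2 ^ (K + 1))
    simpa [hS, hW] using this
  have hkermeas : ∀ ρ : ℂ, ρ.re ≤ 1 →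
      Continuous fun t => (K.factorial : ℂ) / (S t - ρ) ^ (K + 1) * W t := by
    intro ρ hρ
    refine Continuous.mul (continuous_const.div (by fun_prop) fun t => ?_) hWcont
    refine pow_ne_zero _ fun h0 => ?_
    have := congrArg Complex.re h0
    rw [Complex.sub_re, hSre, Complex.zero_re] at this
    linarith
  have hkerint : ∀ ρ : ℂ, ρ.re ≤ 1 →
      Integrable fun t => (K.factorial : ℂ) / (S t - ρ) ^ (K + 1) * W t := fun ρ hρ =>
    (hWK.const_mul _).mono' (hkermeas ρ hρ).aestronglyMeasurable (ae_of_all _ (hkerb ρ hρ))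
  -- the Dirichlet series side
  have hD : HasSum (fun n : ℕ => 2 * Real.pi * (l n * g n)) (∫ t, LSeries l' (S t) * W t) := by
    have hnorm : ∀ (n : ℕ) (t : ℝ), ‖LSeries.term l' (S t) n * W t‖
        = ‖LSeries.term l' 2 n‖ * ‖W t‖ := by
      intro n t
      rw [norm_mul, LSeries.norm_term_eq, LSeries.norm_term_eq, hSre]
      simp
    have hcont : ∀ n : ℕ, Continuous fun t => LSeries.term l' (S t) n * W t := by
      intro n
      refine Continuous.mul ?_ hWcont
      rcases eq_or_ne n 0 with rfl | hn
      · simp only [LSeries.term_zero]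
        exact continuous_const
      · simp only [LSeries.term_of_ne_zero hn]
        have hn0 : (n : ℂ) ≠ 0 := by exact_mod_cast hn
        refine continuous_const.div ?_ fun t => by simp [Complex.cpow_eq_zero_iff, hn]
        exact hScont.const_cpow (Or.inl hn0)
    have hint : ∀ n : ℕ, Integrable fun t => LSeries.term l' (S t) n * W t := fun n =>
      (hWint.norm.const_mul ‖LSeries.term l' 2 n‖).mono' (hcont n).aestronglyMeasurable
        (ae_of_all _ fun t => (hnorm n t).le)
    have hs := hasSum_integral_of_summable_integral_norm hint (by
      simp only [hnorm, integral_const_mul]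
      exact (Summable.norm h2sum).mul_right _)
    -- Mellin inversion at `n` yields `gK n`, and the factor `(log n) ^ K` in `l'` restores `g n`.
    have e1 : (fun n => ∫ t, LSeries.term l' (S t) n * W t) =
        fun n : ℕ => 2 * Real.pi * (l n * g n) := by
      funext n
      rcases eq_or_ne n 0 with rfl | hn
      · have h0 : g 0 = 0 := hg.eq_zero_of_nonpos le_rfl
        simp [h0]
      · have hn0 : (0 : ℝ) < n := by exact_mod_cast Nat.pos_of_ne_zero hn
        have h3 := hgK.mellin_inversion 2 hn0
        have h4 : ∀ t : ℝ, LSeries.term l' (S t) n * W t =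
            l' n * (((n : ℝ) : ℂ) ^ (-((2 : ℝ) + t * Complex.I : ℂ)) * W t) := by
          intro t
          rw [LSeries.term_of_ne_zero hn, Complex.cpow_neg, div_eq_mul_inv]
          simp [hS]
          ring
        simp only [h4]
        rw [integral_const_mul, h3, hl', logMul_iterate_apply, ← hgKg n]
        ring
    have e2 : ∫ t, ∑' n, LSeries.term l' (S t) n * W t = ∫ t, LSeries l' (S t) * W t := by
      refine integral_congr_ae (ae_of_all _ fun t => ?_)
      simp only [LSeries, tsum_mul_right]
    rwa [e1, e2] at hs
  -- the side of the zeros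
  obtain ⟨k, hk⟩ := h.order.exists_summable_zeros (h.ne_zero 2 (by simp))
  -- Exchanging sum and integral requires a countable index set; summability shows that the zeros
  -- form one.
  set Z : Set ℂ := Function.support fun ρ : ℂ => (analyticOrderNatAt E ρ : ℝ) / (1 + ‖ρ‖) ^ k
  have hZc : Z.Countable := hk.countable_support
  have hZ0 : ∀ ρ, ρ ∉ Z → analyticOrderNatAt E ρ = 0 := by
    intro ρ hρ
    have h1 := Function.notMem_support.1 hρ
    rw [div_eq_zero_iff] at h1
    rcases h1 with h1 | h1
    · exact_mod_cast h1
    · exact absurd h1 (by positivity)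
  have hZre : ∀ ρ : Z, (ρ : ℂ).re ≤ 1 := fun ρ => h.re_le_one fun h0 => ρ.2 (by simp [h0])
  have : Countable Z := hZc.to_subtype
  have hsupp : ∀ F : ℂ → ℂ,
      Function.support (fun ρ => (analyticOrderNatAt E ρ : ℂ) * F ρ) ⊆ Z := by
    intro F ρ hρ
    by_contra hn
    exact hρ (by simp [hZ0 ρ hn])
  -- The exponent must be `K + 1`, to match the kernels. It is obtained from the absolute
  -- convergence of the partial fractions at the single point `s = 2`.
  have hsumK : Summable fun ρ : ℂ => (analyticOrderNatAt E ρ : ℝ) / (1 + ‖ρ‖) ^ (K + 1) := by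
    have h1 := (hpf 2 (by simp)).summable.norm
    refine Summable.of_nonneg_of_le (fun _ => by positivity) (fun ρ => ?_) (h1.mul_left (2 ^ (K + 1)))
    have h2 : ‖2 - ρ‖ ≤ 2 * (1 + ‖ρ‖) := by
      have := norm_sub_le 2 ρ
      simp only [Complex.norm_ofNat] at this
      linarith [norm_nonneg ρ]
    rw [norm_mul, norm_div, norm_pow, Complex.norm_natCast, Complex.norm_natCast]
    by_cases h0 : analyticOrderNatAt E ρ = 0
    · simp [h0]
    have h3 : 0 < ‖2 - ρ‖ := by
      rw [norm_pos_iff, sub_ne_zero]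
      rintro rfl
      have := h.re_le_one h0
      norm_num at this
    have h4 : 1 / (1 + ‖ρ‖) ^ (K + 1) ≤ 2 ^ (K + 1) / ‖2 - ρ‖ ^ (K + 1) := by
      rw [div_le_div_iff₀ (by positivity) (by positivity), one_mul, ← mul_pow]
      gcongr
    have h5 : (1 : ℝ) ≤ K.factorial := by exact_mod_cast K.factorial_pos
    calc (analyticOrderNatAt E ρ : ℝ) / (1 + ‖ρ‖) ^ (K + 1)
        = analyticOrderNatAt E ρ * (1 / (1 + ‖ρ‖) ^ (K + 1)) := by ring
      _ ≤ analyticOrderNatAt E ρ * (2 ^ (K + 1) / ‖2 - ρ‖ ^ (K + 1)) := by gcongr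
      _ ≤ K.factorial * (analyticOrderNatAt E ρ * (2 ^ (K + 1) / ‖2 - ρ‖ ^ (K + 1))) :=
          le_mul_of_one_le_left (by positivity) h5
      _ = _ := by ring
  have hz := hasSum_integral_of_summable_integral_norm (ι := Z) (μ := volume)
    (F := fun (ρ : Z) t => (analyticOrderNatAt E ρ : ℂ) *
      ((K.factorial : ℂ) / (S t - ρ) ^ (K + 1) * W t))
    (fun ρ => (hkerint ρ (hZre ρ)).const_mul _) (by
      set I := ∫ t, 2 ^ (K + 1) * ((1 + ‖S t‖) ^ (K + 1) * ‖W t‖)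
      have h1 := ((hsumK.subtype Z).mul_left (K.factorial * I))
      refine Summable.of_nonneg_of_le (fun _ => by positivity) (fun ρ => ?_) h1
      simp only [Function.comp_apply]
      have h2 : ∫ t, ‖(analyticOrderNatAt E ρ : ℂ) *
          ((K.factorial : ℂ) / (S t - ρ) ^ (K + 1) * W t)‖ ≤
          ∫ t, (analyticOrderNatAt E ρ : ℝ) * (K.factorial / (1 + ‖(ρ : ℂ)‖) ^ (K + 1) *
            (2 ^ (K + 1) * ((1 + ‖S t‖) ^ (K + 1) * ‖W t‖))) := by
        refine integral_mono ((hkerint ρ (hZre ρ)).const_mul _).norm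
          ((hWK.const_mul _).const_mul _) fun t => ?_
        simp only
        rw [norm_mul, Complex.norm_natCast]
        gcongr
        exact hkerb ρ (hZre ρ) t
      rw [integral_const_mul, integral_const_mul] at h2
      refine h2.trans (le_of_eq ?_)
      ring)
  -- This is the partial fraction identity integrated along the line: the pole at 1 behaves like a
  -- zero counted with multiplicity `-m`.
  have hzeq : ∫ t, LSeries l' (S t) * W t = 2 * Real.pi * (m * mellin g 1)
      - ∫ t, ∑' ρ : Z, (analyticOrderNatAt E ρ : ℂ) *
        ((K.factorial : ℂ) / (S t - ρ) ^ (K + 1) * W t) := by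
    have h1 : ∀ t, ∑' ρ : Z, (analyticOrderNatAt E ρ : ℂ) *
        ((K.factorial : ℂ) / (S t - ρ) ^ (K + 1) * W t) =
        m * (K.factorial / (S t - 1) ^ (K + 1) * W t) - LSeries l' (S t) * W t := by
      intro t
      have h2 := (hasSum_subtype_iff_of_support_subset (hsupp _)).2 (hpf (S t) (hSre t).ge)
      rw [show (m : ℂ) * (K.factorial / (S t - 1) ^ (K + 1) * W t) - LSeries l' (S t) * W t
        = (m * (K.factorial / (S t - 1) ^ (K + 1)) - LSeries l' (S t)) * W t by ring,
        ← (h2.mul_right (W t)).tsum_eq]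
      refine tsum_congr fun ρ => ?_
      simp only [Function.comp_apply]
      ring
    have hLint : Integrable fun t => LSeries l' (S t) * W t := by
      have hLc : Continuous fun t => LSeries l' (S t) := by
        rw [continuous_iff_continuousAt]
        intro t
        have h3 : LSeries.abscissaOfAbsConv l' < (S t).re := by
          rw [hl', LSeries.absicssaOfAbsConv_logPowMul]
          exact h.abscissa_lt (by rw [hSre]; norm_num)
        exact ContinuousAt.comp (f := S)
          (LSeries_analyticOnNhd l' (S t) h3).continuousAt hScont.continuousAt
      refine (hWint.norm.const_mul (∑' n, ‖LSeries.term l' 2 n‖)).mono'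
        (hLc.mul hWcont).aestronglyMeasurable (ae_of_all _ fun t => ?_)
      rw [norm_mul]
      gcongr
      have h4 : ∀ n, ‖LSeries.term l' (S t) n‖ = ‖LSeries.term l' 2 n‖ := fun n => by
        rw [LSeries.norm_term_eq, LSeries.norm_term_eq, hSre]
        simp
      calc ‖LSeries l' (S t)‖ ≤ ∑' n, ‖LSeries.term l' (S t) n‖ :=
            norm_tsum_le_tsum_norm (by simp only [h4]; exact Summable.norm h2sum)
        _ = _ := by simp only [h4]
    simp only [h1]
    rw [integral_sub ((hkerint 1 (by simp)).const_mul _) hLint, integral_const_mul,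
      hpair 1 (by simp)]
    ring
  have hfin : HasSum (fun ρ : Z => 2 * Real.pi * ((analyticOrderNatAt E ρ : ℂ) * mellin g ρ))
      (∫ t, ∑' ρ : Z, (analyticOrderNatAt E ρ : ℂ) *
        ((K.factorial : ℂ) / (S t - ρ) ^ (K + 1) * W t)) := by
    have e1 : (fun ρ : Z => ∫ t, (analyticOrderNatAt E ρ : ℂ) *
        ((K.factorial : ℂ) / (S t - ρ) ^ (K + 1) * W t)) =
        fun ρ : Z => 2 * Real.pi * ((analyticOrderNatAt E ρ : ℂ) * mellin g ρ) := by
      funext ρ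
      rw [integral_const_mul, hpair ρ (hZre ρ)]
      ring
    rwa [e1] at hz
  have hpi : (2 * Real.pi : ℂ) ≠ 0 := by
    simp
  have hZsum : ∑' ρ : Z, (analyticOrderNatAt E ρ : ℂ) * mellin g ρ
      = ∑' ρ : ℂ, (analyticOrderNatAt E ρ : ℂ) * mellin g ρ :=
    tsum_subtype_eq_of_support_subset (hsupp _)
  rw [← hfin.tsum_eq, ← hD.tsum_eq, tsum_mul_left, tsum_mul_left, hZsum, ← mul_sub] at hzeq
  exact mul_left_cancel₀ hpi hzeq

end Explicit

end ZeroRelation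

end

noncomputable section

namespace ZeroRelation

open MeasureTheory

/-! ### Orders of the Gamma factor and of the completed function -/

lemma meromorphicOrderAt_of_analyticAt_ne_zero {f : ℂ → ℂ} {z : ℂ} (hf : AnalyticAt ℂ f z)
    (hz : f z ≠ 0) : meromorphicOrderAt f z = 0 := by
  rw [hf.meromorphicOrderAt_eq, hf.analyticOrderAt_eq_zero.2 hz]
  simp

/-- From `1/Γ(s) = s · 1/Γ(s + 1)`: the zero at `0` is simple, and each step to the left multiplies
by a factor that does not vanish at the new point. -/
lemma meromorphicOrderAt_inv_Gamma_neg_nat (n : ℕ) :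
    meromorphicOrderAt (fun s : ℂ => (Complex.Gamma s)⁻¹) (-n) = 1 := by
  have hA : ∀ s, AnalyticAt ℂ (fun s : ℂ => (Complex.Gamma s)⁻¹) s := fun s =>
    Complex.differentiable_one_div_Gamma.analyticAt s
  have hB : ∀ s, AnalyticAt ℂ (fun s : ℂ => (Complex.Gamma (s + 1))⁻¹) s := fun s =>
    (Complex.differentiable_one_div_Gamma.comp (differentiable_id.add_const 1)).analyticAt s
  have hrec : (fun s : ℂ => (Complex.Gamma s)⁻¹) =
      id * fun s : ℂ => (Complex.Gamma (s + 1))⁻¹ :=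
    funext Complex.one_div_Gamma_eq_self_mul_one_div_Gamma_add_one
  have hstep : ∀ s : ℂ, meromorphicOrderAt (fun s : ℂ => (Complex.Gamma s)⁻¹) s =
      meromorphicOrderAt id s +
        meromorphicOrderAt (fun s : ℂ => (Complex.Gamma s)⁻¹) (s + 1) := by
    intro s
    conv_lhs => rw [hrec]
    rw [meromorphicOrderAt_mul analyticAt_id.meromorphicAt (hB s).meromorphicAt,
      ← meromorphicOrderAt_comp_add_const_eq_meromorphicOrderAt]
    rfl
  induction n with
  | zero =>
    rw [hstep]
    simp only [Nat.cast_zero, neg_zero, zero_add]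
    rw [meromorphicOrderAt_of_analyticAt_ne_zero (hA 1) (by simp), add_zero]
    exact meromorphicOrderAt_id
  | succ n ih =>
    rw [hstep, meromorphicOrderAt_of_analyticAt_ne_zero analyticAt_id, zero_add,
      ← ih]
    · congr 1
      push_cast
      ring
    · push_cast
      exact neg_ne_zero.2 (by exact_mod_cast n.succ_ne_zero)

open Classical in
lemma meromorphicOrderAt_Gamma (s : ℂ) :
    meromorphicOrderAt Complex.Gamma s = if ∃ n : ℕ, s = -n then -1 else 0 := by
  have h : Complex.Gamma = (fun s : ℂ => (Complex.Gamma s)⁻¹)⁻¹ := by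
    funext s; simp
  split_ifs with hs
  · obtain ⟨n, rfl⟩ := hs
    rw [h, meromorphicOrderAt_inv, meromorphicOrderAt_inv_Gamma_neg_nat]
  · push Not at hs
    rw [h, meromorphicOrderAt_inv, meromorphicOrderAt_of_analyticAt_ne_zero
      (Complex.differentiable_one_div_Gamma.analyticAt s) (inv_ne_zero (Complex.Gamma_ne_zero hs))]
    simp

namespace GammaFactor

open Classical in
/-- The number of Gamma functions of the factor having a pole at `s`. -/
def poleCount (G : GammaFactor) (s : ℂ) : ℕ :=
  (Finset.univ.filter fun j => ∃ n : ℕ, (G.lam j : ℂ) * s + G.mu j = -n).card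

variable (G : GammaFactor)

lemma differentiable_affine (j : Fin G.r) :
    Differentiable ℂ fun s : ℂ => (G.lam j : ℂ) * s + G.mu j := by fun_prop

lemma meromorphicAt_Gamma_affine (j : Fin G.r) (s : ℂ) :
    MeromorphicAt (fun s : ℂ => Complex.Gamma ((G.lam j : ℂ) * s + G.mu j)) s :=
  (Meromorphic.Gamma _).comp_analyticAt ((G.differentiable_affine j).analyticAt s)

lemma analyticAt_Q_cpow (s : ℂ) : AnalyticAt ℂ (fun s : ℂ => (G.Q : ℂ) ^ s) s := by
  have hQ : (G.Q : ℂ) ≠ 0 := by exact_mod_cast G.Q_pos.ne'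
  have : Differentiable ℂ fun s : ℂ => (G.Q : ℂ) ^ s :=
    fun z => differentiableAt_id.const_cpow (Or.inl hQ)
  exact this.analyticAt s

lemma Q_cpow_ne_zero (s : ℂ) : (G.Q : ℂ) ^ s ≠ 0 := by
  have hQ : (G.Q : ℂ) ≠ 0 := by exact_mod_cast G.Q_pos.ne'
  simp [Complex.cpow_eq_zero_iff, hQ]

lemma meromorphicAt_prod (s : ℂ) :
    MeromorphicAt (fun s : ℂ => ∏ j, Complex.Gamma ((G.lam j : ℂ) * s + G.mu j)) s :=
  MeromorphicAt.fun_prod fun j _ => G.meromorphicAt_Gamma_affine j s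

lemma meromorphicAt_eval (s : ℂ) : MeromorphicAt G.eval s :=
  (G.analyticAt_Q_cpow s).meromorphicAt.mul (G.meromorphicAt_prod s)

/-- Since `lam j ≠ 0`, composing with an affine map keeps every Gamma pole simple. The power of `Q`
never vanishes, and Gamma has no zeros to cancel a pole. -/
lemma meromorphicOrderAt_eval (s : ℂ) :
    meromorphicOrderAt G.eval s = ((-(G.poleCount s : ℤ) : ℤ) : WithTop ℤ) := by
  classical
  have h : G.eval = (fun s : ℂ => (G.Q : ℂ) ^ s) *
      fun s : ℂ => ∏ j, Complex.Gamma ((G.lam j : ℂ) * s + G.mu j) := rfl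
  rw [h, meromorphicOrderAt_mul (G.analyticAt_Q_cpow s).meromorphicAt (G.meromorphicAt_prod s),
    meromorphicOrderAt_of_analyticAt_ne_zero (G.analyticAt_Q_cpow s) (G.Q_cpow_ne_zero s),
    zero_add, meromorphicOrderAt_fun_prod fun j _ => G.meromorphicAt_Gamma_affine j s]
  have h1 : ∀ j, meromorphicOrderAt (fun s : ℂ => Complex.Gamma ((G.lam j : ℂ) * s + G.mu j)) s
      = ((if ∃ n : ℕ, (G.lam j : ℂ) * s + G.mu j = -n then -1 else 0 : ℤ) : WithTop ℤ) := by
    intro j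
    have hd : HasDerivAt (fun s : ℂ => (G.lam j : ℂ) * s + G.mu j) (G.lam j) s := by
      simpa using ((hasDerivAt_id s).const_mul (G.lam j : ℂ)).add_const (G.mu j)
    have h2 := meromorphicOrderAt_comp_of_deriv_ne_zero (f := Complex.Gamma)
      ((G.differentiable_affine j).analyticAt s)
      (by rw [hd.deriv]; exact_mod_cast (G.lam_pos j).ne')
    rw [meromorphicOrderAt_Gamma] at h2
    rw [show (fun s : ℂ => Complex.Gamma ((G.lam j : ℂ) * s + G.mu j))
      = Complex.Gamma ∘ fun s : ℂ => (G.lam j : ℂ) * s + G.mu j from rfl, h2]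
    split_ifs <;> rfl
  simp only [h1]
  have h3 : (∑ j : Fin G.r, ((if ∃ n : ℕ, (G.lam j : ℂ) * s + G.mu j = -n then -1 else 0 : ℤ) :
      WithTop ℤ)) = ((∑ j : Fin G.r,
        if ∃ n : ℕ, (G.lam j : ℂ) * s + G.mu j = -n then -1 else 0 : ℤ) : WithTop ℤ) := by
    push_cast
    rfl
  rw [h3, ← Finset.sum_filter]
  simp [poleCount]

lemma poleCount_eq_zero {s : ℂ} (hs : G.Regular s) : G.poleCount s = 0 := by
  classical
  rw [poleCount, Finset.card_eq_zero, Finset.filter_eq_empty_iff]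
  rintro j - ⟨n, hn⟩
  exact hs j n hn

lemma regular_of_re_pos {s : ℂ} (hs : 0 < s.re) : G.Regular s := by
  intro j n h
  have h1 := congrArg Complex.re h
  simp only [Complex.add_re, Complex.mul_re, Complex.ofReal_re, Complex.ofReal_im, zero_mul,
    sub_zero, Complex.neg_re, Complex.natCast_re] at h1
  have h2 := mul_pos (G.lam_pos j) hs
  have h3 := G.mu_re j
  have h4 : (0 : ℝ) ≤ n := n.cast_nonneg
  linarith

end GammaFactor

section Completed

variable {E L : ℂ → ℂ} {m : ℕ} {G : GammaFactor}

lemma meromorphicOrderAt_of_entire (hE : Differentiable ℂ E) {c : ℂ} (hc : E c ≠ 0) (s : ℂ) :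
    meromorphicOrderAt E s = ((analyticOrderNatAt E s : ℤ) : WithTop ℤ) := by
  rw [(hE.analyticAt s).meromorphicOrderAt_eq,
    ← Nat.cast_analyticOrderNatAt (analyticOrderAt_ne_top_of_entire hE hc s)]
  simp

lemma analyticOrderNatAt_eq_zero_of_ne {ρ : ℂ} (h : E ρ ≠ 0) : analyticOrderNatAt E ρ = 0 := by
  by_contra h0
  exact h (apply_eq_zero_of_analyticOrderNatAt_ne_zero h0)

/-- The order of the completed function in terms of that of `(s - 1) ^ m * L s`. -/
lemma meromorphicOrderAt_completed (hE : Differentiable ℂ E) {c : ℂ} (hc : E c ≠ 0)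
    (hEL : ∀ s, s ≠ 1 → E s = (s - 1) ^ m * L s) (ρ : ℂ) :
    meromorphicOrderAt (completed G L) ρ = (((analyticOrderNatAt E ρ : ℤ) - G.poleCount ρ
      - if ρ = 1 then (m : ℤ) else 0 : ℤ) : WithTop ℤ) := by
  have h1 : completed G L =ᶠ[𝓝[≠] ρ] fun s => G.eval s * (E s * ((s - 1) ^ m)⁻¹) := by
    have h2 : ∀ᶠ s in 𝓝[≠] ρ, s ≠ 1 := by
      by_cases hρ : ρ = 1
      · rw [hρ]
        exact self_mem_nhdsWithin
      · exact nhdsWithin_le_nhds (isOpen_ne.mem_nhds hρ)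
    filter_upwards [h2] with s hs
    have h3 : (s - 1) ^ m ≠ 0 := pow_ne_zero _ (sub_ne_zero.2 hs)
    rw [completed, hEL s hs, mul_comm ((s - 1) ^ m), mul_inv_cancel_right₀ h3]
  have hp : MeromorphicAt (fun s : ℂ => ((s - 1) ^ m)⁻¹) ρ := by fun_prop
  have hEm : MeromorphicAt E ρ := (hE.analyticAt ρ).meromorphicAt
  rw [meromorphicOrderAt_congr h1]
  have h4 : (fun s => G.eval s * (E s * ((s - 1) ^ m)⁻¹)) =
      G.eval * (E * fun s : ℂ => ((s - 1) ^ m)⁻¹) := rfl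
  have h5 : meromorphicOrderAt (fun s : ℂ => ((s - 1) ^ m)⁻¹) ρ =
      ((-(if ρ = 1 then (m : ℤ) else 0) : ℤ) : WithTop ℤ) := by
    split_ifs with hρ
    · rw [hρ]
      have : (fun s : ℂ => ((s - 1) ^ m)⁻¹) = fun s : ℂ => (s - 1) ^ (-(m : ℤ)) := by
        funext s
        rw [zpow_neg, zpow_natCast]
      rw [this]
      exact fun_meromorphicOrderAt_zpow_id_sub_const
    · have h6 : AnalyticAt ℂ (fun s : ℂ => ((s - 1) ^ m)⁻¹) ρ :=
        AnalyticAt.inv (by fun_prop) (pow_ne_zero _ (sub_ne_zero.2 hρ))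
      rw [meromorphicOrderAt_of_analyticAt_ne_zero h6
        (inv_ne_zero (pow_ne_zero _ (sub_ne_zero.2 hρ)))]
      rfl
  rw [h4, meromorphicOrderAt_mul (G.meromorphicAt_eval ρ) (hEm.mul hp),
    meromorphicOrderAt_mul hEm hp, h5, G.meromorphicOrderAt_eval,
    meromorphicOrderAt_of_entire hE hc, ← WithTop.coe_add, ← WithTop.coe_add]
  congr 1
  ring

/-- The truncated subtraction is intended: where Gamma poles outnumber the zeros of `E` there is a
pole, hence multiplicity zero. At `ρ = 1` there is no Gamma pole, and `hm` excludes a zero of `E`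
hiding behind the pole of `L`. -/
lemma zeroMult_completed (hE : Differentiable ℂ E) {c : ℂ} (hc : E c ≠ 0)
    (hEL : ∀ s, s ≠ 1 → E s = (s - 1) ^ m * L s) (hm : m = 0 ∨ E 1 ≠ 0) (ρ : ℂ) :
    zeroMult (completed G L) ρ = analyticOrderNatAt E ρ - G.poleCount ρ := by
  rw [zeroMult, meromorphicOrderAt_completed hE hc hEL, WithTop.untop₀_coe]
  by_cases hρ : ρ = 1
  · subst hρ
    have h0 : G.poleCount 1 = 0 := G.poleCount_eq_zero (G.regular_of_re_pos (by simp))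
    rcases hm with rfl | h1
    · simp [h0]
    · simp [h0, analyticOrderNatAt_eq_zero_of_ne h1]
  · simp only [hρ, if_false, sub_zero]
    omega

end Completed

end ZeroRelation

end

noncomputable section

namespace ZeroRelation

open MeasureTheory

/-! ### Sums over the zeros of the completed function -/

lemma zeroMult_eq_zero_of_tendsto {F : ℂ → ℂ} {ρ c : ℂ} (hc : c ≠ 0)
    (hF : Tendsto F (𝓝[≠] ρ) (𝓝 c)) : zeroMult F ρ = 0 := by
  by_contra h
  have h1 : 0 < meromorphicOrderAt F ρ := by
    rw [zeroMult] at h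
    rcases hm : meromorphicOrderAt F ρ with _ | n
    · exact WithTop.coe_lt_top 0
    · rw [hm] at h
      have h2 : 0 < n := by
        by_contra h3
        exact h (Int.toNat_of_nonpos (not_lt.1 h3))
      exact WithTop.coe_pos.2 h2
  exact hc (tendsto_nhds_unique hF (tendsto_zero_of_meromorphicOrderAt_pos h1))

/-- `Complex.Gamma` is assigned the value 0 exactly at its poles, so regularity can be read off from
the value of the product. -/
lemma GammaFactor.regular_iff (G : GammaFactor) (s : ℂ) : G.Regular s ↔ G.eval s ≠ 0 := by
  rw [GammaFactor.eval, mul_ne_zero_iff, Finset.prod_ne_zero_iff]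
  simp only [G.Q_cpow_ne_zero s, ne_eq, not_false_eq_true, true_and, Finset.mem_univ,
    forall_true_left, Complex.Gamma_eq_zero_iff, not_exists]
  rfl

lemma GammaFactor.eventually_regular (G : GammaFactor) (s : ℂ) : ∀ᶠ z in 𝓝[≠] s, G.Regular z := by
  have h : meromorphicOrderAt G.eval s ≠ ⊤ := by
    rw [G.meromorphicOrderAt_eval]
    exact WithTop.coe_ne_top
  filter_upwards [(meromorphicOrderAt_ne_top_iff_eventually_ne_zero (G.meromorphicAt_eval s)).1 h]
    with z hz
  exact (G.regular_iff z).2 hz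

lemma GammaFactor.differentiableAt_eval (G : GammaFactor) {s : ℂ} (hs : G.Regular s) :
    DifferentiableAt ℂ G.eval s := by
  have h1 : DifferentiableAt ℂ
      (fun s : ℂ => ∏ j, Complex.Gamma ((G.lam j : ℂ) * s + G.mu j)) s := by
    refine DifferentiableAt.fun_finsetProd fun j _ => ?_
    exact (Complex.differentiableAt_Gamma _ (hs j)).comp s (G.differentiable_affine j s)
  exact (G.analyticAt_Q_cpow s).differentiableAt.mul h1

section Completed

variable {E L : ℂ → ℂ} {m : ℕ} {l : ℕ → ℂ} {G : GammaFactor}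

/-- By the functional equation the completed function has no zeros to the left of `0`. -/
lemma zeroMult_completed_eq_zero_of_re_neg (hG : FunctionalEquation G L)
    (hd : ∀ s : ℂ, 1 < s.re → DifferentiableAt ℂ L s) (hne : ∀ s : ℂ, 1 < s.re → L s ≠ 0) {ρ : ℂ}
    (hρ : ρ.re < 0) : zeroMult (completed G L) ρ = 0 := by
  obtain ⟨ω, hω, hfe⟩ := hG
  have hre : ∀ s : ℂ, s.re < 0 → 1 < (1 - (starRingEnd ℂ) s).re := fun s hs => by
    simp only [Complex.sub_re, Complex.one_re, Complex.conj_re]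
    linarith
  have hreg : ∀ s : ℂ, 1 < s.re → G.Regular s := fun s hs =>
    G.regular_of_re_pos (by linarith)
  have hcont : ContinuousAt (fun s => ω * (starRingEnd ℂ)
      (completed G L (1 - (starRingEnd ℂ) s))) ρ := by
    have h1 : ContinuousAt (completed G L) (1 - (starRingEnd ℂ) ρ) :=
      ((G.differentiableAt_eval (hreg _ (hre ρ hρ))).mul (hd _ (hre ρ hρ))).continuousAt
    have h2 : ContinuousAt (fun s : ℂ => 1 - (starRingEnd ℂ) s) ρ := by fun_prop
    have h3 := ContinuousAt.comp (f := fun s : ℂ => 1 - (starRingEnd ℂ) s) h1 h2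
    exact continuousAt_const.mul (Complex.continuous_conj.continuousAt.comp h3)
  have hval : ω * (starRingEnd ℂ) (completed G L (1 - (starRingEnd ℂ) ρ)) ≠ 0 := by
    refine mul_ne_zero (fun h => by simp [h] at hω) ?_
    rw [Ne, map_eq_zero]
    exact mul_ne_zero ((G.regular_iff _).1 (hreg _ (hre ρ hρ))) (hne _ (hre ρ hρ))
  refine zeroMult_eq_zero_of_tendsto hval ((hcont.tendsto.mono_left nhdsWithin_le_nhds).congr' ?_)
  -- The functional equation is available only off the Gamma poles, but these are isolated and the
  -- order depends only on a punctured neighbourhood.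
  have h4 : ∀ᶠ s : ℂ in 𝓝[≠] ρ, s.re < 0 :=
    nhdsWithin_le_nhds ((isOpen_lt Complex.continuous_re continuous_const).mem_nhds hρ)
  filter_upwards [h4, G.eventually_regular ρ] with s hs hsr
  refine (hfe s ?_ ?_ hsr (hreg _ (hre s hs))).symm
  · rintro rfl; simp at hs
  · rintro rfl; simp at hs; linarith

/-- The zeros have polynomial density, while the Mellin transform decays to any order in the strip.
Confinement to a strip replaces any condition on the support of `g`, so every dilate is allowed. -/
lemma summable_zeroTerm {F : ℂ → ℂ} {g : ℝ → ℂ} (hE : IsEntireFiniteOrder E) {c : ℂ}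
    (hc : E c ≠ 0) (hle : ∀ ρ, zeroMult F ρ ≤ analyticOrderNatAt E ρ)
    (hstrip : ∀ ρ, zeroMult F ρ ≠ 0 → 0 ≤ ρ.re ∧ ρ.re ≤ 1) (hg : IsTest g) :
    Summable (zeroTerm F g) := by
  obtain ⟨k, hk⟩ := hE.exists_summable_zeros hc
  obtain ⟨C, hC, hdec⟩ := hg.mellin_decay_strip 0 1 k
  refine Summable.of_norm_bounded (hk.mul_left C) fun ρ => ?_
  by_cases h0 : zeroMult F ρ = 0
  · simp only [zeroTerm, h0, Nat.cast_zero, zero_mul, norm_zero]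
    positivity
  · rw [zeroTerm, norm_mul, Complex.norm_natCast]
    calc (zeroMult F ρ : ℝ) * ‖mellin g ρ‖
        ≤ (analyticOrderNatAt E ρ : ℝ) * (C / (1 + ‖ρ‖) ^ k) := by
          have h1 : (zeroMult F ρ : ℝ) ≤ analyticOrderNatAt E ρ := by exact_mod_cast hle ρ
          gcongr
          exact hdec ρ (hstrip ρ h0).1 (hstrip ρ h0).2
      _ = _ := by ring

namespace GammaFactor

/-- The `n`-th pole of the `j`-th Gamma function of the factor. -/
def pole (G : GammaFactor) (j : Fin G.r) (n : ℕ) : ℂ := -(n + G.mu j) / G.lam j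

lemma eq_pole_iff (G : GammaFactor) (j : Fin G.r) (n : ℕ) (s : ℂ) :
    (G.lam j : ℂ) * s + G.mu j = -n ↔ s = G.pole j n := by
  have h : (G.lam j : ℂ) ≠ 0 := by exact_mod_cast (G.lam_pos j).ne'
  rw [pole, eq_div_iff h]
  constructor <;> intro h1 <;> linear_combination h1

lemma pole_re (G : GammaFactor) (j : Fin G.r) (n : ℕ) :
    (G.pole j n).re = -((n + (G.mu j).re) / G.lam j) := by
  rw [pole, Complex.div_ofReal_re]
  simp
  ring

/-- The total contribution of the poles of the Gamma factor to a weighted sum. -/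
lemma sum_poleCount_mul_le (G : GammaFactor) {a : ℂ → ℝ} (ha : ∀ s, 0 ≤ a s)
    {B : Fin G.r → ℕ → ℝ} (hB : ∀ j n, a (G.pole j n) ≤ B j n) (hBs : ∀ j, Summable (B j))
    (T : Finset ℂ) : ∑ ρ ∈ T, (G.poleCount ρ : ℝ) * a ρ ≤ ∑ j, ∑' n, B j n := by
  classical
  have h1 : ∀ ρ, (G.poleCount ρ : ℝ) * a ρ =
      ∑ j, if ∃ n : ℕ, (G.lam j : ℂ) * ρ + G.mu j = -n then a ρ else 0 := by
    intro ρ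
    rw [← Finset.sum_filter, Finset.sum_const, nsmul_eq_mul, poleCount]
  simp only [h1]
  rw [Finset.sum_comm]
  refine Finset.sum_le_sum fun j _ => ?_
  rw [← Finset.sum_filter]
  -- For fixed `j` a pole is determined by its index, so the poles in `T` inject into the natural
  -- numbers and the sum is dominated by the full series.
  have h2 : ∀ ρ : ℂ, ∃ n : ℕ, (∃ n : ℕ, (G.lam j : ℂ) * ρ + G.mu j = -n) → ρ = G.pole j n := by
    intro ρ
    by_cases h : ∃ n : ℕ, (G.lam j : ℂ) * ρ + G.mu j = -n
    · obtain ⟨n, hn⟩ := h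
      exact ⟨n, fun _ => (G.eq_pole_iff j n ρ).1 hn⟩
    · exact ⟨0, fun h' => absurd h' h⟩
  choose n hn using h2
  calc _ ≤ ∑ ρ ∈ T.filter (fun ρ => ∃ n : ℕ, (G.lam j : ℂ) * ρ + G.mu j = -n), B j (n ρ) := by
        refine Finset.sum_le_sum fun ρ hρ => ?_
        have h3 := hn ρ (Finset.mem_filter.1 hρ).2
        conv_lhs => rw [h3]
        exact hB j _
    _ = ∑ k ∈ (T.filter (fun ρ => ∃ n : ℕ, (G.lam j : ℂ) * ρ + G.mu j = -n)).image n, B j k := by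
        rw [Finset.sum_image]
        intro ρ hρ ρ' hρ' h
        rw [hn ρ (Finset.mem_filter.1 hρ).2, hn ρ' (Finset.mem_filter.1 hρ').2, h]
    _ ≤ _ := (hBs j).sum_le_tsum _ fun k _ => (ha _).trans (hB j k)

end GammaFactor

/-- The explicit formula in terms of the zeros of the completed function, up to the contribution
of the trivial zeros. -/
theorem LogDerivData.norm_explicit_sub_le (h : LogDerivData E m l)
    (hEL : ∀ s, s ≠ 1 → E s = (s - 1) ^ m * L s) (hm : m = 0 ∨ E 1 ≠ 0) {g : ℝ → ℂ}
    (hg : IsTest g) (hg1 : tsupport g ⊆ Ioi 1) {B : Fin G.r → ℕ → ℝ} (hB0 : ∀ j n, 0 ≤ B j n)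
    (hB : ∀ j n, E (G.pole j n) = 0 → ‖mellin g (G.pole j n)‖ ≤ B j n)
    (hBs : ∀ j, Summable (B j)) :
    ‖(m * mellin g 1 - zeroSum (completed G L) g) - ∑' n : ℕ, l n * g n‖ ≤ ∑ j, ∑' n, B j n := by
  classical
  have hE2 : E 2 ≠ 0 := h.ne_zero 2 (by simp)
  have hmult := fun ρ => zeroMult_completed (G := G) h.order.1 hE2 hEL hm ρ
  have hsum := h.summable_mellin hg hg1
  have hsum' : Summable (zeroTerm (completed G L) g) := by
    refine Summable.of_norm_bounded hsum.norm fun ρ => ?_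
    rw [zeroTerm, norm_mul, norm_mul, hmult, Complex.norm_natCast, Complex.norm_natCast]
    have : ((analyticOrderNatAt E ρ - G.poleCount ρ : ℕ) : ℝ) ≤ analyticOrderNatAt E ρ := by
      exact_mod_cast Nat.sub_le _ _
    gcongr
  rw [h.explicit_formula hg hg1, zeroSum]
  have e : ((m : ℂ) * mellin g 1 - ∑' ρ, zeroTerm (completed G L) g ρ)
      - (m * mellin g 1 - ∑' ρ : ℂ, (analyticOrderNatAt E ρ : ℂ) * mellin g ρ)
      = ∑' ρ : ℂ, ((analyticOrderNatAt E ρ : ℂ) * mellin g ρ - zeroTerm (completed G L) g ρ) := by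
    rw [hsum.tsum_sub hsum']
    ring
  rw [e]
  -- A Gamma pole where `E` does not vanish has multiplicity zero for both counts, so only common
  -- points of poles and zeros enter.
  set a : ℂ → ℝ := fun ρ => if E ρ = 0 then ‖mellin g ρ‖ else 0 with ha
  have hterm : ∀ ρ : ℂ, ‖(analyticOrderNatAt E ρ : ℂ) * mellin g ρ - zeroTerm (completed G L) g ρ‖
      ≤ (G.poleCount ρ : ℝ) * a ρ := by
    intro ρ
    rw [zeroTerm, hmult, ← sub_mul, norm_mul]
    by_cases hρ : E ρ = 0
    · simp only [ha, hρ, if_true]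
      refine mul_le_mul_of_nonneg_right ?_ (norm_nonneg _)
      -- The defect between the two multiplicities is the smaller of the order and the pole count.
      have h1 : analyticOrderNatAt E ρ - (analyticOrderNatAt E ρ - G.poleCount ρ) ≤
          G.poleCount ρ := by omega
      have h2 : (analyticOrderNatAt E ρ : ℂ) - ((analyticOrderNatAt E ρ - G.poleCount ρ : ℕ) : ℂ)
          = ((analyticOrderNatAt E ρ - (analyticOrderNatAt E ρ - G.poleCount ρ) : ℕ) : ℂ) := by
        rw [Nat.cast_sub (Nat.sub_le _ _)]
      rw [h2, Complex.norm_natCast]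
      exact_mod_cast h1
    · simp [ha, hρ, analyticOrderNatAt_eq_zero_of_ne hρ]
  have ha0 : ∀ s, 0 ≤ a s := fun s => by
    simp only [ha]; split_ifs <;> positivity
  have haB : ∀ j n, a (G.pole j n) ≤ B j n := by
    intro j n
    simp only [ha]
    split_ifs with h0
    · exact hB j n h0
    · exact hB0 j n
  refine (norm_tsum_le_tsum_norm (hsum.sub hsum').norm).trans ?_
  refine Real.tsum_le_of_sum_le (fun _ => norm_nonneg _) fun T => ?_
  exact (Finset.sum_le_sum fun ρ _ => hterm ρ).trans (G.sum_poleCount_mul_le ha0 haB hBs T)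

lemma LogDerivData.of_logDeriv (hE : IsEntireFiniteOrder E)
    (hEL : ∀ s, s ≠ 1 → E s = (s - 1) ^ m * L s) (hd : ∀ s : ℂ, 1 < s.re → DifferentiableAt ℂ L s)
    (hne : ∀ s : ℂ, 1 < s.re → L s ≠ 0) (hs : ∀ s : ℂ, 1 < s.re → LSeriesSummable l s)
    (hl : ∀ s : ℂ, 1 < s.re → logDeriv L s = -LSeries l s) : LogDerivData E m l := by
  have h1 : ∀ s : ℂ, 1 < s.re → s ≠ 1 := fun s hs h => by simp [h] at hs
  refine ⟨hE, fun s hs => ?_, hs, fun s hs => ?_⟩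
  · rw [hEL s (h1 s hs)]
    exact mul_ne_zero (pow_ne_zero _ (sub_ne_zero.2 (h1 s hs))) (hne s hs)
  · have h2 : E =ᶠ[𝓝 s] fun z => (z - 1) ^ m * L z := by
      filter_upwards [isOpen_ne.mem_nhds (h1 s hs)] with z hz using hEL z hz
    have hp : (fun z : ℂ => (z - 1) ^ m) s ≠ 0 := pow_ne_zero _ (sub_ne_zero.2 (h1 s hs))
    have hdp : DifferentiableAt ℂ (fun z : ℂ => (z - 1) ^ m) s := by fun_prop
    rw [logDeriv_apply, h2.deriv_eq, h2.self_of_nhds, ← logDeriv_apply (fun z => (z - 1) ^ m * L z),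
      logDeriv_mul s hp (hne s hs) hdp (hd s hs),
      logDeriv_fun_pow (by fun_prop), hl s hs]
    have h3 : HasDerivAt (fun z : ℂ => z - 1) 1 s := (hasDerivAt_id s).sub_const 1
    rw [logDeriv_apply, h3.deriv]
    ring

end Completed

end ZeroRelation

end

noncomputable section

namespace ZeroRelation

open MeasureTheory

/-! ### Dilated test functions -/

lemma IsTest.tsupport_scale (h : ℝ → ℂ) {x : ℝ} (hx : 0 < x) :
    tsupport (fun u => h (x * u)) = (fun u => x * u) ⁻¹' tsupport h :=
  tsupport_comp_eq_preimage h (Homeomorph.mulLeft₀ x hx.ne')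

lemma IsTest.scale {h : ℝ → ℂ} (hh : IsTest h) {x : ℝ} (hx : 0 < x) :
    IsTest fun u => h (x * u) := by
  refine ⟨hh.smooth.comp (contDiff_const.mul contDiff_id),
    hh.compact.comp_homeomorph (Homeomorph.mulLeft₀ x hx.ne'), ?_⟩
  rw [IsTest.tsupport_scale h hx]
  intro u hu
  have h1 : 0 < x * u := hh.supp hu
  exact (mul_pos_iff_of_pos_left hx).1 h1

lemma IsTest.tsupport_scale_subset {h : ℝ → ℂ} {a b : ℝ} (hab : tsupport h ⊆ Icc a b) {x : ℝ}
    (hx : 0 < x) : tsupport (fun u => h (x * u)) ⊆ Icc (a / x) (b / x) := by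
  rw [IsTest.tsupport_scale h hx]
  intro u hu
  have h1 := hab hu
  exact ⟨by rw [div_le_iff₀ hx]; linarith [h1.1], by rw [le_div_iff₀ hx]; linarith [h1.2]⟩

/-- Mellin transforms of dilated test functions far to the left. -/
lemma IsTest.norm_mellin_scale_le {h : ℝ → ℂ} (hh : IsTest h) {a b : ℝ}
    (hab : tsupport h ⊆ Icc a b) {x : ℝ} (hx : 0 < x) (hxa : 2 * x ≤ a) {w : ℝ → ℂ} {C k : ℝ}
    (hC : 0 ≤ C) (hw : ∀ u : ℝ, 0 < u → ‖w u‖ ≤ C * u ^ k) {s : ℂ} (hs : s.re + k ≤ 0) :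
    ‖mellin (fun u => h (x * u) * w u) s‖ ≤
      C * 2 ^ (s.re + k) * ∫ u in Ioi (0 : ℝ), u ^ ((0 : ℝ) - 1) * ‖h u‖ := by
  -- The measure `du / u` is invariant under dilation, so the bound does not depend on `x`.
  have h1 : ∫ u in Ioi (0 : ℝ), u ^ ((0 : ℝ) - 1) * ‖h (x * u)‖ =
      ∫ u in Ioi (0 : ℝ), u ^ ((0 : ℝ) - 1) * ‖h u‖ := by
    have h2 := integral_comp_mul_left_Ioi (fun v : ℝ => v ^ ((0 : ℝ) - 1) * ‖h v‖) 0 hx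
    rw [mul_zero, smul_eq_mul, eq_inv_mul_iff_mul_eq₀ hx.ne', ← integral_const_mul] at h2
    rw [← h2]
    refine setIntegral_congr_fun measurableSet_Ioi fun u hu => ?_
    have hu0 : (0 : ℝ) < u := hu
    simp only [zero_sub, Real.rpow_neg_one, mul_inv]
    field_simp
  rw [← h1, ← integral_const_mul]
  refine (norm_mellin_le _ s).trans (integral_mono_of_nonneg ?_ ?_ ?_)
  · filter_upwards [ae_restrict_mem measurableSet_Ioi] with u hu
    have hu0 : (0 : ℝ) < u := hu
    positivity
  · exact ((hh.scale hx).integrableOn_rpow_mul_norm 0).const_mul _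
  · filter_upwards [ae_restrict_mem measurableSet_Ioi] with u hu
    have hu0 : (0 : ℝ) < u := hu
    by_cases h0 : h (x * u) = 0
    · simp [h0]
    · have hau : a ≤ x * u := (hab (subset_tsupport _ h0)).1
      have hu2 : 2 ≤ u := by
        by_contra hlt
        have : x * u < x * 2 := mul_lt_mul_of_pos_left (not_le.1 hlt) hx
        linarith
      calc u ^ (s.re - 1) * ‖h (x * u) * w u‖
          ≤ u ^ (s.re - 1) * (‖h (x * u)‖ * (C * u ^ k)) := by
            rw [norm_mul]; gcongr; exact hw u hu0
        _ = C * u ^ (s.re + k) * (u ^ ((0 : ℝ) - 1) * ‖h (x * u)‖) := by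
            have : u ^ (s.re - 1) * u ^ k = u ^ (s.re + k) * u ^ ((0 : ℝ) - 1) := by
              rw [← Real.rpow_add hu0, ← Real.rpow_add hu0]; ring_nf
            linear_combination (‖h (x * u)‖ * C) * this
        _ ≤ _ := by
            have : u ^ (s.re + k) ≤ 2 ^ (s.re + k) :=
              Real.rpow_le_rpow_of_nonpos two_pos hu2 hs
            gcongr

lemma mellin_one_eq (g : ℝ → ℂ) : mellin g 1 = ∫ u in Ioi (0 : ℝ), g u := by
  simp [mellin]

/-! ### The logarithmic derivative of an element of the Selberg class -/

/-- For `‖s‖ ≥ 2` the divisor satisfies `‖s - 1‖ ≥ 1`, so cancelling a zero at 1 keeps the growth.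
This makes minimality of the pole order usable. -/
lemma IsEntireFiniteOrder.dslope_one {E : ℂ → ℂ} (hE : IsEntireFiniteOrder E) (h1 : E 1 = 0) :
    IsEntireFiniteOrder (dslope E 1) := by
  obtain ⟨hd, A, hA⟩ := hE
  refine ⟨?_, A, ?_⟩
  · rw [← differentiableOn_univ, Complex.differentiableOn_dslope univ_mem]
    exact hd.differentiableOn
  · refine IsBigO.trans (IsBigO.of_bound 1 ?_) hA
    filter_upwards [eventually_cobounded_le_norm (E := ℂ) 2] with s hs
    have h2 : 1 ≤ ‖s - 1‖ := by
      have := norm_sub_norm_le s 1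
      rw [norm_one] at this
      linarith
    have h3 : s ≠ 1 := by
      rintro rfl
      simp at h2
      linarith
    rw [dslope_of_ne _ h3, slope_def_field, h1, sub_zero, norm_div, one_mul]
    exact div_le_self (norm_nonneg _) h2

/-- The entire function `(s - 1) ^ m_L * L s` with the minimal exponent. -/
lemma exists_minimal_clearing {L : ℂ → ℂ} (hL : ∃ m, ClearsPole L m) :
    ∃ E, IsEntireFiniteOrder E ∧ (∀ s, s ≠ 1 → E s = (s - 1) ^ poleOrder L * L s) ∧
      (poleOrder L = 0 ∨ E 1 ≠ 0) := by
  obtain ⟨E, hE, hEL⟩ : ClearsPole L (poleOrder L) := Nat.sInf_mem hL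
  refine ⟨E, hE, hEL, ?_⟩
  by_contra! hcon
  obtain ⟨m, hm⟩ := Nat.exists_eq_succ_of_ne_zero hcon.1
  -- A zero of `E` at 1 could be divided out, contradicting the minimality of `poleOrder L`.
  have h1 : ClearsPole L m := by
    refine ⟨_, hE.dslope_one hcon.2, fun s hs => ?_⟩
    have h2 : s - 1 ≠ 0 := sub_ne_zero.2 hs
    rw [dslope_of_ne _ hs, slope_def_field, hcon.2, sub_zero, hEL s hs, hm, pow_succ]
    field_simp
  have h3 : poleOrder L ≤ m := Nat.sInf_le h1
  omega

section Exp

variable {L : ℂ → ℂ} {b : ℕ → ℂ}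

lemma abscissa_lt_of_summable (hb : ∀ s : ℂ, 1 < s.re → LSeriesSummable b s) {s : ℂ}
    (hs : 1 < s.re) : LSeries.abscissaOfAbsConv b < s.re :=
  lt_of_le_of_lt (LSeries.abscissaOfAbsConv_le_of_forall_lt_LSeriesSummable (x := 1)
    fun y hy => hb y (by simpa using hy)) (by exact_mod_cast hs)

lemma hasDerivAt_of_exp_LSeries (hb : ∀ s : ℂ, 1 < s.re → LSeriesSummable b s)
    (hL : ∀ s : ℂ, 1 < s.re → Complex.exp (LSeries b s) = L s) {s : ℂ} (hs : 1 < s.re) :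
    HasDerivAt L (L s * -LSeries (LSeries.logMul b) s) s := by
  have h1 := (LSeries_hasDerivAt (abscissa_lt_of_summable hb hs)).cexp
  rw [hL s hs] at h1
  refine h1.congr_of_eventuallyEq ?_
  filter_upwards [(isOpen_lt continuous_const Complex.continuous_re).mem_nhds hs] with z hz
  exact (hL z hz).symm

lemma ne_zero_of_exp_LSeries (hL : ∀ s : ℂ, 1 < s.re → Complex.exp (LSeries b s) = L s) {s : ℂ}
    (hs : 1 < s.re) : L s ≠ 0 := hL s hs ▸ Complex.exp_ne_zero _

lemma logDerivData_of_exp_LSeries {E : ℂ → ℂ} {m : ℕ} (hE : IsEntireFiniteOrder E)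
    (hEL : ∀ s, s ≠ 1 → E s = (s - 1) ^ m * L s)
    (hb : ∀ s : ℂ, 1 < s.re → LSeriesSummable b s)
    (hL : ∀ s : ℂ, 1 < s.re → Complex.exp (LSeries b s) = L s) :
    LogDerivData E m (LSeries.logMul b) := by
  refine LogDerivData.of_logDeriv hE hEL
    (fun s hs => (hasDerivAt_of_exp_LSeries hb hL hs).differentiableAt)
    (fun s hs => ne_zero_of_exp_LSeries hL hs)
    (fun s hs => LSeriesSummable_logMul_of_lt_re (abscissa_lt_of_summable hb hs)) fun s hs => ?_
  rw [logDeriv_apply, (hasDerivAt_of_exp_LSeries hb hL hs).deriv,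
    mul_div_cancel_left₀ _ (ne_zero_of_exp_LSeries hL hs)]

end Exp

section Selberg

variable {L : ℂ → ℂ} {a b : ℕ → ℂ} {G : GammaFactor} {h : ℝ → ℂ}

/-- The Euler product excludes zeros to the right of `Re s = 1`, and the functional equation
excludes those to the left of `Re s = 0`. -/
lemma summable_zeroTerm_selberg (hc : ∃ m, ClearsPole L m) (hG : FunctionalEquation G L)
    (hb : ∀ s : ℂ, 1 < s.re → LSeriesSummable b s)
    (hL : ∀ s : ℂ, 1 < s.re → Complex.exp (LSeries b s) = L s) (hh : IsTest h) :
    Summable (zeroTerm (completed G L) h) := by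
  obtain ⟨E, hE, hEL, hm⟩ := exists_minimal_clearing hc
  have hD := logDerivData_of_exp_LSeries hE hEL hb hL
  have hE2 : E 2 ≠ 0 := hD.ne_zero 2 (by simp)
  have hmult := fun ρ => zeroMult_completed (G := G) hE.1 hE2 hEL hm ρ
  refine summable_zeroTerm hE hE2 (fun ρ => by rw [hmult]; exact Nat.sub_le _ _)
    (fun ρ hρ => ⟨?_, ?_⟩) hh
  · by_contra hlt
    exact hρ (zeroMult_completed_eq_zero_of_re_neg hG
      (fun s hs => (hasDerivAt_of_exp_LSeries hb hL hs).differentiableAt)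
      (fun s hs => ne_zero_of_exp_LSeries hL hs) (not_le.1 hlt))
  · refine hD.re_le_one fun h0 => hρ ?_
    rw [hmult, h0, Nat.zero_sub]

/-- The explicit formula for an element of the Selberg class. -/
lemma explicit_formula_selberg (hc : ∃ m, ClearsPole L m)
    (hb : ∀ s : ℂ, 1 < s.re → LSeriesSummable b s)
    (hL : ∀ s : ℂ, 1 < s.re → Complex.exp (LSeries b s) = L s) (hh : IsTest h) (G : GammaFactor) :
    (fun x : ℝ => ((poleOrder L : ℂ) * (∫ u in Ioi (0 : ℝ), h (x * u))
        - zeroSum (completed G L) (fun u => h (x * u)))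
      - ∑' n : ℕ, LSeries.logMul b n * h (x * n)) =O[𝓝[>] (0 : ℝ)] fun _ => (1 : ℝ) := by
  obtain ⟨E, hE, hEL, hm⟩ := exists_minimal_clearing hc
  have hD := logDerivData_of_exp_LSeries hE hEL hb hL
  obtain ⟨A, B, hA, -, hAB⟩ := hh.exists_support_subset_Icc hh.supp
  set I := ∫ u in Ioi (0 : ℝ), u ^ ((0 : ℝ) - 1) * ‖h u‖ with hI
  have hI0 : 0 ≤ I := setIntegral_nonneg measurableSet_Ioi fun u hu => by
    have : (0 : ℝ) < u := hu
    positivity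
  -- The real parts of the poles form arithmetic progressions tending to `-∞`, so these bounds form
  -- a geometric series for each `j`.
  set W : Fin G.r → ℕ → ℝ := fun j n => 1 * 2 ^ ((G.pole j n).re + 0) * I with hW
  have hWs : ∀ j, Summable (W j) := by
    intro j
    have h1 : W j = fun n : ℕ => (2 ^ (-((G.mu j).re / G.lam j)) * I) *
        ((2 : ℝ) ^ (-(G.lam j)⁻¹)) ^ n := by
      funext n
      simp only [hW, G.pole_re]
      rw [← Real.rpow_natCast, ← Real.rpow_mul two_pos.le, one_mul, mul_right_comm,
        ← Real.rpow_add two_pos]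
      congr 2
      ring
    rw [h1]
    refine (summable_geometric_of_lt_one (by positivity) ?_).mul_left _
    exact Real.rpow_lt_one_of_one_lt_of_neg one_lt_two (by have := G.lam_pos j; simpa using this)
  refine IsBigO.of_bound (∑ j, ∑' n, W j n) ?_
  have hev : ∀ᶠ x : ℝ in 𝓝[>] 0, x < A / 2 :=
    nhdsWithin_le_nhds (Iio_mem_nhds (by positivity))
  filter_upwards [hev, self_mem_nhdsWithin] with x hxA hx
  have hx0 : (0 : ℝ) < x := hx
  have hsupp : tsupport (fun u => h (x * u)) ⊆ Ioi 1 := by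
    refine (IsTest.tsupport_scale_subset hAB hx0).trans fun u hu => ?_
    have h2 : 1 < A / x := by rw [lt_div_iff₀ hx0]; linarith
    exact h2.trans_le hu.1
  have key := hD.norm_explicit_sub_le (G := G) hEL hm (hh.scale hx0) hsupp (B := W)
    (fun j n => by positivity) (fun j n _ => ?_) hWs
  · rw [norm_one, mul_one]
    rwa [mellin_one_eq] at key
  · have h3 := hh.norm_mellin_scale_le hAB hx0 (by linarith) (w := fun _ => 1) (C := 1) (k := 0)
      zero_le_one (by simp) (s := G.pole j n) (by
        have h4 := G.lam_pos j
        have h5 := G.mu_re j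
        rw [G.pole_re, add_zero, neg_nonpos]
        positivity)
    simpa only [mul_one] using h3

end Selberg

end ZeroRelation

end

noncomputable section

namespace ZeroRelation

open MeasureTheory

/-! ### The order of the Riemann zeta function -/

/-- `(s - 1) * ∫ t in n + 1..n + 2, ((n + 1) ^ (-s) - t ^ (-s))`. -/
def zetaTerm (n : ℕ) (s : ℂ) : ℂ :=
  (s - 1) * ((n + 1 : ℝ) : ℂ) ^ (-s) + (((n + 2 : ℝ) : ℂ) ^ (1 - s) - ((n + 1 : ℝ) : ℂ) ^ (1 - s))

lemma differentiable_zetaTerm (n : ℕ) : Differentiable ℂ (zetaTerm n) := by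
  have h1 : ((n + 1 : ℝ) : ℂ) ≠ 0 := by exact_mod_cast n.succ_ne_zero
  have h2 : ((n + 2 : ℝ) : ℂ) ≠ 0 := by exact_mod_cast (n + 1).succ_ne_zero
  intro s
  refine ((differentiableAt_id.sub_const 1).mul (differentiableAt_id.neg.const_cpow (.inl h1))).add
    (((differentiableAt_id.const_sub 1).const_cpow (.inl h2)).sub
      ((differentiableAt_id.const_sub 1).const_cpow (.inl h1)))

/-- Two mean value estimates on `[n + 1, n + 2]`: the integrand `(n + 1) ^ (-s) - t ^ (-s)` is
`O(‖s‖ (n + 1) ^ (-Re s - 1))`, and integrating it costs `‖s - 1‖`. Any bound `Re s > σ > 0` would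
make the series converge; `1/4` leaves room beyond the line `Re s = 1/2`. -/
lemma norm_zetaTerm_le (n : ℕ) {s : ℂ} (hs : 1 / 4 < s.re) :
    ‖zetaTerm n s‖ ≤ ‖s‖ * ‖s - 1‖ * (n + 1 : ℝ) ^ (-(5 / 4) : ℝ) := by
  have hn0 : (0 : ℝ) ≤ n := n.cast_nonneg
  set a : ℝ := n + 1 with ha
  have ha1 : 1 ≤ a := by linarith
  have ha2 : (n + 2 : ℝ) = a + 1 := by rw [ha]; ring
  by_cases h1 : s = 1
  · simp [zetaTerm, h1]
  have hs0 : s ≠ 0 := by rintro rfl; norm_num at hs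
  have hder : ∀ r : ℂ, r ≠ 0 → ∀ t : ℝ, t ∈ Icc a (a + 1) →
      HasDerivAt (fun y : ℝ => (y : ℂ) ^ r) (r * (t : ℂ) ^ (r - 1)) t := fun r hr t ht =>
    hasDerivAt_ofReal_cpow_const (by linarith [ht.1]) hr
  have hin : ∀ t ∈ Icc a (a + 1), ‖(t : ℂ) ^ (-s) - (a : ℂ) ^ (-s)‖ ≤
      ‖s‖ * a ^ (-(5 / 4) : ℝ) := by
    intro t ht
    have h2 := Convex.norm_image_sub_le_of_norm_hasDerivWithin_le
      (f := fun y : ℝ => (y : ℂ) ^ (-s)) (f' := fun t : ℝ => -s * (t : ℂ) ^ (-s - 1))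
      (s := Icc a (a + 1)) (x := a) (y := t) (C := ‖s‖ * a ^ (-(5 / 4) : ℝ))
      (fun t ht => (hder (-s) (neg_ne_zero.2 hs0) t ht).hasDerivWithinAt) (fun t ht => ?_)
      (convex_Icc _ _) ⟨le_rfl, by linarith⟩ ht
    · refine h2.trans ?_
      have h3 : ‖t - a‖ ≤ 1 := by
        rw [Real.norm_eq_abs, abs_le]; constructor <;> linarith [ht.1, ht.2]
      exact mul_le_of_le_one_right (by positivity) h3
    · have ht0 : 0 < t := by linarith [ht.1]
      rw [norm_mul, norm_neg, Complex.norm_cpow_eq_rpow_re_of_pos ht0]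
      gcongr
      calc t ^ (-s - 1).re ≤ t ^ (-(5 / 4) : ℝ) :=
            Real.rpow_le_rpow_of_exponent_le (by linarith [ht.1])
              (by simp only [Complex.sub_re, Complex.neg_re, Complex.one_re]; linarith)
        _ ≤ _ := Real.rpow_le_rpow_of_nonpos (by linarith) ht.1 (by norm_num)
  have h4 := Convex.norm_image_sub_le_of_norm_hasDerivWithin_le
      (f := fun y : ℝ => (y : ℂ) ^ (1 - s) - ((1 - s) * (a : ℂ) ^ (-s)) * y)
      (f' := fun t : ℝ => (1 - s) * (t : ℂ) ^ (1 - s - 1) - ((1 - s) * (a : ℂ) ^ (-s)) * 1)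
      (s := Icc a (a + 1)) (x := a) (y := a + 1) (C := ‖s - 1‖ * (‖s‖ * a ^ (-(5 / 4) : ℝ)))
      (fun t ht => ((hder (1 - s) (sub_ne_zero.2 (Ne.symm h1)) t ht).sub
        (Complex.ofRealCLM.hasDerivAt.const_mul _)).hasDerivWithinAt) (fun t ht => ?_)
      (convex_Icc _ _) ⟨le_rfl, by linarith⟩ ⟨by linarith, le_rfl⟩
  · have h5 : zetaTerm n s = (((a + 1 : ℝ) : ℂ) ^ (1 - s) - ((1 - s) * (a : ℂ) ^ (-s)) *
        ((a + 1 : ℝ) : ℂ)) - ((a : ℂ) ^ (1 - s) - ((1 - s) * (a : ℂ) ^ (-s)) * a) := by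
      rw [zetaTerm, ha2, ← ha]
      push_cast
      ring
    rw [h5]
    refine h4.trans (le_of_eq ?_)
    simp
    ring
  · have h6 : (1 - s) * (t : ℂ) ^ (1 - s - 1) - ((1 - s) * (a : ℂ) ^ (-s)) * 1 =
        (1 - s) * ((t : ℂ) ^ (-s) - (a : ℂ) ^ (-s)) := by
      rw [show 1 - s - 1 = -s by ring]; ring
    rw [h6, norm_mul, norm_sub_rev 1 s]
    exact mul_le_mul_of_nonneg_left (hin t ht) (norm_nonneg _)

lemma summable_zeta_majorant : Summable fun n : ℕ => (n + 1 : ℝ) ^ (-(5 / 4) : ℝ) := by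
  have h := (summable_nat_add_iff 1).2 (Real.summable_nat_rpow.2 (by norm_num : -(5 / 4 : ℝ) < -1))
  simpa using h

/-- The differences of `(n + 1) ^ (1 - s)` telescope to `-1`, which the leading 1 compensates. -/
lemma riemannZeta₁_eq_of_one_lt {s : ℂ} (hs : 1 < s.re) :
    riemannZeta₁ s = 1 + ∑' n : ℕ, zetaTerm n s := by
  have h1 : s ≠ 1 := fun h => by simp [h] at hs
  have hz : riemannZeta₁ s = (s - 1) * riemannZeta s := by
    rw [riemannZeta_eq_inv_sub_mul h1, mul_inv_cancel_left₀ (sub_ne_zero.2 h1)]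
  have hsum : Summable fun n : ℕ => ((n + 1 : ℝ) : ℂ) ^ (-s) := by
    have h2 := (summable_nat_add_iff 1).2 (Complex.summable_one_div_nat_cpow.2 hs)
    refine h2.congr fun n => ?_
    rw [Complex.cpow_neg, one_div]
    push_cast
    rfl
  have hzs : riemannZeta s = ∑' n : ℕ, ((n + 1 : ℝ) : ℂ) ^ (-s) := by
    rw [zeta_eq_tsum_one_div_nat_add_one_cpow hs]
    refine tsum_congr fun n => ?_
    rw [Complex.cpow_neg, one_div]
    push_cast
    rfl
  have hterm : Summable fun n : ℕ => zetaTerm n s :=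
    Summable.of_norm_bounded (summable_zeta_majorant.mul_left (‖s‖ * ‖s - 1‖))
      fun n => norm_zetaTerm_le n (by linarith)
  have hlim := hterm.hasSum.tendsto_sum_nat
  have hlim2 := (hsum.hasSum.tendsto_sum_nat.const_mul (s - 1)).add
    ((tendsto_const_nhds (x := (-1 : ℂ))).add
      (?_ : Tendsto (fun n : ℕ => ((n + 1 : ℝ) : ℂ) ^ (1 - s)) atTop (𝓝 0)))
  · have heq : (fun n => ∑ i ∈ Finset.range n, zetaTerm i s) = fun n : ℕ =>
        (s - 1) * ∑ i ∈ Finset.range n, ((i + 1 : ℝ) : ℂ) ^ (-s) +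
          (-1 + ((n + 1 : ℝ) : ℂ) ^ (1 - s)) := by
      funext n
      induction n with
      | zero => simp
      | succ n ih =>
        rw [Finset.sum_range_succ, Finset.sum_range_succ, ih, zetaTerm]
        push_cast
        rw [show (n : ℂ) + 1 + 1 = n + 2 by ring]
        ring
    rw [heq] at hlim
    rw [tendsto_nhds_unique hlim hlim2, hz, hzs]
    ring
  · rw [tendsto_zero_iff_norm_tendsto_zero]
    have h3 : Tendsto (fun n : ℕ => ((n + 1 : ℕ) : ℝ) ^ (-(s.re - 1))) atTop (𝓝 0) :=
      ((tendsto_rpow_neg_atTop (sub_pos.2 hs)).comp tendsto_natCast_atTop_atTop).comp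
        (tendsto_add_atTop_nat 1)
    refine h3.congr fun n => ?_
    rw [Complex.norm_cpow_eq_rpow_re_of_pos (by positivity)]
    simp

/-- Analytic continuation by the identity theorem. The domain is cut to a bounded convex set because
the majorant of the terms depends on `‖s‖`. -/
lemma riemannZeta₁_eq {s : ℂ} (hs : 1 / 4 < s.re) :
    riemannZeta₁ s = 1 + ∑' n : ℕ, zetaTerm n s := by
  set R := ‖s‖ + 4
  set U : Set ℂ := {z | 1 / 4 < z.re} ∩ Metric.ball 0 R with hU
  have hUo : IsOpen U := (isOpen_lt continuous_const Complex.continuous_re).inter Metric.isOpen_ball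
  have hUc : IsPreconnected U :=
    ((convex_halfSpace_re_gt (1 / 4)).inter (convex_ball 0 R)).isPreconnected
  have hd : DifferentiableOn ℂ (fun z => ∑' n : ℕ, zetaTerm n z) U := by
    refine Complex.differentiableOn_tsum_of_summable_norm
      (summable_zeta_majorant.mul_left (R * (R + 1)))
      (fun n => (differentiable_zetaTerm n).differentiableOn) hUo fun n z hz => ?_
    have h1 : ‖z‖ ≤ R := by simpa using (mem_ball_zero_iff.1 hz.2).le
    have h2 : ‖z - 1‖ ≤ R + 1 := (norm_sub_le z 1).trans (by rw [norm_one]; linarith)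
    refine (norm_zetaTerm_le n hz.1).trans ?_
    gcongr
  refine ((differentiable_riemannZeta₁.differentiableOn.analyticOnNhd
    hUo).eqOn_of_preconnected_of_eventuallyEq
      ((hd.const_add 1).analyticOnNhd hUo) hUc (z₀ := 2) ?_ ?_ : EqOn riemannZeta₁ _ U)
    ⟨hs, ?_⟩
  · refine ⟨by norm_num, ?_⟩
    rw [mem_ball_zero_iff, Complex.norm_ofNat]
    have := norm_nonneg s
    simp only [R]; linarith
  · have h2 : (1 : ℝ) < (2 : ℂ).re := by norm_num
    filter_upwards [(isOpen_lt continuous_const Complex.continuous_re).mem_nhds h2] with z hz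
    exact riemannZeta₁_eq_of_one_lt hz
  · rw [mem_ball_zero_iff]
    simp [R]

lemma norm_Gamma_le_Gamma_re {s : ℂ} (hs : 0 < s.re) :
    ‖Complex.Gamma s‖ ≤ Real.Gamma s.re := by
  rw [Complex.Gamma_eq_integral hs, Real.Gamma_eq_integral hs, Complex.GammaIntegral]
  refine (norm_integral_le_integral_norm _).trans (le_of_eq ?_)
  refine setIntegral_congr_fun measurableSet_Ioi fun t ht => ?_
  have ht0 : (0 : ℝ) < t := ht
  simp only [norm_mul, Complex.norm_real, Complex.norm_cpow_eq_rpow_re_of_pos ht0, Real.norm_eq_abs,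
    Real.abs_exp, Complex.sub_re, Complex.one_re]

/-- Shifting by 2 does not decrease the modulus and moves the real part to `[2, ∞)`, where real
Gamma is increasing and bounded by a factorial; then `n! ≤ n ^ n ≤ exp (n ^ 2)`. -/
lemma norm_Gamma_le_exp {s : ℂ} (hs : 0 < s.re) (h1 : 1 ≤ ‖s‖) :
    ‖Complex.Gamma s‖ ≤ Real.exp ((‖s‖ + 3) ^ 2) := by
  have hs0 : s ≠ 0 := fun h => by simp [h] at hs
  have hs1 : s + 1 ≠ 0 := fun h => by
    have := congrArg Complex.re h
    simp at this
    linarith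
  have e : Complex.Gamma (s + 2) = (s + 1) * (s * Complex.Gamma s) := by
    rw [← Complex.Gamma_add_one s hs0, ← Complex.Gamma_add_one (s + 1) hs1]
    ring_nf
  have h2 : 1 ≤ ‖s + 1‖ := by
    refine le_trans ?_ (Complex.re_le_norm _)
    simp only [Complex.add_re, Complex.one_re]
    linarith
  have h3 : ‖Complex.Gamma s‖ ≤ ‖Complex.Gamma (s + 2)‖ := by
    rw [e, norm_mul, norm_mul]
    nlinarith [norm_nonneg (Complex.Gamma s), mul_le_mul h2 h1 zero_le_one (norm_nonneg (s + 1))]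
  set n := ⌈s.re⌉₊ + 1 with hn
  have hre : (s + 2).re = s.re + 2 := by simp
  have h4 : ‖Complex.Gamma (s + 2)‖ ≤ Real.Gamma (n + 1) := by
    refine (norm_Gamma_le_Gamma_re (by rw [hre]; linarith)).trans ?_
    rw [hre]
    have h5 := Nat.le_ceil s.re
    have h6 : s.re + 2 ≤ (n : ℝ) + 1 := by rw [hn]; push_cast; linarith
    exact Real.Gamma_strictMonoOn_Ici.monotoneOn (by simp only [mem_Ici]; linarith)
      (by simp only [mem_Ici]; linarith) h6
  rw [Real.Gamma_nat_eq_factorial] at h4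
  have h7 : (n : ℝ) ≤ ‖s‖ + 2 := by
    have h8 := (Nat.ceil_lt_add_one hs.le).le
    have := Complex.re_le_norm s
    rw [hn]; push_cast; linarith
  calc ‖Complex.Gamma s‖ ≤ (n.factorial : ℝ) := h3.trans h4
    _ ≤ (n : ℝ) ^ n := by exact_mod_cast Nat.factorial_le_pow n
    _ ≤ (Real.exp n) ^ n := by
        gcongr
        linarith [Real.add_one_le_exp (n : ℝ)]
    _ = Real.exp (n * n) := by rw [← Real.exp_nat_mul]
    _ ≤ _ := by
        refine Real.exp_le_exp.2 ?_
        have : (0 : ℝ) ≤ n := n.cast_nonneg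
        nlinarith

lemma norm_cos_le_exp (z : ℂ) : ‖Complex.cos z‖ ≤ Real.exp ‖z‖ := by
  rw [Complex.cos, norm_div, Complex.norm_ofNat, div_le_iff₀ two_pos]
  refine (norm_add_le _ _).trans ?_
  have h1 := Complex.norm_exp_le_exp_norm (z * Complex.I)
  have h2 := Complex.norm_exp_le_exp_norm (-z * Complex.I)
  rw [norm_mul, Complex.norm_I, mul_one] at h1
  rw [norm_mul, Complex.norm_I, mul_one, norm_neg] at h2
  linarith

/-- The series handles `Re s ≥ 1/2`, and the functional equation reflects the rest. Both yield `exp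
(O(‖s‖ ^ 2))`; the exponent 3 is a convenience that swallows the constants. -/
lemma isEntireFiniteOrder_riemannZeta₁ : IsEntireFiniteOrder riemannZeta₁ := by
  refine ⟨differentiable_riemannZeta₁, 3, ?_⟩
  set K := ∑' n : ℕ, (n + 1 : ℝ) ^ (-(5 / 4) : ℝ) with hK
  have hK0 : 0 ≤ K := tsum_nonneg fun n => by positivity
  have hright : ∀ s : ℂ, 1 / 2 ≤ s.re → ‖riemannZeta₁ s‖ ≤ Real.exp (K * (‖s‖ * (‖s‖ + 1))) := by
    intro s hs
    have hs' : 1 / 4 < s.re := by linarith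
    rw [riemannZeta₁_eq hs']
    have h1 : ‖∑' n : ℕ, zetaTerm n s‖ ≤ ‖s‖ * ‖s - 1‖ * K := by
      rw [hK, ← tsum_mul_left]
      exact tsum_of_norm_bounded (summable_zeta_majorant.mul_left _).hasSum
        fun n => norm_zetaTerm_le n hs'
    have h2 : ‖s - 1‖ ≤ ‖s‖ + 1 := (norm_sub_le s 1).trans (by rw [norm_one])
    have h3 : ‖s‖ * ‖s - 1‖ * K ≤ K * (‖s‖ * (‖s‖ + 1)) := by
      rw [mul_comm K]; gcongr
    refine (norm_add_le _ _).trans ?_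
    rw [norm_one]
    linarith [Real.add_one_le_exp (K * (‖s‖ * (‖s‖ + 1)))]
  refine IsBigO.of_bound 1 ?_
  -- The threshold is chosen so that `(24 + 8K) r ^ 2 ≤ r ^ 3`, which collects all the exponents
  -- below.
  filter_upwards [eventually_cobounded_le_norm (E := ℂ) (24 + 8 * K)] with w hw
  set r := ‖w‖ with hr
  have hr24 : 24 ≤ r := by linarith
  rw [one_mul, Real.norm_eq_abs, Real.abs_exp, show (3 : ℝ) = ((3 : ℕ) : ℝ) by norm_num,
    Real.rpow_natCast]
  rcases le_or_gt (1 / 2) w.re with hre | hre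
  · refine (hright w hre).trans (Real.exp_le_exp.2 ?_)
    rw [← hr]
    have : K * (r * (r + 1)) ≤ 8 * K * r ^ 2 := by
      have : r * (r + 1) ≤ 8 * r ^ 2 := by nlinarith
      nlinarith
    nlinarith [sq_nonneg r]
  · set s := 1 - w with hs
    have hws : w = 1 - s := by rw [hs]; ring
    have hsre : 1 / 2 < s.re := by rw [hs]; simp; linarith
    have hsn : ‖s‖ ≤ r + 1 := by
      have := norm_sub_le 1 w
      rw [norm_one] at this
      linarith
    have hsn' : r - 1 ≤ ‖s‖ := by
      have := norm_sub_norm_le w 1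
      rw [norm_one, norm_sub_rev] at this
      linarith
    have hs1 : s ≠ 1 := by rintro h; rw [h, norm_one] at hsn'; linarith
    have hw1 : w ≠ 1 := by rintro h; rw [h] at hre; norm_num at hre
    have hs2 : ∀ n : ℕ, s ≠ -n := by
      intro n h
      have := congrArg Complex.re h
      simp only [Complex.neg_re, Complex.natCast_re] at this
      have h0 : (0 : ℝ) ≤ n := n.cast_nonneg
      linarith
    have e : riemannZeta₁ w = -s * (2 * (2 * (Real.pi : ℂ)) ^ (-s) * Complex.Gamma s *
        Complex.cos (Real.pi * s / 2) * ((s - 1)⁻¹ * riemannZeta₁ s)) := by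
      rw [← riemannZeta_eq_inv_sub_mul hs1, ← riemannZeta_one_sub hs2 hs1, ← hws,
        riemannZeta_eq_inv_sub_mul hw1, show -s = w - 1 by rw [hs]; ring,
        mul_inv_cancel_left₀ (sub_ne_zero.2 hw1)]
    have b1 : ‖(2 * (Real.pi : ℂ)) ^ (-s)‖ ≤ 1 := by
      have : (2 * (Real.pi : ℂ)) = ((2 * Real.pi : ℝ) : ℂ) := by push_cast; rfl
      rw [this, Complex.norm_cpow_eq_rpow_re_of_pos (by positivity)]
      refine Real.rpow_le_one_of_one_le_of_nonpos ?_ (by simp; linarith)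
      linarith [Real.pi_gt_three]
    have b2 := norm_Gamma_le_exp (s := s) (by linarith) (by linarith)
    have b3 : ‖Complex.cos (Real.pi * s / 2)‖ ≤ Real.exp (2 * ‖s‖) := by
      refine (norm_cos_le_exp _).trans (Real.exp_le_exp.2 ?_)
      rw [norm_div, norm_mul, Complex.norm_real, Real.norm_eq_abs, abs_of_pos Real.pi_pos,
        Complex.norm_ofNat]
      nlinarith [Real.pi_le_four, norm_nonneg s]
    have b4 : ‖(s - 1)⁻¹‖ ≤ 1 := by
      rw [norm_inv]
      refine inv_le_one_of_one_le₀ ?_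
      have := norm_sub_norm_le s 1
      rw [norm_one] at this
      linarith
    have b5 := hright s hsre.le
    have b6 : ‖s‖ * 2 ≤ Real.exp (2 * ‖s‖) := by linarith [Real.add_one_le_exp (2 * ‖s‖)]
    rw [e]
    simp only [norm_mul, norm_neg, Complex.norm_ofNat]
    calc ‖s‖ * (2 * ‖(2 * (Real.pi : ℂ)) ^ (-s)‖ * ‖Complex.Gamma s‖ *
          ‖Complex.cos (Real.pi * s / 2)‖ * (‖(s - 1)⁻¹‖ * ‖riemannZeta₁ s‖))
        ≤ ‖s‖ * (2 * 1 * Real.exp ((‖s‖ + 3) ^ 2) * Real.exp (2 * ‖s‖) *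
          (1 * Real.exp (K * (‖s‖ * (‖s‖ + 1))))) := by gcongr
      _ = (‖s‖ * 2) * (Real.exp ((‖s‖ + 3) ^ 2) * Real.exp (2 * ‖s‖) *
          Real.exp (K * (‖s‖ * (‖s‖ + 1)))) := by ring
      _ ≤ Real.exp (2 * ‖s‖) * (Real.exp ((‖s‖ + 3) ^ 2) * Real.exp (2 * ‖s‖) *
          Real.exp (K * (‖s‖ * (‖s‖ + 1)))) := by gcongr
      _ = Real.exp (2 * ‖s‖ + ((‖s‖ + 3) ^ 2 + 2 * ‖s‖ + K * (‖s‖ * (‖s‖ + 1)))) := by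
          rw [Real.exp_add, Real.exp_add, Real.exp_add]
      _ ≤ _ := by
          refine Real.exp_le_exp.2 ?_
          have c1 : (‖s‖ + 3) ^ 2 ≤ 4 * r ^ 2 := by
            have : ‖s‖ + 3 ≤ 2 * r := by linarith
            nlinarith [norm_nonneg s]
          have c2 : 4 * ‖s‖ ≤ 8 * r ^ 2 := by nlinarith
          have c3 : ‖s‖ * (‖s‖ + 1) ≤ 8 * r ^ 2 := by
            have h1 : ‖s‖ ≤ 2 * r := by linarith
            have h2 : ‖s‖ + 1 ≤ 2 * r := by linarith
            nlinarith [mul_le_mul h1 h2 (by positivity) (by positivity)]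
          have c4 : K * (‖s‖ * (‖s‖ + 1)) ≤ K * (8 * r ^ 2) := mul_le_mul_of_nonneg_left c3 hK0
          have c5 : (24 + 8 * K) * r ^ 2 ≤ r ^ 3 := by
            rw [pow_succ r 2, mul_comm]; gcongr
          nlinarith [sq_nonneg r]

end ZeroRelation

end

noncomputable section

namespace ZeroRelation

open MeasureTheory

/-! ### The explicit formula for the Riemann zeta function -/

/-- The Gamma factor of the Riemann zeta function. -/
def zetaFactor : GammaFactor where
  Q := Real.pi ^ (-(1 / 2) : ℝ)
  r := 1
  lam _ := 1 / 2
  mu _ := 0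
  Q_pos := by positivity
  one_le_r := le_rfl
  lam_pos _ := by norm_num
  mu_re _ := by simp

lemma zetaFactor_eval (s : ℂ) : zetaFactor.eval s = s.Gammaℝ := by
  have hπ : (Real.pi : ℂ) ≠ 0 := by exact_mod_cast Real.pi_ne_zero
  have hQ : (zetaFactor.Q : ℂ) ≠ 0 := by exact_mod_cast zetaFactor.Q_pos.ne'
  have h1 : (zetaFactor.Q : ℂ) ^ s = (Real.pi : ℂ) ^ (-s / 2) := by
    rw [Complex.cpow_def_of_ne_zero hQ, Complex.cpow_def_of_ne_zero hπ,
      ← Complex.ofReal_log zetaFactor.Q_pos.le, ← Complex.ofReal_log Real.pi_pos.le]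
    simp only [zetaFactor, Real.log_rpow Real.pi_pos]
    push_cast
    ring_nf
  rw [GammaFactor.eval, h1, Complex.Gammaℝ_def]
  refine congrArg _ ((Fin.prod_univ_one _).trans ?_)
  simp only [zetaFactor, add_zero]
  congr 1
  push_cast
  ring

/-- The two functions agree off the poles of the Gamma factor; these are isolated, so the orders
coincide everywhere. -/
lemma zeroMult_completedRiemannZeta (ρ : ℂ) :
    zeroMult completedRiemannZeta ρ = zeroMult (completed zetaFactor riemannZeta) ρ := by
  have h : completedRiemannZeta =ᶠ[𝓝[≠] ρ] completed zetaFactor riemannZeta := by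
    filter_upwards [zetaFactor.eventually_regular ρ] with s hs
    have h1 := (zetaFactor.regular_iff s).1 hs
    have h0 : s ≠ 0 := by
      rintro rfl
      rw [zetaFactor_eval] at h1
      exact h1 (Complex.Gammaℝ_eq_zero_iff.2 ⟨0, by simp⟩)
    rw [completed, riemannZeta_def_of_ne_zero h0, ← zetaFactor_eval, mul_div_cancel₀ _ h1]
  rw [zeroMult, zeroMult, meromorphicOrderAt_congr h]

lemma riemannZeta₁_eq_mul {s : ℂ} (hs : s ≠ 1) :
    riemannZeta₁ s = (s - 1) ^ 1 * riemannZeta s := by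
  rw [pow_one, riemannZeta_eq_inv_sub_mul hs, mul_inv_cancel_left₀ (sub_ne_zero.2 hs)]

lemma logDerivData_zeta :
    LogDerivData riemannZeta₁ 1 fun n => (ArithmeticFunction.vonMangoldt n : ℂ) := by
  have h1 : ∀ s : ℂ, 1 < s.re → s ≠ 1 := fun s hs h => by simp [h] at hs
  refine LogDerivData.of_logDeriv (L := riemannZeta) isEntireFiniteOrder_riemannZeta₁
    (fun s hs => riemannZeta₁_eq_mul hs) (fun s hs => differentiableAt_riemannZeta (h1 s hs))
    (fun s hs => riemannZeta_ne_zero_of_one_le_re hs.le)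
    (fun s hs => ArithmeticFunction.LSeriesSummable_vonMangoldt hs) fun s hs => ?_
  rw [ArithmeticFunction.LSeries_vonMangoldt_eq_deriv_riemannZeta_div hs, logDeriv_apply, neg_div,
    neg_neg]

lemma zeroMult_completedRiemannZeta_eq (ρ : ℂ) : zeroMult completedRiemannZeta ρ =
    analyticOrderNatAt riemannZeta₁ ρ - zetaFactor.poleCount ρ := by
  rw [zeroMult_completedRiemannZeta]
  exact zeroMult_completed differentiable_riemannZeta₁ (c := 1) (by simp)
    (fun s hs => riemannZeta₁_eq_mul hs) (.inr (by simp)) ρ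

lemma zeroMult_completedRiemannZeta_eq_zero {ρ : ℂ} (hρ : ρ.re < 0) :
    zeroMult completedRiemannZeta ρ = 0 := by
  have h0 : ρ ≠ 0 := by rintro rfl; simp at hρ
  have h1 : ρ ≠ 1 := by rintro rfl; simp at hρ; linarith
  have h2 : 1 < (1 - ρ).re := by simp only [Complex.sub_re, Complex.one_re]; linarith
  have h3 : 1 - ρ ≠ 0 := sub_ne_zero.2 h1.symm
  refine zeroMult_eq_zero_of_tendsto (c := completedRiemannZeta ρ) ?_
    ((differentiableAt_completedZeta h0 h1).continuousAt.tendsto.mono_left nhdsWithin_le_nhds)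
  rw [← completedRiemannZeta_one_sub]
  intro h4
  apply riemannZeta_ne_zero_of_one_le_re h2.le
  rw [riemannZeta_def_of_ne_zero h3, h4, zero_div]

lemma summable_zeroTerm_zeta {g : ℝ → ℂ} (hg : IsTest g) :
    Summable (zeroTerm completedRiemannZeta g) := by
  refine summable_zeroTerm isEntireFiniteOrder_riemannZeta₁ (c := 1) (by simp)
    (fun ρ => by rw [zeroMult_completedRiemannZeta_eq]; exact Nat.sub_le _ _)
    (fun ρ hρ => ⟨?_, ?_⟩) hg
  · by_contra hlt
    exact hρ (zeroMult_completedRiemannZeta_eq_zero (not_le.1 hlt))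
  · refine logDerivData_zeta.re_le_one fun h0 => hρ ?_
    rw [zeroMult_completedRiemannZeta_eq, h0, Nat.zero_sub]

lemma zetaFactor_pole (j : Fin zetaFactor.r) (n : ℕ) : zetaFactor.pole j n = -(2 * n : ℂ) := by
  simp only [GammaFactor.pole, zetaFactor]
  push_cast
  ring

/-- The explicit formula for the Riemann zeta function with the weight `φ`. -/
lemma explicit_formula_zeta {h φ : ℝ → ℂ} (hh : IsTest h)
    (hφ : ContDiffOn ℝ (⊤ : ℕ∞) φ (Ioi 0)) {C : ℝ} (hC : 0 ≤ C)
    (hφC : ∀ u : ℝ, 0 < u → ‖φ u‖ ≤ C * u ^ 2) :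
    (fun x : ℝ => ((∫ u in Ioi (0 : ℝ), h (x * u) * φ u)
        - zeroSum completedRiemannZeta (fun u => h (x * u) * φ u))
      - ∑' n : ℕ, (ArithmeticFunction.vonMangoldt n : ℂ) * (h (x * n) * φ n))
      =O[𝓝[>] (0 : ℝ)] fun _ => (1 : ℝ) := by
  obtain ⟨A, B, hA, -, hAB⟩ := hh.exists_support_subset_Icc hh.supp
  set I := ∫ u in Ioi (0 : ℝ), u ^ ((0 : ℝ) - 1) * ‖h u‖ with hI
  have hI0 : 0 ≤ I := setIntegral_nonneg measurableSet_Ioi fun u hu => by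
    have : (0 : ℝ) < u := hu
    positivity
  -- The shift by 2 in the exponent is the quadratic growth of `φ`.
  set W : Fin zetaFactor.r → ℕ → ℝ := fun j n => C * 2 ^ ((zetaFactor.pole j n).re + 2) * I with hW
  have hWs : ∀ j, Summable (W j) := by
    intro j
    have h1 : W j = fun n : ℕ => (C * 2 ^ (2 : ℝ) * I) * ((2 : ℝ) ^ (-2 : ℝ)) ^ n := by
      funext n
      have h2 : (zetaFactor.pole j n).re = -(2 * n) := by rw [zetaFactor_pole]; simp
      simp only [hW, h2]
      rw [← Real.rpow_natCast, ← Real.rpow_mul two_pos.le, Real.rpow_add two_pos]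
      ring_nf
    rw [h1]
    refine (summable_geometric_of_lt_one (by positivity) ?_).mul_left _
    exact Real.rpow_lt_one_of_one_lt_of_neg one_lt_two (by norm_num)
  refine IsBigO.of_bound (∑ j, ∑' n, W j n) ?_
  have hev : ∀ᶠ x : ℝ in 𝓝[>] 0, x < A / 2 :=
    nhdsWithin_le_nhds (Iio_mem_nhds (by positivity))
  filter_upwards [hev, self_mem_nhdsWithin] with x hxA hx
  have hx0 : (0 : ℝ) < x := hx
  have hsupp : tsupport (fun u => h (x * u)) ⊆ Ioi 1 := by
    refine (IsTest.tsupport_scale_subset hAB hx0).trans fun u hu => ?_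
    have h2 : 1 < A / x := by rw [lt_div_iff₀ hx0]; linarith
    exact h2.trans_le hu.1
  have hg : IsTest fun u => h (x * u) * φ u :=
    (hh.scale hx0).mul isOpen_Ioi (hh.scale hx0).supp hφ
  have key := logDerivData_zeta.norm_explicit_sub_le (G := zetaFactor) (L := riemannZeta)
    (fun s hs => riemannZeta₁_eq_mul hs) (.inr (by simp)) hg
    ((tsupport_mul_subset_left).trans hsupp) (B := W)
    (fun j n => by positivity) (fun j n hE => ?_) hWs
  · have hz : zeroSum (completed zetaFactor riemannZeta) (fun u => h (x * u) * φ u) =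
        zeroSum completedRiemannZeta (fun u => h (x * u) * φ u) := by
      simp only [zeroSum, zeroTerm, zeroMult_completedRiemannZeta]
    rw [hz, Nat.cast_one, one_mul, mellin_one_eq] at key
    rwa [norm_one, mul_one]
  -- The Gamma pole at 0 is not a zero of `riemannZeta₁`, since `ζ(0) = -1/2`. This matters because
  -- the bound needs `Re s + 2 ≤ 0`, which holds from the first trivial zero `-2` on but fails at 0.
  · have hn : n ≠ 0 := by
      rintro rfl
      rw [zetaFactor_pole, Nat.cast_zero, mul_zero, neg_zero, riemannZeta₁_eq_mul zero_ne_one,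
        riemannZeta_zero] at hE
      norm_num at hE
    have hn1 : (1 : ℝ) ≤ n := by exact_mod_cast Nat.one_le_iff_ne_zero.2 hn
    refine hh.norm_mellin_scale_le hAB hx0 (by linarith) hC (k := 2)
      (fun u hu => by simpa using hφC u hu) (s := zetaFactor.pole j n) ?_
    rw [zetaFactor_pole, Complex.neg_re, show (2 * n : ℂ) = ((2 * n : ℝ) : ℂ) by push_cast; rfl,
      Complex.ofReal_re]
    linarith

end ZeroRelation

end

noncomputable section

namespace ZeroRelation

/-! ### Power series of Euler factors -/

open FormalMultilinearSeries in
/-- A power series which is bounded at some point and vanishes on points accumulating at `0` is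
zero. -/
lemma eq_zero_of_frequently_tsum_eq_zero {e : ℕ → ℂ} {r K : ℝ} (hr : 0 < r)
    (he : ∀ n, ‖e n‖ * r ^ n ≤ K) (h0 : ∃ᶠ z : ℂ in 𝓝[≠] 0, ∑' n, e n * z ^ n = 0) : e = 0 := by
  set P : FormalMultilinearSeries ℂ ℂ ℂ := ofScalars ℂ e with hP
  have hrad : 0 < P.radius := by
    refine lt_of_lt_of_le ?_ (P.le_radius_of_bound (r := ⟨r, hr.le⟩) K fun n => ?_)
    · exact ENNReal.coe_pos.2 (show (0 : NNReal) < ⟨r, hr.le⟩ from hr)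
    · rw [hP, ofScalars_norm]
      exact he n
  have hfp := (P.hasFPowerSeriesOnBall hrad).hasFPowerSeriesAt
  have hsum : ∀ z, P.sum z = ∑' n, e n * z ^ n := fun z => by
    rw [FormalMultilinearSeries.sum, hP, ofScalars_apply_eq']
    simp [smul_eq_mul]
  have h1 : P.sum =ᶠ[𝓝 0] 0 := by
    refine (hfp.analyticAt.frequently_zero_iff_eventually_zero).1 ?_
    simpa only [hsum] using h0
  have h2 : P = 0 := (hfp.congr h1).eq_zero
  exact (ofScalars_series_eq_zero ℂ).1 h2

/-- The coefficients of the polynomial `1 - c 1 X - ⋯ - c N X ^ N`. -/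
def eulerCoeff (N : ℕ) (c : ℕ → ℂ) (j : ℕ) : ℂ :=
  if j = 0 then 1 else if j ≤ N then -c j else 0

lemma eulerCoeff_of_gt {N : ℕ} (c : ℕ → ℂ) {j : ℕ} (hj : N < j) : eulerCoeff N c j = 0 := by
  rw [eulerCoeff, if_neg (by omega), if_neg (by omega)]

lemma hasSum_eulerCoeff (N : ℕ) (c : ℕ → ℕ → ℂ) (p : ℕ) (X : ℂ) :
    HasSum (fun j => eulerCoeff N (c p) j * X ^ j) (eulerPoly N c p X) := by
  have h1 : ∑ j ∈ Finset.range (N + 1), eulerCoeff N (c p) j * X ^ j = eulerPoly N c p X := by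
    rw [Finset.sum_range_succ', eulerPoly, ← Finset.Ico_add_one_right_eq_Icc,
      Finset.sum_Ico_eq_sum_range, add_comm, sub_eq_add_neg, ← Finset.sum_neg_distrib]
    congr 1
    · simp [eulerCoeff]
    · refine Finset.sum_congr (by simp) fun j hj => ?_
      have hj' := Finset.mem_range.1 hj
      rw [eulerCoeff, if_neg (by omega), if_pos (by omega), add_comm 1 j]
      ring
  rw [← h1]
  refine hasSum_sum_of_ne_finset_zero fun j hj => ?_
  rw [eulerCoeff_of_gt _ (by simpa using hj), zero_mul]

/-- The Euler factor identity between functions of `s` becomes an identity of formal power series: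
the points `p ^ (-s)` accumulate at 0, where both sides are analytic. -/
lemma mk_mul_eulerCoeff {a : ℕ → ℂ} {N : ℕ} {c : ℕ → ℕ → ℂ} (hc : HasRankEulerProduct a N c)
    {K : ℝ} (ha : ∀ n : ℕ, n ≠ 0 → ‖a n‖ ≤ K * n) {p : ℕ} (hp : p.Prime) :
    PowerSeries.mk (fun m => a (p ^ m)) * PowerSeries.mk (eulerCoeff N (c p)) = 1 := by
  set f : ℕ → ℂ := fun m => a (p ^ m) with hf
  set q := eulerCoeff N (c p) with hq
  have hp0 : (0 : ℝ) < p := by exact_mod_cast hp.pos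
  have hp1 : (1 : ℝ) < p := by exact_mod_cast hp.one_lt
  have hK0 : 0 ≤ K := by
    have := (norm_nonneg _).trans (ha 1 one_ne_zero)
    simpa using this
  have hfb : ∀ m, ‖f m‖ ≤ K * (p : ℝ) ^ m := fun m => by
    have := ha (p ^ m) (pow_ne_zero _ hp.ne_zero)
    push_cast at this
    exact this
  set d : ℕ → ℂ := fun n => ∑ kl ∈ Finset.HasAntidiagonal.antidiagonal n, f kl.1 * q kl.2 with hd
  set e : ℕ → ℂ := fun n => d n - if n = 0 then 1 else 0 with he
  have hfs : ∀ z : ℂ, ‖z‖ < (p : ℝ)⁻¹ → Summable fun n => ‖f n * z ^ n‖ := by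
    intro z hz
    have hr : p * ‖z‖ < 1 := by
      rwa [← lt_div_iff₀' hp0, one_div]
    refine Summable.of_nonneg_of_le (fun _ => norm_nonneg _) (fun n => ?_)
      ((summable_geometric_of_lt_one (by positivity) hr).mul_left K)
    rw [norm_mul, norm_pow, mul_pow, ← mul_assoc]
    exact mul_le_mul_of_nonneg_right (hfb n) (by positivity)
  have hqs : ∀ z : ℂ, Summable fun n => ‖q n * z ^ n‖ := fun z =>
    summable_of_ne_finset_zero (s := Finset.range (N + 1)) fun j hj => by
      rw [hq, eulerCoeff_of_gt _ (by simpa using hj), zero_mul, norm_zero]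
  have hds : ∀ z : ℂ, ‖z‖ < (p : ℝ)⁻¹ →
      ∑' n, e n * z ^ n = (∑' n, f n * z ^ n) * eulerPoly N c p z - 1 ∧
        Summable fun n => e n * z ^ n := by
    intro z hz
    have h1 := (summable_norm_sum_mul_antidiagonal_of_summable_norm (hfs z hz) (hqs z)).of_norm
    have h2 := tsum_mul_tsum_eq_tsum_sum_antidiagonal_of_summable_norm (hfs z hz) (hqs z)
    have h3 : (fun n => ∑ kl ∈ Finset.HasAntidiagonal.antidiagonal n, f kl.1 * z ^ kl.1 * (q kl.2 * z ^ kl.2)) =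
        fun n => d n * z ^ n := by
      funext n
      rw [hd, Finset.sum_mul]
      refine Finset.sum_congr rfl fun kl hkl => ?_
      rw [← Finset.HasAntidiagonal.mem_antidiagonal.1 hkl, pow_add]
      ring
    have h4 : HasSum (fun n : ℕ => (if n = 0 then (1 : ℂ) else 0) * z ^ n) 1 := by
      have h5 := hasSum_ite_eq (0 : ℕ) (1 : ℂ)
      have h6 : (fun n : ℕ => (if n = 0 then (1 : ℂ) else 0) * z ^ n) =
          fun n => if n = 0 then 1 else 0 := by
        funext n
        split_ifs with h
        · simp [h]
        · simp
      rwa [h6]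
    rw [h3] at h1 h2
    rw [(hasSum_eulerCoeff N c p z).tsum_eq] at h2
    have h7 := h1.hasSum.sub h4
    rw [← h2] at h7
    have h8 : (fun n => e n * z ^ n) =
        fun n => d n * z ^ n - (if n = 0 then (1 : ℂ) else 0) * z ^ n := by
      funext n
      rw [he, sub_mul]
    rw [← h8] at h7
    exact ⟨h7.tsum_eq, h7.summable⟩
  have he0 : e = 0 := by
    refine eq_zero_of_frequently_tsum_eq_zero (r := (2 * p : ℝ)⁻¹) (by positivity)
      (K := ∑' n, ‖e n * (((2 * p : ℝ)⁻¹ : ℝ) : ℂ) ^ n‖) ?_ ?_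
    · intro n
      have hz : ‖(((2 * p : ℝ)⁻¹ : ℝ) : ℂ)‖ = (2 * p : ℝ)⁻¹ := by
        rw [Complex.norm_real, Real.norm_eq_abs, abs_of_pos (by positivity)]
      have h1 := (hds (((2 * p : ℝ)⁻¹ : ℝ) : ℂ) (by
        rw [hz]; exact inv_strictAnti₀ hp0 (by linarith))).2.norm
      have h2 := h1.le_tsum n fun _ _ => norm_nonneg _
      rwa [norm_mul, norm_pow, hz] at h2
    · have hpc : (p : ℂ) ≠ 0 := by exact_mod_cast hp.ne_zero
      -- These are the values `p ^ (-s)` at the integers `s = k + 2`. Starting at 2 keeps them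
      -- strictly inside the disc of radius `1 / p`, where the bound `‖a n‖ ≤ K n` gives
      -- convergence.
      set z : ℕ → ℂ := fun k => ((p : ℂ)⁻¹) ^ (k + 2) with hz
      have hpn : ‖(p : ℂ)⁻¹‖ = (p : ℝ)⁻¹ := by rw [norm_inv, Complex.norm_natCast]
      have hpi : (p : ℝ)⁻¹ < 1 := inv_lt_one_of_one_lt₀ hp1
      have hz0 : Tendsto z atTop (𝓝 0) :=
        (tendsto_pow_atTop_nhds_zero_of_norm_lt_one (by rwa [hpn])).comp (tendsto_add_atTop_nat 2)
      have hz1 : Tendsto z atTop (𝓝[≠] 0) :=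
        tendsto_nhdsWithin_iff.2 ⟨hz0, Eventually.of_forall fun k =>
          pow_ne_zero _ (inv_ne_zero hpc)⟩
      have hcont : Continuous (eulerPoly N c p) := by
        unfold eulerPoly
        fun_prop
      have hP : ∀ᶠ k in atTop, eulerPoly N c p (z k) ≠ 0 := by
        have h3 : ∑ j ∈ Finset.Icc 1 N, c p j * (0 : ℂ) ^ j = 0 := Finset.sum_eq_zero fun j hj => by
          rw [zero_pow (by have := (Finset.mem_Icc.1 hj).1; omega), mul_zero]
        have h6 : eulerPoly N c p 0 ≠ 0 := by
          rw [eulerPoly, h3, sub_zero]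
          exact one_ne_zero
        exact (hcont.continuousAt.tendsto.comp hz0).eventually_ne h6
      refine hz1.frequently (hP.mono fun k hk => ?_).frequently
      have hzk : ‖z k‖ < (p : ℝ)⁻¹ := by
        rw [hz, norm_pow, hpn]
        exact pow_lt_self_of_lt_one₀ (by positivity) hpi (by omega)
      have h4 := hc.1 p hp ((k + 2 : ℕ) : ℂ) (by simp; positivity)
      rw [eulerFactor, Complex.cpow_neg, Complex.cpow_natCast, ← inv_pow] at h4
      rw [(hds (z k) hzk).1]
      have h5 : ∑' n, f n * z k ^ n = (eulerPoly N c p (z k))⁻¹ := h4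
      rw [h5, inv_mul_cancel₀ hk, sub_self]
  ext n
  rw [PowerSeries.coeff_mul, PowerSeries.coeff_one]
  simp only [PowerSeries.coeff_mk]
  have := congrFun he0 n
  simpa only [he, hd, Pi.zero_apply, sub_eq_zero] using this

/-- The coefficients of the logarithmic derivative of `F = 1 / Q`. -/
lemma coeff_of_logDeriv {F Q B : PowerSeries ℂ} (hFQ : F * Q = 1)
    (hB : PowerSeries.X * PowerSeries.derivative ℂ F = B * F) :
    B = -(F * (PowerSeries.X * PowerSeries.derivative ℂ Q)) := by
  have h1 := congrArg (PowerSeries.derivative ℂ) hFQ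
  rw [Derivation.leibniz, Derivation.map_one_eq_zero, smul_eq_mul, smul_eq_mul] at h1
  calc B = B * (F * Q) := by rw [hFQ, mul_one]
    _ = PowerSeries.X * (Q * PowerSeries.derivative ℂ F) := by rw [← mul_assoc, ← hB]; ring
    _ = _ := by linear_combination PowerSeries.X * h1

lemma coeff_X_mul_derivative (F : PowerSeries ℂ) (n : ℕ) :
    PowerSeries.coeff n (PowerSeries.X * PowerSeries.derivative ℂ F) =
      n * PowerSeries.coeff n F := by
  cases n with
  | zero => simp
  | succ n =>
    rw [PowerSeries.coeff_succ_X_mul, PowerSeries.coeff_derivative]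
    push_cast
    ring

/-! ### Coefficients at prime powers -/

section LogCoeff

variable {L : ℂ → ℂ} {a b : ℕ → ℂ}

/-- As `x → ∞` the Dirichlet series tend to their coefficients at 1, so `a 1 = exp (b 1) = exp 0`.
-/
lemma apply_one_of_exp_LSeries (ha : ∀ s : ℂ, 1 < s.re → LSeriesSummable a s ∧ L s = LSeries a s)
    (hb : ∀ s : ℂ, 1 < s.re → LSeriesSummable b s)
    (hL : ∀ s : ℂ, 1 < s.re → Complex.exp (LSeries b s) = L s) (hb1 : b 1 = 0) : a 1 = 1 := by
  have h2 : (1 : ℝ) < (2 : ℂ).re := by norm_num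
  have hA := LSeries.tendsto_atTop
    ((abscissa_lt_of_summable (fun s hs => (ha s hs).1) h2).trans_le le_top)
  have hB := LSeries.tendsto_atTop ((abscissa_lt_of_summable hb h2).trans_le le_top)
  rw [hb1] at hB
  have hB' := (Complex.continuous_exp.tendsto 0).comp hB
  rw [Complex.exp_zero] at hB'
  refine tendsto_nhds_unique hA (hB'.congr' ?_)
  filter_upwards [eventually_gt_atTop 1] with x hx
  have hx1 : 1 < (x : ℂ).re := by simpa using hx
  rw [Function.comp_apply, hL _ hx1, (ha _ hx1).2]

/-- Compare coefficients in `L' = L · (log L)'`, using uniqueness of Dirichlet series. -/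
lemma logMul_eq_convolution (ha : ∀ s : ℂ, 1 < s.re → LSeriesSummable a s ∧ L s = LSeries a s)
    (hb : ∀ s : ℂ, 1 < s.re → LSeriesSummable b s)
    (hL : ∀ s : ℂ, 1 < s.re → Complex.exp (LSeries b s) = L s) {n : ℕ} (hn : n ≠ 0) :
    LSeries.logMul a n = LSeries.convolution (LSeries.logMul b) a n := by
  have hA := fun s hs => abscissa_lt_of_summable (b := a) (s := s) (fun s hs => (ha s hs).1) hs
  have hB := fun s hs => abscissa_lt_of_summable (s := s) hb hs
  have hAs := fun s hs => LSeriesSummable_logMul_of_lt_re (hA s hs)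
  have hBs := fun s hs => (LSeriesSummable_logMul_of_lt_re (hB s hs)).convolution (ha s hs).1
  have h2 : (1 : ℝ) < (2 : ℂ).re := by norm_num
  refine LSeries.eq_of_LSeries_eventually_eq
    ((abscissa_lt_of_summable hAs h2).trans_le le_top)
    ((abscissa_lt_of_summable hBs h2).trans_le le_top) ?_ hn
  filter_upwards [eventually_gt_atTop 1] with x hx
  have hx1 : 1 < (x : ℂ).re := by simpa using hx
  rw [LSeries_convolution' (LSeriesSummable_logMul_of_lt_re (hB _ hx1)) (ha _ hx1).1]
  have h3 : HasDerivAt L (-LSeries (LSeries.logMul a) x) x := by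
    refine (LSeries_hasDerivAt (hA _ hx1)).congr_of_eventuallyEq ?_
    filter_upwards [(isOpen_lt continuous_const Complex.continuous_re).mem_nhds hx1] with z hz
    exact (ha z hz).2
  have h4 := h3.unique (hasDerivAt_of_exp_LSeries hb hL hx1)
  rw [(ha _ hx1).2] at h4
  linear_combination -h4

/-- At `p ^ m` the Dirichlet convolution involves only powers of `p`, and the common factor `log p`
cancels. What remains is the logarithmic derivative of the local factor as a formal power series. -/
lemma mk_logDeriv (ha : ∀ s : ℂ, 1 < s.re → LSeriesSummable a s ∧ L s = LSeries a s)
    (hb : ∀ s : ℂ, 1 < s.re → LSeriesSummable b s)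
    (hL : ∀ s : ℂ, 1 < s.re → Complex.exp (LSeries b s) = L s) {p : ℕ} (hp : p.Prime) :
    PowerSeries.X * PowerSeries.derivative ℂ (PowerSeries.mk fun m => a (p ^ m)) =
      PowerSeries.mk (fun m => (m : ℂ) * b (p ^ m)) * PowerSeries.mk fun m => a (p ^ m) := by
  have hlog : (Real.log p : ℂ) ≠ 0 := by
    exact_mod_cast (Real.log_pos (by exact_mod_cast hp.one_lt)).ne'
  ext m
  rw [coeff_X_mul_derivative, PowerSeries.coeff_mul]
  simp only [PowerSeries.coeff_mk]
  have h1 := logMul_eq_convolution ha hb hL (pow_ne_zero m hp.ne_zero)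
  have hlogp : ∀ k : ℕ, Complex.log ((p ^ k : ℕ) : ℂ) = k * (Real.log p : ℂ) := fun k => by
    rw [Complex.natCast_log.symm, Nat.cast_pow, Real.log_pow]
    push_cast
    rfl
  rw [LSeries.convolution_def] at h1
  simp only [LSeries.logMul] at h1
  rw [Nat.sum_divisorsAntidiagonal (fun i j => Complex.log i * b i * a j),
    Nat.sum_divisors_prime_pow hp, hlogp] at h1
  rw [Finset.Nat.sum_antidiagonal_eq_sum_range_succ (fun i j => (i : ℂ) * b (p ^ i) * a (p ^ j))]
  refine mul_left_cancel₀ hlog ?_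
  rw [Finset.mul_sum]
  refine Eq.trans (by linear_combination h1) (Finset.sum_congr rfl fun i hi => ?_)
  have hi' : i ≤ m := by simpa [Nat.lt_succ_iff] using hi
  rw [hlogp, Nat.pow_div hi' hp.pos]
  ring

end LogCoeff

end ZeroRelation

end

noncomputable section

namespace ZeroRelation

/-! ### Local identities and bounds for the logarithmic coefficients -/

lemma exists_forall_norm_le_rpow {a : ℕ → ℂ}
    (ha : ∀ ε : ℝ, 0 < ε → a =O[atTop] fun n : ℕ => (n : ℝ) ^ ε) {ε : ℝ} (hε : 0 < ε) :
    ∃ A : ℝ, 0 ≤ A ∧ ∀ n : ℕ, n ≠ 0 → ‖a n‖ ≤ A * (n : ℝ) ^ ε := by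
  obtain ⟨A, hA, h⟩ := bound_of_isBigO_nat_atTop (ha ε hε)
  refine ⟨A, hA.le, fun n hn => ?_⟩
  have hn0 : (0 : ℝ) < n := by exact_mod_cast Nat.pos_of_ne_zero hn
  have h1 := h (x := n) (Real.rpow_pos_of_pos hn0 ε).ne'
  rwa [Real.norm_of_nonneg (Real.rpow_nonneg hn0.le ε)] at h1

section Bounds

variable {a b : ℕ → ℂ} {N : ℕ} {c : ℕ → ℕ → ℂ}

/-- The identity `F * Q = 1` expresses the `j`-th coefficient of `Q` through earlier ones and the
values `a (p ^ i)`. Giving half of `ε` to each factor keeps the constants uniform in `p`. -/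
lemma exists_norm_eulerCoeff_le
    (hA : ∀ ε : ℝ, 0 < ε → ∃ A : ℝ, 0 ≤ A ∧ ∀ n : ℕ, n ≠ 0 → ‖a n‖ ≤ A * (n : ℝ) ^ ε)
    (ha1 : a 1 = 1)
    (hFQ : ∀ p : ℕ, p.Prime →
      PowerSeries.mk (fun m => a (p ^ m)) * PowerSeries.mk (eulerCoeff N (c p)) = 1) (j : ℕ) :
    ∀ ε : ℝ, 0 < ε → ∃ C : ℝ, 0 ≤ C ∧ ∀ p : ℕ, p.Prime → ‖eulerCoeff N (c p) j‖ ≤ C * (p : ℝ) ^ ε := by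
  induction j using Nat.strong_induction_on with
  | _ j ih =>
  intro ε hε
  rcases Nat.eq_zero_or_pos j with rfl | hj
  · refine ⟨1, zero_le_one, fun p hp => ?_⟩
    rw [eulerCoeff, if_pos rfl, norm_one, one_mul]
    exact Real.one_le_rpow (by exact_mod_cast hp.one_le) hε.le
  have h1 : ∀ i : ℕ, ∃ A : ℝ, 0 ≤ A ∧ ∀ p : ℕ, p.Prime → ‖a (p ^ (i + 1))‖ ≤ A * (p : ℝ) ^ (ε / 2) := by
    intro i
    obtain ⟨A, hA0, hAb⟩ := hA (ε / 2 / (i + 1)) (by positivity)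
    refine ⟨A, hA0, fun p hp => (hAb _ (pow_ne_zero _ hp.ne_zero)).trans (le_of_eq ?_)⟩
    rw [Nat.cast_pow, ← Real.rpow_natCast, ← Real.rpow_mul p.cast_nonneg]
    congr 2
    push_cast
    field_simp
  choose A hA0 hAb using h1
  have h2 : ∀ i : ℕ, ∃ C : ℝ, 0 ≤ C ∧ (i < j → ∀ p : ℕ, p.Prime →
      ‖eulerCoeff N (c p) i‖ ≤ C * (p : ℝ) ^ (ε / 2)) := by
    intro i
    by_cases hi : i < j
    · obtain ⟨C, hC0, hC⟩ := ih i hi (ε / 2) (by positivity)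
      exact ⟨C, hC0, fun _ => hC⟩
    · exact ⟨0, le_rfl, fun h => absurd h hi⟩
  choose C hC0 hC using h2
  refine ⟨∑ i ∈ Finset.range j, A i * C (j - (i + 1)),
    Finset.sum_nonneg fun i _ => mul_nonneg (hA0 i) (hC0 _), fun p hp => ?_⟩
  have h3 := congrArg (PowerSeries.coeff j) (hFQ p hp)
  rw [PowerSeries.coeff_mul, PowerSeries.coeff_one, if_neg hj.ne'] at h3
  simp only [PowerSeries.coeff_mk] at h3
  rw [Finset.Nat.sum_antidiagonal_eq_sum_range_succ (fun k l => a (p ^ k) * eulerCoeff N (c p) l),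
    Finset.sum_range_succ', pow_zero, ha1, one_mul, Nat.sub_zero] at h3
  rw [eq_neg_of_add_eq_zero_right h3, norm_neg, Finset.sum_mul]
  refine (norm_sum_le _ _).trans (Finset.sum_le_sum fun i hi => ?_)
  have hi' := Finset.mem_range.1 hi
  rw [norm_mul]
  have hp0 : (0 : ℝ) < p := by exact_mod_cast hp.pos
  calc ‖a (p ^ (i + 1))‖ * ‖eulerCoeff N (c p) (j - (i + 1))‖
      ≤ (A i * (p : ℝ) ^ (ε / 2)) * (C (j - (i + 1)) * (p : ℝ) ^ (ε / 2)) :=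
        mul_le_mul (hAb i p hp) (hC _ (by omega) p hp) (norm_nonneg _)
          (mul_nonneg (hA0 i) (by positivity))
    _ = A i * C (j - (i + 1)) * ((p : ℝ) ^ (ε / 2) * (p : ℝ) ^ (ε / 2)) := by ring
    _ = _ := by rw [← Real.rpow_add hp0, add_halves]

/-- Coefficients of the difference of logarithmic derivatives which measures the deviation of the
explicit formulas from each other. -/
def logDiff (a b : ℕ → ℂ) (n : ℕ) : ℂ :=
  LSeries.logMul b n - (ArithmeticFunction.vonMangoldt n : ℂ) * a n

lemma logDiff_eq_zero (hb : ∀ n : ℕ, ¬IsPrimePow n → b n = 0) {n : ℕ} (hn : ¬IsPrimePow n) :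
    logDiff a b n = 0 := by
  rw [logDiff, LSeries.logMul, hb n hn, ArithmeticFunction.vonMangoldt_eq_zero_iff.2 hn]
  simp

lemma logDiff_pow {p m : ℕ} (hp : p.Prime) (hm : m ≠ 0) :
    logDiff a b (p ^ m) = (m * b (p ^ m) - a (p ^ m)) * (Real.log p : ℂ) := by
  rw [logDiff, LSeries.logMul, ArithmeticFunction.vonMangoldt_apply_pow hm,
    ArithmeticFunction.vonMangoldt_apply_prime hp, ← Complex.natCast_log, Nat.cast_pow,
    Real.log_pow]
  push_cast
  ring

/-- The Euler factors of the series with coefficients `a` are inverse to the polynomials with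
coefficients `c`, and have the logarithmic coefficients `b`. -/
structure EulerData (a b : ℕ → ℂ) (N : ℕ) (c : ℕ → ℕ → ℂ) : Prop where
  one : a 1 = 1
  inv : ∀ p : ℕ, p.Prime →
    PowerSeries.mk (fun m => a (p ^ m)) * PowerSeries.mk (eulerCoeff N (c p)) = 1
  logDeriv : ∀ p : ℕ, p.Prime →
    PowerSeries.X * PowerSeries.derivative ℂ (PowerSeries.mk fun m => a (p ^ m)) =
      PowerSeries.mk (fun m => (m : ℂ) * b (p ^ m)) * PowerSeries.mk fun m => a (p ^ m)

namespace EulerData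

/-- These are Newton's identities, read off from `-F · X Q'` with `F = 1 / Q`. -/
lemma mul_apply_pow (h : EulerData a b N c) {p : ℕ} (hp : p.Prime) (m : ℕ) : (m : ℂ) * b (p ^ m) =
    -∑ l ∈ Finset.range (m + 1), (l : ℂ) * eulerCoeff N (c p) l * a (p ^ (m - l)) := by
  have h3 := congrArg (PowerSeries.coeff m) (coeff_of_logDeriv (h.inv p hp) (h.logDeriv p hp))
  rw [mul_comm (PowerSeries.mk fun m => a (p ^ m)), map_neg, PowerSeries.coeff_mul] at h3
  simp only [coeff_X_mul_derivative, PowerSeries.coeff_mk] at h3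
  rw [h3, Finset.Nat.sum_antidiagonal_eq_sum_range_succ
    (fun l k => (l : ℂ) * eulerCoeff N (c p) l * a (p ^ k))]

lemma eulerCoeff_one (h : EulerData a b N c) {p : ℕ} (hp : p.Prime) : eulerCoeff N (c p) 1 = -a p := by
  have h3 := congrArg (PowerSeries.coeff 1) (h.inv p hp)
  rw [PowerSeries.coeff_mul, PowerSeries.coeff_one, if_neg one_ne_zero] at h3
  simp only [PowerSeries.coeff_mk] at h3
  rw [Finset.Nat.sum_antidiagonal_eq_sum_range_succ (fun k l => a (p ^ k) * eulerCoeff N (c p) l),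
    Finset.sum_range_succ, Finset.sum_range_one] at h3
  simp only [pow_zero, h.one, Nat.sub_zero, one_mul, pow_one, Nat.sub_self] at h3
  have h0 : eulerCoeff N (c p) 0 = 1 := by simp [eulerCoeff]
  rw [h0] at h3
  linear_combination h3

/-- The linear coefficients give `b(p) = c₁(p) = a(p)`; hence the two explicit formulas agree at
primes. -/
lemma logDiff_prime (h : EulerData a b N c) {p : ℕ} (hp : p.Prime) : logDiff a b p = 0 := by
  have h1 := h.mul_apply_pow hp 1
  rw [Finset.sum_range_succ, Finset.sum_range_one] at h1
  simp only [pow_zero, h.one, Nat.sub_self, pow_one, Nat.cast_one, Nat.cast_zero, zero_mul, zero_add,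
    one_mul, mul_one, h.eulerCoeff_one hp, neg_neg] at h1
  have h2 := logDiff_pow (a := a) (b := b) hp one_ne_zero
  rw [pow_one] at h2
  rw [h2, Nat.cast_one, one_mul, h1, sub_self, zero_mul]

/-- Here `2 b(p²) = a(p)² + 2 c₂(p)` while `a(p²) = a(p)² + c₂(p)`. The condition `2 ≤ N` ensures
that `c₂` occurs in the Euler polynomial. -/
lemma logDiff_sq (h : EulerData a b N c) (hN : 2 ≤ N) {p : ℕ} (hp : p.Prime) :
    logDiff a b (p ^ 2) = c p 2 * (Real.log p : ℂ) := by
  have h1 := h.mul_apply_pow hp 2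
  have h3 := congrArg (PowerSeries.coeff 2) (h.inv p hp)
  rw [PowerSeries.coeff_mul, PowerSeries.coeff_one, if_neg two_ne_zero] at h3
  simp only [PowerSeries.coeff_mk] at h3
  rw [Finset.Nat.sum_antidiagonal_eq_sum_range_succ (fun k l => a (p ^ k) * eulerCoeff N (c p) l),
    Finset.sum_range_succ, Finset.sum_range_succ, Finset.sum_range_one] at h3
  rw [Finset.sum_range_succ, Finset.sum_range_succ, Finset.sum_range_one] at h1
  have h0 : eulerCoeff N (c p) 0 = 1 := by simp [eulerCoeff]
  have h2 : eulerCoeff N (c p) 2 = -c p 2 := by simp [eulerCoeff, hN]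
  have e21 : 2 - 1 = 1 := rfl
  simp only [pow_zero, h.one, Nat.sub_zero, one_mul, pow_one, Nat.sub_self, e21,
    h.eulerCoeff_one hp, h0, h2, mul_one] at h3 h1
  rw [logDiff_pow hp two_ne_zero]
  push_cast at h1 ⊢
  congr 1
  linear_combination h1 - h3

/-- However large `m` is, Newton's identity at `p ^ m` has at most `N` nonzero terms, so the
Ramanujan bound for `a` passes to `m b(p ^ m)`. -/
lemma exists_norm_logDiff_le (h : EulerData a b N c)
    (hA : ∀ ε : ℝ, 0 < ε → ∃ A : ℝ, 0 ≤ A ∧ ∀ n : ℕ, n ≠ 0 → ‖a n‖ ≤ A * (n : ℝ) ^ ε)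
    (hb : ∀ n : ℕ, ¬IsPrimePow n → b n = 0) {ε : ℝ} (hε : 0 < ε) :
    ∃ C : ℝ, 0 ≤ C ∧ ∀ n : ℕ, ‖logDiff a b n‖ ≤ C * (n : ℝ) ^ ε := by
  have hδ : 0 < ε / 3 := by positivity
  -- One third each for `a (p ^ (m - l))`, for the coefficient of the Euler polynomial and for `log
  -- p`.
  set δ := ε / 3 with hδdef
  obtain ⟨A, hA0, hAb⟩ := hA δ hδ
  choose Q hQ0 hQ using fun l => exists_norm_eulerCoeff_le hA h.one h.inv l δ hδ
  set K := ∑ l ∈ Finset.range (N + 1), (l : ℝ) * Q l with hK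
  have hK0 : 0 ≤ K := Finset.sum_nonneg fun l _ => mul_nonneg l.cast_nonneg (hQ0 l)
  refine ⟨(K * A + A) / δ, by positivity, fun n => ?_⟩
  by_cases hn : IsPrimePow n
  swap
  · rw [logDiff_eq_zero hb hn, norm_zero]
    positivity
  obtain ⟨p, m, hp, hm, rfl⟩ := (isPrimePow_nat_iff n).1 hn
  have hp0 : (0 : ℝ) < p := by exact_mod_cast hp.pos
  have hp1 : (1 : ℝ) ≤ p := by exact_mod_cast hp.one_le
  set X : ℝ := ((p ^ m : ℕ) : ℝ) ^ δ with hX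
  have hpX : (p : ℝ) ^ δ ≤ X := by
    rw [hX, Nat.cast_pow]
    exact Real.rpow_le_rpow hp0.le (le_self_pow₀ hp1 hm.ne') hδ.le
  have hX1 : 1 ≤ X := (Real.one_le_rpow hp1 hδ.le).trans hpX
  have hX3 : ((p ^ m : ℕ) : ℝ) ^ ε = X ^ 3 := by
    rw [hX, ← Real.rpow_natCast, ← Real.rpow_mul (Nat.cast_nonneg _)]
    congr 1
    rw [hδdef]
    push_cast
    ring
  have hab : ∀ l ≤ m, ‖a (p ^ (m - l))‖ ≤ A * X := fun l _ => by
    refine (hAb _ (pow_ne_zero _ hp.ne_zero)).trans ?_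
    gcongr
    rw [hX]
    refine Real.rpow_le_rpow (Nat.cast_nonneg _) ?_ hδ.le
    exact_mod_cast Nat.pow_le_pow_right hp.pos (Nat.sub_le m l)
  have hmb : ‖(m : ℂ) * b (p ^ m)‖ ≤ K * X * (A * X) := by
    rw [h.mul_apply_pow hp m, norm_neg]
    refine (norm_sum_le _ _).trans ?_
    calc ∑ l ∈ Finset.range (m + 1), ‖(l : ℂ) * eulerCoeff N (c p) l * a (p ^ (m - l))‖
        ≤ ∑ l ∈ Finset.range (m + 1), ((l : ℝ) * ‖eulerCoeff N (c p) l‖) * (A * X) := by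
          refine Finset.sum_le_sum fun l hl => ?_
          rw [norm_mul, norm_mul, Complex.norm_natCast]
          gcongr
          exact hab l (by simpa [Nat.lt_succ_iff] using hl)
      _ = (∑ l ∈ Finset.range (m + 1), (l : ℝ) * ‖eulerCoeff N (c p) l‖) * (A * X) := by
          rw [Finset.sum_mul]
      _ ≤ (∑ l ∈ Finset.range (N + 1), (l : ℝ) * ‖eulerCoeff N (c p) l‖) * (A * X) := by
          -- Either of `m` and `N` may be the larger; the sum is compared through a common range,
          -- terms beyond `N` being zero.
          have hsub : Finset.range (N + 1) ⊆ Finset.range (max m N + 1) :=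
            Finset.range_mono (by omega)
          rw [Finset.sum_subset hsub fun l _ hl => by
            rw [eulerCoeff_of_gt _ (by simpa using hl), norm_zero, mul_zero]]
          refine mul_le_mul_of_nonneg_right (Finset.sum_le_sum_of_subset_of_nonneg
            (Finset.range_mono (by omega)) fun l _ _ => by positivity) (by positivity)
      _ ≤ K * X * (A * X) := by
          refine mul_le_mul_of_nonneg_right ?_ (by positivity)
          rw [hK, Finset.sum_mul]
          refine Finset.sum_le_sum fun l _ => ?_
          rw [mul_assoc]
          exact mul_le_mul_of_nonneg_left ((hQ l p hp).trans
            (mul_le_mul_of_nonneg_left hpX (hQ0 l))) l.cast_nonneg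
  have hlog0 : 0 ≤ Real.log p := Real.log_nonneg hp1
  have hlog : Real.log p ≤ X / δ :=
    (Real.log_le_rpow_div hp0.le hδ).trans (div_le_div_of_nonneg_right hpX hδ.le)
  rw [logDiff_pow hp hm.ne', norm_mul, Complex.norm_real, Real.norm_of_nonneg hlog0, hX3]
  have h1 : ‖(m : ℂ) * b (p ^ m) - a (p ^ m)‖ ≤ (K * A + A) * X ^ 2 := by
    refine (norm_sub_le _ _).trans ?_
    have h2 := hab 0 (Nat.zero_le m)
    rw [Nat.sub_zero] at h2
    nlinarith [mul_nonneg hA0 (sub_nonneg.2 hX1), mul_nonneg (mul_nonneg hA0 (sub_nonneg.2 hX1))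
      (zero_le_one.trans hX1)]
  calc _ ≤ ((K * A + A) * X ^ 2) * (X / δ) := by gcongr
    _ = _ := by ring

end EulerData

end Bounds

end ZeroRelation

end

noncomputable section

namespace ZeroRelation

open MeasureTheory

/-! ### Sums over prime powers against dilated test functions -/

lemma IsTest.exists_norm_le_rpow {h : ℝ → ℂ} (hh : IsTest h) {α : ℝ} (hα : 0 < α) :
    ∃ M : ℝ, 0 ≤ M ∧ ∀ u : ℝ, 0 < u → ‖h u‖ ≤ M * u ^ (-α) := by
  obtain ⟨M, hM⟩ := hh.compact.exists_bound_of_continuous hh.continuous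
  obtain ⟨A, B, hA, hAB', hAB⟩ := hh.exists_support_subset_Icc hh.supp
  have hM0 : 0 ≤ M := (norm_nonneg _).trans (hM 0)
  have hB : 0 < B := hA.trans hAB'
  refine ⟨M * B ^ α, by positivity, fun u hu => ?_⟩
  by_cases h0 : h u = 0
  · rw [h0, norm_zero]; positivity
  · have huB : u ≤ B := (hAB (subset_tsupport _ h0)).2
    have h1 : 1 ≤ B ^ α * u ^ (-α) := by
      rw [Real.rpow_neg hu.le, ← div_eq_mul_inv, one_le_div (by positivity)]
      exact Real.rpow_le_rpow hu.le huB hα.le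
    calc ‖h u‖ ≤ M * 1 := by rw [mul_one]; exact hM u
      _ ≤ M * (B ^ α * u ^ (-α)) := by gcongr
      _ = _ := by ring

/-- Rankin's trick: compact support gives `‖h u‖ ≤ M u ^ (-α)`, and the factor `x ^ (-α)` comes out
of the sum. -/
lemma isBigO_tsum_scale {D : ℕ → ℂ} {h : ℝ → ℂ} (hh : IsTest h) {α : ℝ} (hα : 0 < α)
    (hs : Summable fun n : ℕ => ‖D n‖ * (n : ℝ) ^ (-α)) :
    (fun x : ℝ => ∑' n : ℕ, D n * h (x * n)) =O[𝓝[>] (0 : ℝ)] fun x => x ^ (-α) := by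
  obtain ⟨M, hM0, hM⟩ := hh.exists_norm_le_rpow hα
  refine IsBigO.of_bound (M * ∑' n : ℕ, ‖D n‖ * (n : ℝ) ^ (-α)) ?_
  filter_upwards [self_mem_nhdsWithin] with x hx
  have hx0 : (0 : ℝ) < x := hx
  rw [Real.norm_of_nonneg (by positivity), mul_right_comm, ← tsum_mul_left]
  refine tsum_of_norm_bounded (hs.mul_left _).hasSum fun n => ?_
  rcases Nat.eq_zero_or_pos n with rfl | hn
  · rw [Nat.cast_zero, mul_zero, hh.eq_zero_of_nonpos le_rfl, mul_zero, norm_zero]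
    positivity
  · have hn0 : (0 : ℝ) < n := by exact_mod_cast hn
    rw [norm_mul]
    calc ‖D n‖ * ‖h (x * n)‖ ≤ ‖D n‖ * (M * (x * n) ^ (-α)) := by
          gcongr
          exact hM _ (by positivity)
      _ = _ := by rw [Real.mul_rpow hx0.le hn0.le]; ring

lemma injective_prime_pow_add {j : ℕ} (hj : j ≠ 0) :
    Function.Injective fun q : Nat.Primes × ℕ => (q.1 : ℕ) ^ (q.2 + j) := by
  rintro ⟨p, k⟩ ⟨q, l⟩ h
  obtain ⟨h1, h2⟩ := Nat.Prime.pow_inj' p.2 q.2 (by omega) (by omega) h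
  exact Prod.ext (Subtype.ext h1) (by simpa using h2)

/-- Sums over `j`-full prime powers. -/
lemma summable_of_support_prime_pow {D : ℕ → ℂ} {j : ℕ} (hj : j ≠ 0) {C ε α : ℝ}
    (hD : ∀ n, ‖D n‖ ≤ C * (n : ℝ) ^ ε)
    (hsupp : ∀ n, D n ≠ 0 → ∃ p k : ℕ, p.Prime ∧ n = p ^ (k + j)) (hα : 1 / (j : ℝ) + ε < α) :
    Summable fun n : ℕ => ‖D n‖ * (n : ℝ) ^ (-α) := by
  have hj0 : (0 : ℝ) < j := by exact_mod_cast Nat.pos_of_ne_zero hj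
  set β := α - ε with hβ
  have hβj : 1 < j * β := by
    have : 1 / (j : ℝ) < β := by rw [hβ]; linarith
    rwa [div_lt_iff₀' hj0] at this
  have hβ0 : 0 < β := by
    by_contra h
    nlinarith [not_lt.1 h]
  have hC : 0 ≤ C := by
    have := (norm_nonneg _).trans (hD 1)
    simpa using this
  -- Parametrizing by `(p, k)`, the sum is dominated by a product: `∑ p ^ (-jβ)` over primes,
  -- convergent as `jβ > 1`, times a geometric series in `k` since `p ≥ 2`.
  rw [← (injective_prime_pow_add hj).summable_iff]
  · have h1 : Summable fun p : Nat.Primes => ((p : ℕ) : ℝ) ^ (-(j * β)) :=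
      Nat.Primes.summable_rpow.2 (by linarith)
    have h2 : Summable fun k : ℕ => ((2 : ℝ) ^ (-β)) ^ k :=
      summable_geometric_of_lt_one (by positivity)
        (Real.rpow_lt_one_of_one_lt_of_neg one_lt_two (by linarith))
    have h3 := (h1.mul_of_nonneg h2 (fun p => by positivity) fun k => by positivity).mul_left C
    refine Summable.of_nonneg_of_le (fun q => by simp only [Function.comp_apply]; positivity)
      (fun q => ?_) h3
    obtain ⟨p, k⟩ := q
    have hp0 : (0 : ℝ) < (p : ℕ) := by exact_mod_cast p.2.pos
    have hp2 : (2 : ℝ) ≤ (p : ℕ) := by exact_mod_cast p.2.two_le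
    have hn0 : (0 : ℝ) < (((p : ℕ) ^ (k + j) : ℕ) : ℝ) := by exact_mod_cast pow_pos p.2.pos _
    simp only [Function.comp_apply]
    calc ‖D ((p : ℕ) ^ (k + j))‖ * (((p : ℕ) ^ (k + j) : ℕ) : ℝ) ^ (-α)
        ≤ (C * (((p : ℕ) ^ (k + j) : ℕ) : ℝ) ^ ε) * (((p : ℕ) ^ (k + j) : ℕ) : ℝ) ^ (-α) := by
          gcongr
          exact hD _
      _ = C * (((p : ℕ) ^ (k + j) : ℕ) : ℝ) ^ (-β) := by
          rw [mul_assoc, ← Real.rpow_add hn0]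
          congr 2
          rw [hβ]; ring
      _ = C * (((p : ℕ) : ℝ) ^ (-(j * β)) * (((p : ℕ) : ℝ) ^ (-β)) ^ k) := by
          rw [Nat.cast_pow, ← Real.rpow_natCast, ← Real.rpow_natCast, ← Real.rpow_mul hp0.le,
            ← Real.rpow_mul hp0.le, ← Real.rpow_add hp0]
          congr 2
          push_cast
          ring
      _ ≤ _ := by
          have h4 : ((p : ℕ) : ℝ) ^ (-β) ≤ 2 ^ (-β) :=
            Real.rpow_le_rpow_of_nonpos two_pos hp2 (by linarith)
          gcongr
  · intro n hn
    have h0 : D n = 0 := by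
      by_contra h
      obtain ⟨p, k, hp, rfl⟩ := hsupp n h
      exact hn ⟨(⟨p, hp⟩, k), rfl⟩
    rw [h0, norm_zero, zero_mul]

lemma IsTest.summable_mul_scale {h : ℝ → ℂ} (hh : IsTest h) (D : ℕ → ℂ) {x : ℝ} (hx : 0 < x) :
    Summable fun n : ℕ => D n * h (x * n) := by
  obtain ⟨A, B, -, -, hAB⟩ := hh.exists_support_subset_Icc hh.supp
  refine summable_of_ne_finset_zero (s := Finset.range (⌊B / x⌋₊ + 1)) fun n hn => ?_
  have hn' : ⌊B / x⌋₊ < n := by simpa using hn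
  have h1 : B < x * n := by
    have := Nat.lt_of_floor_lt hn'
    rwa [div_lt_iff₀' hx] at this
  have h2 : h (x * n) = 0 := by
    by_contra h0
    exact (hAB (subset_tsupport _ h0)).2.not_gt h1
  rw [h2, mul_zero]

open Classical in
/-- The restriction of `D` to squares of primes. -/
def sqPart (D : ℕ → ℂ) (n : ℕ) : ℂ := if ∃ p : ℕ, p.Prime ∧ n = p ^ 2 then D n else 0

lemma exists_of_sqPart_ne_zero {D : ℕ → ℂ} {n : ℕ} (h : sqPart D n ≠ 0) :
    ∃ p : ℕ, p.Prime ∧ n = p ^ 2 := by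
  by_contra h0
  exact h (if_neg h0)

lemma norm_sqPart_le (D : ℕ → ℂ) (n : ℕ) : ‖sqPart D n‖ ≤ ‖D n‖ := by
  rw [sqPart]; split_ifs <;> simp

lemma norm_sub_sqPart_le (D : ℕ → ℂ) (n : ℕ) : ‖D n - sqPart D n‖ ≤ ‖D n‖ := by
  rw [sqPart]; split_ifs <;> simp

lemma isBigO_sqPart {D : ℕ → ℂ} {h : ℝ → ℂ} (hh : IsTest h)
    (hD : ∀ ε : ℝ, 0 < ε → ∃ C : ℝ, 0 ≤ C ∧ ∀ n : ℕ, ‖D n‖ ≤ C * (n : ℝ) ^ ε) {ε : ℝ} (hε : 0 < ε) :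
    (fun x : ℝ => ∑' n : ℕ, sqPart D n * h (x * n)) =O[𝓝[>] (0 : ℝ)]
      fun x => x ^ (-(1 / 2 : ℝ) - ε) := by
  obtain ⟨C, -, hC⟩ := hD (ε / 2) (by positivity)
  have h1 := isBigO_tsum_scale hh (D := sqPart D) (α := 1 / 2 + ε) (by positivity)
    (summable_of_support_prime_pow two_ne_zero (fun n => (norm_sqPart_le D n).trans (hC n))
      (fun n hn => ?_) (by push_cast; linarith))
  · rwa [neg_add'] at h1
  · obtain ⟨p, hp, rfl⟩ := exists_of_sqPart_ne_zero hn
    exact ⟨p, 0, hp, rfl⟩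

/-- With primes and their squares gone, only exponents at least 3 remain, whence the abscissa `1/3`.
-/
lemma isBigO_sub_sqPart {D : ℕ → ℂ} {h : ℝ → ℂ} (hh : IsTest h)
    (hD : ∀ ε : ℝ, 0 < ε → ∃ C : ℝ, 0 ≤ C ∧ ∀ n : ℕ, ‖D n‖ ≤ C * (n : ℝ) ^ ε)
    (hpp : ∀ n, ¬IsPrimePow n → D n = 0) (hp : ∀ p : ℕ, p.Prime → D p = 0) {ε : ℝ} (hε : 0 < ε) :
    (fun x : ℝ => ∑' n : ℕ, D n * h (x * n) - ∑' n : ℕ, sqPart D n * h (x * n))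
      =O[𝓝[>] (0 : ℝ)] fun x => x ^ (-(1 / 3 : ℝ) - ε) := by
  obtain ⟨C, -, hC⟩ := hD (ε / 2) (by positivity)
  have h1 := isBigO_tsum_scale hh (D := fun n => D n - sqPart D n) (α := 1 / 3 + ε) (by positivity)
    (summable_of_support_prime_pow three_ne_zero (fun n => (norm_sub_sqPart_le D n).trans (hC n))
      (fun n hn => ?_) (by push_cast; linarith))
  · rw [neg_add'] at h1
    refine h1.congr' ?_ EventuallyEq.rfl
    filter_upwards [self_mem_nhdsWithin] with x hx
    rw [← (hh.summable_mul_scale D hx).tsum_sub (hh.summable_mul_scale (sqPart D) hx)]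
    simp only [sub_mul]
  · have hD0 : D n ≠ 0 := fun h0 => hn (by rw [sqPart, h0]; simp)
    have hpn : IsPrimePow n := by
      by_contra h0
      exact hD0 (hpp n h0)
    obtain ⟨p, k, hpr, hk, rfl⟩ := (isPrimePow_nat_iff n).1 hpn
    have hk1 : k ≠ 1 := by
      rintro rfl
      rw [pow_one] at hD0
      exact hD0 (hp p hpr)
    have hk2 : k ≠ 2 := by
      rintro rfl
      refine hn ?_
      rw [sqPart, if_pos ⟨p, hpr, rfl⟩, sub_self]
    exact ⟨p, k - 3, hpr, by congr 1; omega⟩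

/-! ### The extra term -/

section ExtraTerm

variable {N : ℕ} {c : ℕ → ℕ → ℂ} {h : ℝ → ℂ}

open Classical in
/-- The exceptional primes do not contribute for small arguments. -/
lemma eventually_extraTerm_eq (hS : {p : ℕ | p.Prime ∧ c p N = 0}.Finite) (hh : IsTest h) :
    ∀ᶠ x : ℝ in 𝓝[>] 0, extraTerm N c h x = ∑' p : ℕ,
      (if p.Prime then c p 2 * (Real.log p : ℂ) else 0) * h (x * (p : ℝ) ^ 2) := by
  obtain ⟨A, B, hA, -, hAB⟩ := hh.exists_support_subset_Icc hh.supp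
  have h1 : ∀ᶠ x : ℝ in 𝓝[>] 0, ∀ p ∈ {p : ℕ | p.Prime ∧ c p N = 0}, x * (p : ℝ) ^ 2 < A := by
    refine (eventually_all_finite hS).2 fun p _ => nhdsWithin_le_nhds ?_
    have h2 : Tendsto (fun x : ℝ => x * (p : ℝ) ^ 2) (𝓝 0) (𝓝 (0 * (p : ℝ) ^ 2)) :=
      tendsto_id.mul_const _
    rw [zero_mul] at h2
    exact h2.eventually_lt_const hA
  filter_upwards [h1] with x hx
  refine tsum_congr fun p => ?_
  by_cases hp : p.Prime
  · by_cases hc : c p N = 0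
    · have h2 : h (x * (p : ℝ) ^ 2) = 0 := by
        by_contra h0
        exact (hAB (subset_tsupport _ h0)).1.not_gt (hx p ⟨hp, hc⟩)
      simp [hc, h2]
    · rw [if_pos ⟨hp, hc⟩, if_pos hp]
      ring
  · rw [if_neg (fun h => hp h.1), if_neg hp, zero_mul]

lemma eventually_extraTerm_eq_sqPart {D : ℕ → ℂ} (hS : {p : ℕ | p.Prime ∧ c p N = 0}.Finite)
    (hh : IsTest h) (hD : ∀ p : ℕ, p.Prime → D (p ^ 2) = c p 2 * (Real.log p : ℂ)) :
    ∀ᶠ x : ℝ in 𝓝[>] 0, extraTerm N c h x = ∑' n : ℕ, sqPart D n * h (x * n) := by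
  classical
  filter_upwards [eventually_extraTerm_eq hS hh] with x hx
  rw [hx]
  have h1 : Function.Injective fun p : Nat.Primes => (p : ℕ) ^ 2 := fun p q h =>
    Subtype.ext (Nat.pow_left_injective two_ne_zero h)
  have h2 := h1.tsum_eq (f := fun n => sqPart D n * h (x * n)) fun n hn => by
    have h3 : sqPart D n ≠ 0 := left_ne_zero_of_mul hn
    obtain ⟨p, hp, rfl⟩ := exists_of_sqPart_ne_zero h3
    exact ⟨⟨p, hp⟩, rfl⟩
  have h4 := (Subtype.val_injective (p := Nat.Prime)).tsum_eq
    (f := fun p : ℕ => (if p.Prime then c p 2 * (Real.log p : ℂ) else 0) * h (x * (p : ℝ) ^ 2))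
    fun p hp => by
      have h3 := left_ne_zero_of_mul hp
      rw [ite_ne_right_iff] at h3
      exact ⟨⟨p, h3.1⟩, rfl⟩
  rw [← h2, ← h4]
  refine tsum_congr fun p => ?_
  have hp : Nat.Prime p.1 := p.2
  rw [if_pos hp, sqPart, if_pos ⟨p.1, hp, rfl⟩, hD _ hp]
  push_cast
  rfl

end ExtraTerm

end ZeroRelation

end

noncomputable section

namespace ZeroRelation

open MeasureTheory

/-! ### Partial summation -/

/-- The cutoff removes the mirror image of the support under `u ↦ -u`; smoothness survives because
the function already vanishes for `u < √A`. -/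
lemma IsTest.comp_sq {h : ℝ → ℂ} (hh : IsTest h) :
    IsTest fun u => if 0 < u then h (u ^ 2) else 0 := by
  obtain ⟨A, B, hA, hAB', hAB⟩ := hh.exists_support_subset_Icc hh.supp
  have h0 : ∀ u : ℝ, 0 < u → h (u ^ 2) ≠ 0 → u ∈ Icc (√A) (√B) := fun u hu hne => by
    have h1 := hAB (subset_tsupport _ hne)
    exact ⟨Real.sqrt_le_iff.2 ⟨hu.le, h1.1⟩, Real.le_sqrt_of_sq_le h1.2⟩
  have hsupp : Function.support (fun u => if 0 < u then h (u ^ 2) else 0) ⊆ Icc (√A) (√B) := by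
    intro u hu
    rw [Function.mem_support, ite_ne_right_iff] at hu
    exact h0 u hu.1 hu.2
  refine ⟨?_, HasCompactSupport.of_support_subset_isCompact isCompact_Icc hsupp, ?_⟩
  · rw [contDiff_iff_contDiffAt]
    intro u
    rcases lt_or_ge 0 u with hu | hu
    · refine (hh.smooth.comp (contDiff_id.pow 2)).contDiffAt.congr_of_eventuallyEq ?_
      filter_upwards [Ioi_mem_nhds hu] with v hv
      rw [if_pos (show 0 < v from hv)]
      rfl
    · refine (contDiff_const (c := (0 : ℂ))).contDiffAt.congr_of_eventuallyEq ?_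
      filter_upwards [Iio_mem_nhds (hu.trans_lt (Real.sqrt_pos.2 hA))] with v hv
      by_contra hne
      exact (hsupp hne).1.not_gt hv
  · exact (closure_minimal hsupp isClosed_Icc).trans
      fun u hu => (Real.sqrt_pos.2 hA).trans_le hu.1

/-- Partial summation against a dilated test function. -/
lemma isBigO_tsum_sub_mellin {H : ℝ → ℂ} (hH : IsTest H) {D : ℕ → ℂ} {A μ : ℂ} {κ : ℝ} (hκ : 0 ≤ κ)
    (hμ : 0 < μ.re)
    (hS : (fun T : ℝ => (∑ k ∈ Finset.Icc 0 ⌊T⌋₊, D k) - A * (T : ℂ) ^ μ) =O[atTop]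
      fun T : ℝ => T ^ κ) :
    (fun y : ℝ => (∑' n : ℕ, D n * H (y * n)) - μ * A * mellin (fun u => H (y * u)) μ)
      =O[𝓝[>] (0 : ℝ)] fun y => y ^ (-κ) := by
  obtain ⟨a, b, ha, hab, habs⟩ := hH.exists_support_subset_Icc hH.supp
  have hb0 : 0 < b := ha.trans hab
  obtain ⟨K, hK⟩ := hS.bound
  obtain ⟨T₀, hT₀⟩ := eventually_atTop.1 hK
  refine IsBigO.of_bound (|K| * b ^ κ * ∫ t : ℝ, ‖deriv H t‖) ?_
  -- For such `y` the dilated function is supported beyond `T₀`, so the asymptotic for the partial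
  -- sums applies on the whole support.
  have hev : ∀ᶠ y : ℝ in 𝓝[>] 0, y * max T₀ 1 < a := by
    have h2 : Tendsto (fun y : ℝ => y * max T₀ 1) (𝓝 0) (𝓝 (0 * max T₀ 1)) :=
      tendsto_id.mul_const _
    rw [zero_mul] at h2
    exact nhdsWithin_le_nhds (h2.eventually_lt_const ha)
  filter_upwards [hev, self_mem_nhdsWithin] with y hya hy
  have hy0 : (0 : ℝ) < y := hy
  set g : ℝ → ℂ := fun u => H (y * u) with hg
  have hgT : IsTest g := hH.scale hy0
  have hgs : tsupport g ⊆ Icc (a / y) (b / y) := IsTest.tsupport_scale_subset habs hy0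
  have hgd : Differentiable ℝ g := hgT.smooth.differentiable (by simp)
  have hgc : Continuous (deriv g) := hgT.smooth.continuous_deriv (by simp)
  have hgi : Integrable (deriv g) := hgc.integrable_of_hasCompactSupport hgT.compact.deriv
  have hdz : ∀ t, deriv g t ≠ 0 → t ∈ Icc (a / y) (b / y) := fun t ht =>
    hgs (support_deriv_subset ht)
  set B : ℝ := b / y + 1 with hB
  have hB0 : 0 ≤ B := by positivity
  set S : ℝ → ℂ := fun t => ∑ k ∈ Finset.Icc 0 ⌊t⌋₊, D k with hSdef
  have hgB : ∀ t, B ≤ t → g t = 0 := fun t ht => by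
    by_contra h0
    have := (hgs (subset_tsupport _ h0)).2
    linarith
  have hsum : ∑' n : ℕ, D n * H (y * n) = -∫ t in Ioc 0 B, deriv g t * S t := by
    have h1 := sum_mul_eq_sub_integral_mul D (f := g) hB0 (fun t _ => hgd t) hgi.integrableOn
    rw [hgB B le_rfl, zero_mul, zero_sub] at h1
    rw [← h1, tsum_eq_sum (s := Finset.Icc 0 ⌊B⌋₊) fun n hn => ?_]
    · exact Finset.sum_congr rfl fun n _ => mul_comm _ _
    · have hn' : ⌊B⌋₊ < n := by simpa using hn
      rw [show H (y * n) = g n from rfl, hgB n (Nat.lt_of_floor_lt hn').le, mul_zero]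
  -- Integration by parts puts the main term in the same shape as the sum, with `A * t ^ μ`
  -- replacing the partial sums.
  have hmel : μ * A * mellin g μ = -∫ t in Ioc 0 B, deriv g t * (A * (t : ℂ) ^ μ) := by
    have h1 := hgT.mellin_mul_deriv μ
    have h2 : mellin (fun u => (u : ℂ) * deriv g u) μ = ∫ t in Ioc 0 B, deriv g t * (t : ℂ) ^ μ := by
      rw [mellin, setIntegral_eq_of_subset_of_forall_sdiff_eq_zero measurableSet_Ioi
        (Ioc_subset_Ioi_self : Ioc 0 B ⊆ Ioi 0)]
      · refine setIntegral_congr_fun measurableSet_Ioc fun t ht => ?_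
        have ht0 : (t : ℂ) ≠ 0 := by exact_mod_cast ht.1.ne'
        simp only [smul_eq_mul]
        rw [Complex.cpow_sub _ _ ht0, Complex.cpow_one]
        field_simp
      · intro t ht
        have hz : deriv g t = 0 := by
          by_contra h0
          have h3 := (hdz t h0).2
          exact ht.2 ⟨ht.1, by linarith⟩
        rw [hz, mul_zero, smul_zero]
    rw [h2] at h1
    have h3 : (fun t : ℝ => deriv g t * (A * (t : ℂ) ^ μ)) =
        fun t : ℝ => A * (deriv g t * (t : ℂ) ^ μ) := by
      funext t; ring
    rw [h3, integral_const_mul, h1]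
    ring
  have hint1 : IntegrableOn (fun t => deriv g t * S t) (Ioc 0 B) :=
    (integrableOn_mul_sum_Icc D (m := 0) le_rfl hgi.integrableOn).mono_set Ioc_subset_Icc_self
  have hcp : Continuous fun t : ℝ => (t : ℂ) ^ μ := Complex.continuous_ofReal_cpow_const hμ
  have hint2 : IntegrableOn (fun t : ℝ => deriv g t * (A * (t : ℂ) ^ μ)) (Ioc 0 B) :=
    ((hgc.mul (continuous_const.mul hcp)).integrableOn_Icc).mono_set Ioc_subset_Icc_self
  -- The total variation is invariant under dilation, so the only dependence on `y` is through `(b /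
  -- y) ^ κ`.
  have hnorm : ∫ t : ℝ, ‖deriv g t‖ = ∫ t : ℝ, ‖deriv H t‖ := by
    have h1 : ∀ t, ‖deriv g t‖ = y * ‖deriv H (y * t)‖ := fun t => by
      rw [hg, deriv_comp_mul_left, norm_smul, Real.norm_of_nonneg hy0.le]
    simp only [h1]
    rw [integral_const_mul, Measure.integral_comp_mul_left (fun t => ‖deriv H t‖) y,
      abs_of_pos (inv_pos.2 hy0), smul_eq_mul, mul_inv_cancel_left₀ hy0.ne']
  rw [hsum, hmel, Real.norm_of_nonneg (by positivity), sub_neg_eq_add, neg_add_eq_sub, norm_sub_rev,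
    ← integral_sub hint1 hint2]
  have hbd : ∀ t, ‖deriv g t * S t - deriv g t * (A * (t : ℂ) ^ μ)‖ ≤
      |K| * (b / y) ^ κ * ‖deriv g t‖ := by
    intro t
    rw [← mul_sub, norm_mul]
    by_cases h0 : deriv g t = 0
    · rw [h0, norm_zero, zero_mul, mul_zero]
    · have h1 := hdz t h0
      have hta : max T₀ 1 ≤ t := by
        refine le_trans ?_ h1.1
        rw [le_div_iff₀ hy0]
        linarith
      have ht0 : 0 < t := by linarith [le_max_right T₀ 1]
      have h2 := hT₀ t ((le_max_left _ _).trans hta)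
      rw [Real.norm_of_nonneg (by positivity)] at h2
      rw [mul_comm]
      refine mul_le_mul_of_nonneg_right (h2.trans ?_) (norm_nonneg _)
      refine mul_le_mul (le_abs_self K) (Real.rpow_le_rpow ht0.le h1.2 hκ) (by positivity)
        (abs_nonneg K)
  calc ‖∫ t in Ioc 0 B, (deriv g t * S t - deriv g t * (A * (t : ℂ) ^ μ))‖
      ≤ ∫ t in Ioc 0 B, |K| * (b / y) ^ κ * ‖deriv g t‖ :=
        norm_integral_le_of_norm_le (hgi.norm.const_mul _).integrableOn
          (Eventually.of_forall hbd)
    _ ≤ ∫ t, |K| * (b / y) ^ κ * ‖deriv g t‖ :=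
        setIntegral_le_integral (hgi.norm.const_mul _)
          (Eventually.of_forall fun t => by positivity)
    _ = _ := by
        rw [integral_const_mul, hnorm, Real.div_rpow hb0.le hy0.le, Real.rpow_neg hy0.le]
        ring

lemma sum_Icc_eq_c2Sum (c : ℕ → ℕ → ℂ) (T : ℝ) :
    ∑ k ∈ Finset.Icc 0 ⌊T⌋₊, (if k.Prime then c k 2 * (Real.log k : ℂ) else 0) = c2Sum c T := by
  rw [c2Sum, Finset.sum_filter]
  rfl

/-- The asymptotic formula for the extra term. -/
lemma extraTerm_asymptotic {N : ℕ} {c : ℕ → ℕ → ℂ} {h : ℝ → ℂ}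
    (hS : {p : ℕ | p.Prime ∧ c p N = 0}.Finite) (hh : IsTest h) {A μ : ℂ} {ν : ℝ} (hν : 0 ≤ ν)
    (hμ : ν < μ.re)
    (hc : ∀ ε : ℝ, 0 < ε → (fun T : ℝ => c2Sum c T - A * (T : ℂ) ^ μ)
      =O[atTop] fun T : ℝ => T ^ (ν + ε)) {ε : ℝ} (hε : 0 < ε) :
    (fun x : ℝ => extraTerm N c h x - μ * A * mellin (fun u : ℝ => h (x * u ^ 2)) μ)
      =O[𝓝[>] (0 : ℝ)] fun x : ℝ => x ^ (-(ν / 2) - ε) := by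
  -- The substitution `y = √x` halves exponents, so `ν + 2ε` becomes `ν / 2 + ε`.
  have h1 := hc (2 * ε) (by positivity)
  simp only [← sum_Icc_eq_c2Sum] at h1
  have h2 := isBigO_tsum_sub_mellin hh.comp_sq (by positivity) (hν.trans_lt hμ) h1
  have hsqrt : Tendsto Real.sqrt (𝓝[>] 0) (𝓝[>] 0) := by
    refine tendsto_nhdsWithin_iff.2 ⟨?_, ?_⟩
    · have := Real.continuous_sqrt.tendsto 0
      rw [Real.sqrt_zero] at this
      exact this.mono_left nhdsWithin_le_nhds
    · filter_upwards [self_mem_nhdsWithin] with x hx using Real.sqrt_pos.2 hx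
  refine (h2.comp_tendsto hsqrt).congr' ?_ ?_
  · filter_upwards [eventually_extraTerm_eq hS hh, self_mem_nhdsWithin] with x hx hx0
    have hx0' : (0 : ℝ) < x := hx0
    have key : ∀ u : ℝ, 0 < u → (if 0 < √x * u then h ((√x * u) ^ 2) else 0) = h (x * u ^ 2) := by
      intro u hu
      rw [if_pos (mul_pos (Real.sqrt_pos.2 hx0') hu), mul_pow, Real.sq_sqrt hx0'.le]
    rw [Function.comp_apply, hx]
    congr 1
    · refine tsum_congr fun n => ?_
      rcases Nat.eq_zero_or_pos n with rfl | hn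
      · simp [Nat.not_prime_zero]
      · rw [key n (by exact_mod_cast hn)]
    · congr 1
      refine setIntegral_congr_fun measurableSet_Ioi fun u hu => ?_
      simp only [key u hu]
  · filter_upwards [self_mem_nhdsWithin] with x hx
    have hx0 : (0 : ℝ) < x := hx
    rw [Function.comp_apply, Real.sqrt_eq_rpow, ← Real.rpow_mul hx0.le]
    congr 1
    ring

end ZeroRelation

end

noncomputable section

namespace ZeroRelation

open MeasureTheory

/-! ### Combining the two explicit formulas -/

lemma one_isBigO_rpow {α : ℝ} (hα : α ≤ 0) :
    (fun _ => (1 : ℝ)) =O[𝓝[>] (0 : ℝ)] fun x : ℝ => x ^ α := by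
  refine IsBigO.of_bound 1 ?_
  filter_upwards [nhdsWithin_le_nhds (Iio_mem_nhds one_pos), self_mem_nhdsWithin] with x hx1 hx0
  have hx0' : (0 : ℝ) < x := hx0
  have hx1' : x < 1 := hx1
  rw [norm_one, one_mul, Real.norm_of_nonneg (by positivity)]
  exact Real.one_le_rpow_of_pos_of_le_one_of_nonpos hx0' hx1'.le hα

/-- The Euler factors of an element of the Selberg class with a polynomial Euler product. -/
lemma eulerData_of_selberg {L : ℂ → ℂ} {a b : ℕ → ℂ} {N : ℕ} {c : ℕ → ℕ → ℂ}
    (hL : IsSelberg a L) (hc : HasRankEulerProduct a N c) (hb1 : b 1 = 0)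
    (hb : ∀ s : ℂ, 1 < s.re → LSeriesSummable b s)
    (hexp : ∀ s : ℂ, 1 < s.re → Complex.exp (LSeries b s) = L s) : EulerData a b N c where
  one := apply_one_of_exp_LSeries hL.dirichlet hb hexp hb1
  inv p hp := by
    obtain ⟨A, hA0, hA⟩ := exists_forall_norm_le_rpow hL.ramanujan one_pos
    exact mk_mul_eulerCoeff hc (K := A) (fun n hn => by simpa using hA n hn) hp
  logDeriv p hp := mk_logDeriv hL.dirichlet hb hexp hp

/-- The difference of the two explicit formulas. -/
lemma isBigO_explicit_sub {L : ℂ → ℂ} {b : ℕ → ℂ} {φ h : ℝ → ℂ} {G : GammaFactor}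
    (hcl : ∃ m, ClearsPole L m) (hb : ∀ s : ℂ, 1 < s.re → LSeriesSummable b s)
    (hexp : ∀ s : ℂ, 1 < s.re → Complex.exp (LSeries b s) = L s)
    (hφ : ContDiffOn ℝ (⊤ : ℕ∞) φ (Ioi 0)) {C : ℝ} (hC : 0 ≤ C)
    (hφC : ∀ u : ℝ, 0 < u → ‖φ u‖ ≤ C * u ^ 2) (hh : IsTest h) :
    (fun x : ℝ => (((poleOrder L : ℂ) * (∫ u in Ioi (0 : ℝ), h (x * u))
          - zeroSum (completed G L) (fun u => h (x * u)))
        - ((∫ u in Ioi (0 : ℝ), h (x * u) * φ u)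
          - zeroSum completedRiemannZeta (fun u => h (x * u) * φ u)))
      - ∑' n : ℕ, logDiff (coeffs φ) b n * h (x * n)) =O[𝓝[>] (0 : ℝ)] fun _ => (1 : ℝ) := by
  refine ((explicit_formula_selberg hcl hb hexp hh G).sub
    (explicit_formula_zeta hh hφ hC hφC)).congr' ?_ EventuallyEq.rfl
  filter_upwards [self_mem_nhdsWithin] with x hx
  have h1 : (fun n : ℕ => (ArithmeticFunction.vonMangoldt n : ℂ) * (h (x * n) * φ n)) =
      fun n : ℕ => ((ArithmeticFunction.vonMangoldt n : ℂ) * coeffs φ n) * h (x * n) := by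
    funext n
    rw [coeffs]
    ring
  have h2 : ∑' n : ℕ, logDiff (coeffs φ) b n * h (x * n) =
      ∑' n : ℕ, LSeries.logMul b n * h (x * n) -
        ∑' n : ℕ, ((ArithmeticFunction.vonMangoldt n : ℂ) * coeffs φ n) * h (x * n) := by
    rw [← (hh.summable_mul_scale _ hx).tsum_sub (hh.summable_mul_scale _ hx)]
    simp only [logDiff, sub_mul]
  rw [h1, h2]
  ring

end ZeroRelation

end

theorem theorem2 (N : ℕ) (hN : 2 ≤ N) (φ : ℝ → ℂ) (hφ : φ ∈ ZeroRelation.CL N)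
    (L : ℂ → ℂ) (hL : ZeroRelation.IsSelberg (ZeroRelation.coeffs φ) L)
    (G : ZeroRelation.GammaFactor) (hG : ZeroRelation.FunctionalEquation G L)
    (c : ℕ → ℕ → ℂ) (hc : ZeroRelation.HasRankEulerProduct (ZeroRelation.coeffs φ) N c)
    (h : ℝ → ℂ) (hh : h ∈ ZeroRelation.TestFunctions) :
    -- the sums over zeros converge absolutely
    (∀ x : ℝ, 0 < x →
      Summable (ZeroRelation.zeroTerm (ZeroRelation.completed G L) (fun u => h (x * u))) ∧
      Summable (ZeroRelation.zeroTerm completedRiemannZeta (fun u => h (x * u) * φ u))) ∧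
    -- the relation between the zeros
    (∀ ε : ℝ, 0 < ε →
      (fun x : ℝ =>
        ((ZeroRelation.poleOrder L : ℂ) * (∫ u in Ioi (0 : ℝ), h (x * u))
            - ZeroRelation.zeroSum (ZeroRelation.completed G L) (fun u => h (x * u)))
          - ((∫ u in Ioi (0 : ℝ), h (x * u) * φ u)
            - ZeroRelation.zeroSum completedRiemannZeta (fun u => h (x * u) * φ u)
            + ZeroRelation.extraTerm N c h x))
        =O[𝓝[>] (0 : ℝ)] fun x : ℝ => x ^ (-(1 / 3 : ℝ) - ε)) ∧
    -- the size of the extra term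
    (∀ ε : ℝ, 0 < ε →
      (fun x : ℝ => ZeroRelation.extraTerm N c h x)
        =O[𝓝[>] (0 : ℝ)] fun x : ℝ => x ^ (-(1 / 2 : ℝ) - ε)) ∧
    -- the asymptotic formula for the extra term
    (∀ (A μ : ℂ) (ν : ℝ), 0 ≤ ν → ν < μ.re →
      (∀ ε : ℝ, 0 < ε →
        (fun T : ℝ => ZeroRelation.c2Sum c T - A * (T : ℂ) ^ μ)
          =O[atTop] fun T : ℝ => T ^ (ν + ε)) →
      ∀ ε : ℝ, 0 < ε →
        (fun x : ℝ => ZeroRelation.extraTerm N c h x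
            - μ * A * mellin (fun u : ℝ => h (x * u ^ 2)) μ)
          =O[𝓝[>] (0 : ℝ)] fun x : ℝ => x ^ (-(ν / 2) - ε)) := by
  have hT := ZeroRelation.isTest_of_mem hh
  obtain ⟨⟨hφs, -⟩, ⟨C, hC, hφC⟩, -, -⟩ := hφ
  obtain ⟨b, hb0, -, hb⟩ := hL.euler
  have hbs := fun s hs => (hb s hs).1
  have hexp := fun s hs => (hb s hs).2
  have hE := ZeroRelation.eulerData_of_selberg hL hc (hb0 1 not_isPrimePow_one) hbs hexp
  have hD : ∀ ε : ℝ, 0 < ε → ∃ C : ℝ, 0 ≤ C ∧ ∀ n : ℕ,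
      ‖ZeroRelation.logDiff (ZeroRelation.coeffs φ) b n‖ ≤ C * (n : ℝ) ^ ε := fun ε hε =>
    hE.exists_norm_logDiff_le
      (fun ε hε => ZeroRelation.exists_forall_norm_le_rpow hL.ramanujan hε) hb0 hε
  -- For small `x` the finitely many exceptional primes fall below the support of `h`, so `J` is
  -- exactly the part of the `logDiff` sum over squares of primes.
  have hJ := ZeroRelation.eventually_extraTerm_eq_sqPart hc.2 hT
    (D := ZeroRelation.logDiff (ZeroRelation.coeffs φ) b) fun p hp => hE.logDiff_sq hN hp
  refine ⟨fun x hx => ⟨?_, ?_⟩, fun ε hε => ?_, fun ε hε => ?_, fun A μ ν hν hμ hS ε hε => ?_⟩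
  · exact ZeroRelation.summable_zeroTerm_selberg hL.continuation hG hbs hexp (hT.scale hx)
  · exact ZeroRelation.summable_zeroTerm_zeta
      ((hT.scale hx).mul isOpen_Ioi (hT.scale hx).supp hφs)
  -- Two errors are added: the trivial zeros, which are `O(1)`, and the prime powers with exponent
  -- at least 3.
  · have h1 := ((ZeroRelation.isBigO_explicit_sub (G := G) hL.continuation hbs hexp hφs hC.le hφC
      hT).trans (ZeroRelation.one_isBigO_rpow (α := -(1 / 3 : ℝ) - ε) (by linarith))).add
      (ZeroRelation.isBigO_sub_sqPart hT hD (fun n hn => ZeroRelation.logDiff_eq_zero hb0 hn)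
        (fun p hp => hE.logDiff_prime hp) hε)
    refine h1.congr' ?_ EventuallyEq.rfl
    filter_upwards [hJ] with x hx
    rw [hx]
    ring
  · exact (ZeroRelation.isBigO_sqPart hT hD hε).congr'
      (hJ.mono fun x hx => hx.symm) EventuallyEq.rfl
  · exact ZeroRelation.extraTerm_asymptotic hc.2 hT hν hμ hS hε
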